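/- Let $F$ be an algebraically closed field (of any characteristic), $G$ a finite group, and $V_1,\dots,V_r$ a complete set of pairwise non-isomorphic finite-dimensional simple $FG$-modules. For each $k$ let $c_k\in F$ be the scalar such that $\sum_{h\in G}hv\otimes h^{-1}w=c_k\,w\otimes v$ for all $v,w\in V_k$. For $n\ge 0$ the wreath Hecke algebra $\mathcal H_n(G)$ is the associative unital $F$-algebra generated by the group $G^n$, elements $s_1,\dots,s_{n-1}$ and $x_1,\dots,x_n$, subject to: the $x_i$ commute with each other and with $G^n$; $s_i^2=1$, $s_is_j=s_js_i$ for $|i-j|>1$, $s_is_{i+1}s_i=s_{i+1}s_is_{i+1}$; $s_ix_i=x_{i+1}s_i-\sum_{h\in G}h^{(i)}(h^{-1})^{(i+1)}$; $s_ix_j=x_js_i$ for $j\ne i,i+1$; and $s_ig={}^{s_i}g\,s_i$ for $g\in G^n$, where $h^{(i)}\in G^n$ is $h$ placed in the $i$-th factor and ${}^{s_i}g$ is $g$ with its $i$-th and $(i+1)$-st entries exchanged. For $u\in\{0,1\}$ let ${}^u\mathcal H_m$ be the $F$-algebra generated by $s_1,\dots,s_{m-1}$ and pairwise commuting $y_1,\dots,y_m$,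 where the $s_i$ satisfy the Coxeter relations above, $s_iy_i=y_{i+1}s_i-u$, and $s_iy_j=y_js_i$ for $j\neq i,i+1$. Put ${}^{c}\mathcal H_m={}^1\mathcal H_m$ if $c\ne0$ and ${}^{c}\mathcal H_m={}^0\mathcal H_m$ if $c=0$. For a ${}^{c_k}\mathcal H_m$-module $L$, the space $V_k^{\otimes m}\otimes L$ is an $\mathcal H_m(G)$-module: $G^m$ acts on the factor $V_k^{\otimes m}$; $s_i$ acts by exchanging the $i$-th and $(i+1)$-st tensor factors of $V_k^{\otimes m}$ and by $s_i$ on $L$; $x_i$ acts as $\mathrm{id}\otimes c_ky_i$ if $c_k\neq0$ and as $\mathrm{id}\otimes y_i$ if $c_k=0$. For $\widehat n=(n_1,\dots,n_r)\in\mathbb Z_{\ge0}^r$ with $n_1+\dots+n_r=n$, let $\mathcal H_{\widehat n}(G)=\mathcal H_{n_1}(G)\otimes\cdots\otimes\mathcal H_{n_r}(G)$, identified with the subalgebra of $\mathcal H_n(G)$ generated by $G^n$, $x_1,\dots,x_n$ and the $s_i$ in the Young subgroup $S_{n_1}\times\cdots\times S_{n_r}$, the $k$-th factor being placed in the $k$-th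 block of positions. For ${}^{c_k}\mathcal H_{n_k}$-modules $L_k$ put $$D_{\widehat n}(L_\bullet)=\operatorname{ind}_{\mathcal H_{\widehat n}(G)}^{\mathcal H_n(G)}\Big((V_1^{\otimes n_1}\otimes L_1)\otimes\cdots\otimes(V_r^{\otimes n_r}\otimes L_r)\Big),\qquad \operatorname{ind}_B^AW=A\otimes_BW .$$ **Theorem.** Every simple $\mathcal H_n(G)$-module is isomorphic to $D_{\widehat n}(L_\bullet)$ for some such $\widehat n$ and some simple ${}^{c_k}\mathcal H_{n_k}$-modules $L_k$ ($1\le k\le r$). Conversely, each $D_{\widehat n}(L_\bullet)$ with all $L_k$ simple is a simple $\mathcal H_n(G)$-module. Moreover, for simple $L_k$ and $L'_k$, $D_{\widehat n}(L_\bullet)\cong D_{\widehat n'}(L'_\bullet)$ if and only if $\widehat n=\widehat n'$ and $L_k\cong L'_k$ for all $k$. -/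

import Mathlib

universe u v w y z z'

open scoped TensorProduct

noncomputable section

/-! ### The wreath Hecke algebra -/

/-- The simple transposition exchanging `i` and `i + 1` (positions are numbered from `0`). -/
def simpleTransposition {n : ℕ} (i : ℕ) (h : i + 1 < n) : Equiv.Perm (Fin n) :=
  Equiv.swap ⟨i, Nat.lt_of_succ_lt h⟩ ⟨i + 1, h⟩

theorem simpleTransposition_comm {n : ℕ} (i j : ℕ) (hi : i + 1 < n) (hj : j + 1 < n)
    (hij : i + 1 < j) (k : Fin n) :
    simpleTransposition j hj (simpleTransposition i hi k)
      = simpleTransposition i hi (simpleTransposition j hj k) := by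
  simp only [simpleTransposition, Equiv.swap_apply_def, Fin.ext_iff]
  grind

theorem simpleTransposition_braid {n : ℕ} (i : ℕ) (h : i + 1 + 1 < n) (k : Fin n) :
    simpleTransposition i (Nat.lt_of_succ_lt h) (simpleTransposition (i + 1) h
        (simpleTransposition i (Nat.lt_of_succ_lt h) k))
      = simpleTransposition (i + 1) h (simpleTransposition i (Nat.lt_of_succ_lt h)
        (simpleTransposition (i + 1) h k)) := by
  simp only [simpleTransposition, Equiv.swap_apply_def, Fin.ext_iff]
  grind

/-- Generators of the wreath Hecke algebra: the elements of `G ^ n`, the polynomial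
generators, and the simple reflections. -/
inductive WreathHecke.Gen (G : Type v) (n : ℕ) : Type v
  | grp (g : Fin n → G) : WreathHecke.Gen G n
  | x (i : Fin n) : WreathHecke.Gen G n
  | s (i : ℕ) (h : i + 1 < n) : WreathHecke.Gen G n

namespace WreathHecke

/-- A generator, in the free algebra. -/
abbrev pre (F : Type u) [Field F] {G : Type v} {n : ℕ} (a : Gen G n) : FreeAlgebra F (Gen G n) :=
  FreeAlgebra.ι F a

/-- The defining relations of the wreath Hecke algebra. -/
inductive Rel (F : Type u) [Field F] (G : Type v) [Group G] [Fintype G] (n : ℕ) :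
    FreeAlgebra F (Gen G n) → FreeAlgebra F (Gen G n) → Prop
  | grp_one : Rel F G n (pre F (.grp 1)) 1
  | grp_mul (g h : Fin n → G) : Rel F G n (pre F (.grp g) * pre F (.grp h)) (pre F (.grp (g * h)))
  | x_comm (i j : Fin n) : Rel F G n (pre F (.x i) * pre F (.x j)) (pre F (.x j) * pre F (.x i))
  | x_grp (i : Fin n) (g : Fin n → G) :
      Rel F G n (pre F (.x i) * pre F (.grp g)) (pre F (.grp g) * pre F (.x i))
  | s_sq (i : ℕ) (h : i + 1 < n) : Rel F G n (pre F (.s i h) * pre F (.s i h)) 1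
  | s_comm (i j : ℕ) (hi : i + 1 < n) (hj : j + 1 < n) (hij : i + 1 < j) :
      Rel F G n (pre F (.s i hi) * pre F (.s j hj)) (pre F (.s j hj) * pre F (.s i hi))
  | s_braid (i : ℕ) (h : i + 1 + 1 < n) :
      Rel F G n
        (pre F (.s i (Nat.lt_of_succ_lt h)) * pre F (.s (i + 1) h)
          * pre F (.s i (Nat.lt_of_succ_lt h)))
        (pre F (.s (i + 1) h) * pre F (.s i (Nat.lt_of_succ_lt h)) * pre F (.s (i + 1) h))
  | s_x (i : ℕ) (h : i + 1 < n) :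
      Rel F G n (pre F (.s i h) * pre F (.x ⟨i, Nat.lt_of_succ_lt h⟩))
        (pre F (.x ⟨i + 1, h⟩) * pre F (.s i h)
          - ∑ a : G, pre F (.grp (Pi.mulSingle ⟨i, Nat.lt_of_succ_lt h⟩ a
              * Pi.mulSingle ⟨i + 1, h⟩ a⁻¹)))
  | s_x_of_ne (i : ℕ) (h : i + 1 < n) (j : Fin n) (h₁ : j.val ≠ i) (h₂ : j.val ≠ i + 1) :
      Rel F G n (pre F (.s i h) * pre F (.x j)) (pre F (.x j) * pre F (.s i h))
  | s_grp (i : ℕ) (h : i + 1 < n) (g : Fin n → G) :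
      Rel F G n (pre F (.s i h) * pre F (.grp g))
        (pre F (.grp (fun k => g ((simpleTransposition i h)⁻¹ k))) * pre F (.s i h))

end WreathHecke

/-- The wreath Hecke algebra `H_n(G)` over `F`. -/
def WreathHecke (F : Type u) [Field F] (G : Type v) [Group G] [Fintype G] (n : ℕ) :
    Type (max u v) :=
  RingQuot (WreathHecke.Rel F G n)

namespace WreathHecke

variable {F : Type u} [Field F] {G : Type v} [Group G] [Fintype G] {n : ℕ}

instance : Ring (WreathHecke F G n) := inferInstanceAs (Ring (RingQuot (Rel F G n)))

instance : Algebra F (WreathHecke F G n) := inferInstanceAs (Algebra F (RingQuot (Rel F G n)))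

/-- The generators, as elements of `H_n(G)`. -/
def of (F : Type u) [Field F] {G : Type v} [Group G] [Fintype G] {n : ℕ} (a : Gen G n) :
    WreathHecke F G n :=
  RingQuot.mkAlgHom F (Rel F G n) (pre F a)

theorem mk_eq {a b : FreeAlgebra F (Gen G n)} (h : Rel F G n a b) :
    (RingQuot.mkAlgHom F (Rel F G n) a : RingQuot (Rel F G n)) = RingQuot.mkAlgHom F (Rel F G n) b :=
  RingQuot.mkAlgHom_rel F h

/-- The universal property: an assignment of the generators that respects the relations
extends to an algebra homomorphism. -/
def lift {A : Type*} [Ring A] [Algebra F A] (f : Gen G n → A)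
    (hf : ∀ ⦃a b⦄, Rel F G n a b → FreeAlgebra.lift F f a = FreeAlgebra.lift F f b) :
    WreathHecke F G n →ₐ[F] A :=
  RingQuot.liftAlgHom F ⟨FreeAlgebra.lift F f, hf⟩

theorem lift_of {A : Type*} [Ring A] [Algebra F A] (f : Gen G n → A)
    (hf : ∀ ⦃a b⦄, Rel F G n a b → FreeAlgebra.lift F f a = FreeAlgebra.lift F f b)
    (a : Gen G n) : lift f hf (of F a) = f a := by
  exact (RingQuot.liftAlgHom_mkAlgHom_apply F (FreeAlgebra.lift F f) hf _).trans
    (FreeAlgebra.lift_ι_apply f a)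

theorem adjoin_range_of :
    Algebra.adjoin F (Set.range (of F : Gen G n → WreathHecke F G n)) = ⊤ := by
  have h : Set.range (of F : Gen G n → WreathHecke F G n)
      = (RingQuot.mkAlgHom F (Rel F G n)) '' Set.range (FreeAlgebra.ι F) := by
    rw [← Set.range_comp]; rfl
  rw [h]
  refine (AlgHom.map_adjoin (RingQuot.mkAlgHom F (Rel F G n)) _).symm.trans ?_
  rw [FreeAlgebra.adjoin_range_ι, Algebra.map_top]
  exact (AlgHom.range_eq_top _).2 (RingQuot.mkAlgHom_surjective F _)

theorem grp_one : (of F (.grp 1) : WreathHecke F G n) = 1 :=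
  (mk_eq Rel.grp_one).trans (map_one _)

theorem grp_mul (g h : Fin n → G) :
    (of F (.grp g) * of F (.grp h) : WreathHecke F G n) = of F (.grp (g * h)) :=
  (map_mul _ _ _).symm.trans (mk_eq (Rel.grp_mul g h))

theorem x_comm (i j : Fin n) :
    (of F (.x i) * of F (.x j) : WreathHecke F G n) = of F (.x j) * of F (.x i) :=
  (map_mul _ _ _).symm.trans ((mk_eq (Rel.x_comm i j)).trans (map_mul _ _ _))

theorem x_grp (i : Fin n) (g : Fin n → G) :
    (of F (.x i) * of F (.grp g) : WreathHecke F G n) = of F (.grp g) * of F (.x i) :=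
  (map_mul _ _ _).symm.trans ((mk_eq (Rel.x_grp i g)).trans (map_mul _ _ _))

theorem s_sq (i : ℕ) (h : i + 1 < n) :
    (of F (.s i h) * of F (.s i h) : WreathHecke F G n) = 1 :=
  (map_mul _ _ _).symm.trans ((mk_eq (Rel.s_sq i h)).trans (map_one _))

theorem s_comm (i j : ℕ) (hi : i + 1 < n) (hj : j + 1 < n) (hij : i + 1 < j) :
    (of F (.s i hi) * of F (.s j hj) : WreathHecke F G n) = of F (.s j hj) * of F (.s i hi) :=
  (map_mul _ _ _).symm.trans ((mk_eq (Rel.s_comm i j hi hj hij)).trans (map_mul _ _ _))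

theorem s_braid (i : ℕ) (h : i + 1 + 1 < n) :
    (of F (.s i (Nat.lt_of_succ_lt h)) * of F (.s (i + 1) h)
        * of F (.s i (Nat.lt_of_succ_lt h)) : WreathHecke F G n)
      = of F (.s (i + 1) h) * of F (.s i (Nat.lt_of_succ_lt h)) * of F (.s (i + 1) h) := by
  have := mk_eq (F := F) (G := G) (Rel.s_braid i h)
  simp only [map_mul] at this
  exact this

theorem s_x (i : ℕ) (h : i + 1 < n) :
    (of F (.s i h) * of F (.x ⟨i, Nat.lt_of_succ_lt h⟩) : WreathHecke F G n)
      = of F (.x ⟨i + 1, h⟩) * of F (.s i h)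
        - ∑ a : G, of F (.grp (Pi.mulSingle ⟨i, Nat.lt_of_succ_lt h⟩ a
            * Pi.mulSingle ⟨i + 1, h⟩ a⁻¹)) := by
  have := mk_eq (F := F) (G := G) (Rel.s_x i h)
  simp only [map_mul, map_sub, map_sum] at this
  exact this

theorem s_x_of_ne (i : ℕ) (h : i + 1 < n) (j : Fin n) (h₁ : j.val ≠ i) (h₂ : j.val ≠ i + 1) :
    (of F (.s i h) * of F (.x j) : WreathHecke F G n) = of F (.x j) * of F (.s i h) :=
  (map_mul _ _ _).symm.trans ((mk_eq (Rel.s_x_of_ne i h j h₁ h₂)).trans (map_mul _ _ _))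

theorem s_grp (i : ℕ) (h : i + 1 < n) (g : Fin n → G) :
    (of F (.s i h) * of F (.grp g) : WreathHecke F G n)
      = of F (.grp (fun k => g ((simpleTransposition i h)⁻¹ k))) * of F (.s i h) :=
  (map_mul _ _ _).symm.trans ((mk_eq (Rel.s_grp i h g)).trans (map_mul _ _ _))

end WreathHecke

/-! ### Degenerate affine Hecke algebras -/

/-- Generators of the degenerate affine Hecke algebra. -/
inductive DegenerateHecke.Gen (n : ℕ) : Type
  | y (i : Fin n) : DegenerateHecke.Gen n
  | s (i : ℕ) (h : i + 1 < n) : DegenerateHecke.Gen n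

namespace DegenerateHecke

/-- A generator, in the free algebra. -/
abbrev pre (F : Type u) [Field F] {n : ℕ} (a : Gen n) : FreeAlgebra F (Gen n) :=
  FreeAlgebra.ι F a

/-- The defining relations of the degenerate affine Hecke algebra with parameter `q`. -/
inductive Rel (F : Type u) [Field F] (q : F) (n : ℕ) :
    FreeAlgebra F (Gen n) → FreeAlgebra F (Gen n) → Prop
  | y_comm (i j : Fin n) : Rel F q n (pre F (.y i) * pre F (.y j)) (pre F (.y j) * pre F (.y i))
  | s_sq (i : ℕ) (h : i + 1 < n) : Rel F q n (pre F (.s i h) * pre F (.s i h)) 1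
  | s_comm (i j : ℕ) (hi : i + 1 < n) (hj : j + 1 < n) (hij : i + 1 < j) :
      Rel F q n (pre F (.s i hi) * pre F (.s j hj)) (pre F (.s j hj) * pre F (.s i hi))
  | s_braid (i : ℕ) (h : i + 1 + 1 < n) :
      Rel F q n
        (pre F (.s i (Nat.lt_of_succ_lt h)) * pre F (.s (i + 1) h)
          * pre F (.s i (Nat.lt_of_succ_lt h)))
        (pre F (.s (i + 1) h) * pre F (.s i (Nat.lt_of_succ_lt h)) * pre F (.s (i + 1) h))
  | s_y (i : ℕ) (h : i + 1 < n) :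
      Rel F q n (pre F (.s i h) * pre F (.y ⟨i, Nat.lt_of_succ_lt h⟩))
        (pre F (.y ⟨i + 1, h⟩) * pre F (.s i h) - algebraMap F _ q)
  | s_y_of_ne (i : ℕ) (h : i + 1 < n) (j : Fin n) (h₁ : j.val ≠ i) (h₂ : j.val ≠ i + 1) :
      Rel F q n (pre F (.s i h) * pre F (.y j)) (pre F (.y j) * pre F (.s i h))

end DegenerateHecke

/-- The degenerate affine Hecke algebra with parameter `q`: for `q = 1` this is the degenerate
affine Hecke algebra `H_n`, and for `q = 0` it is the smash product of the polynomial algebra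
with the group algebra of the symmetric group. -/
def DegenerateHecke (F : Type u) [Field F] (q : F) (n : ℕ) : Type u :=
  RingQuot (DegenerateHecke.Rel F q n)

namespace DegenerateHecke

variable {F : Type u} [Field F] {q : F} {n : ℕ}

instance : Ring (DegenerateHecke F q n) := inferInstanceAs (Ring (RingQuot (Rel F q n)))

instance : Algebra F (DegenerateHecke F q n) := inferInstanceAs (Algebra F (RingQuot (Rel F q n)))

/-- The generators, as elements of the degenerate affine Hecke algebra. -/
def of (F : Type u) [Field F] (q : F) {n : ℕ} (a : Gen n) : DegenerateHecke F q n :=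
  RingQuot.mkAlgHom F (Rel F q n) (pre F a)

theorem mk_eq {a b : FreeAlgebra F (Gen n)} (h : Rel F q n a b) :
    (RingQuot.mkAlgHom F (Rel F q n) a : RingQuot (Rel F q n)) = RingQuot.mkAlgHom F (Rel F q n) b :=
  RingQuot.mkAlgHom_rel F h

theorem y_comm (i j : Fin n) :
    (of F q (.y i) * of F q (.y j) : DegenerateHecke F q n) = of F q (.y j) * of F q (.y i) :=
  (map_mul _ _ _).symm.trans ((mk_eq (Rel.y_comm i j)).trans (map_mul _ _ _))

theorem s_sq (i : ℕ) (h : i + 1 < n) :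
    (of F q (.s i h) * of F q (.s i h) : DegenerateHecke F q n) = 1 :=
  (map_mul _ _ _).symm.trans ((mk_eq (Rel.s_sq i h)).trans (map_one _))

theorem s_comm (i j : ℕ) (hi : i + 1 < n) (hj : j + 1 < n) (hij : i + 1 < j) :
    (of F q (.s i hi) * of F q (.s j hj) : DegenerateHecke F q n)
      = of F q (.s j hj) * of F q (.s i hi) :=
  (map_mul _ _ _).symm.trans ((mk_eq (Rel.s_comm i j hi hj hij)).trans (map_mul _ _ _))

theorem s_braid (i : ℕ) (h : i + 1 + 1 < n) :
    (of F q (.s i (Nat.lt_of_succ_lt h)) * of F q (.s (i + 1) h)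
        * of F q (.s i (Nat.lt_of_succ_lt h)) : DegenerateHecke F q n)
      = of F q (.s (i + 1) h) * of F q (.s i (Nat.lt_of_succ_lt h)) * of F q (.s (i + 1) h) := by
  have := mk_eq (F := F) (q := q) (Rel.s_braid i h)
  simp only [map_mul] at this
  exact this

theorem s_y (i : ℕ) (h : i + 1 < n) :
    (of F q (.s i h) * of F q (.y ⟨i, Nat.lt_of_succ_lt h⟩) : DegenerateHecke F q n)
      = of F q (.y ⟨i + 1, h⟩) * of F q (.s i h) - algebraMap F _ q := by
  have := mk_eq (F := F) (q := q) (Rel.s_y i h)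
  simp only [map_mul, map_sub, AlgHom.commutes] at this
  exact this

theorem s_y_of_ne (i : ℕ) (h : i + 1 < n) (j : Fin n) (h₁ : j.val ≠ i) (h₂ : j.val ≠ i + 1) :
    (of F q (.s i h) * of F q (.y j) : DegenerateHecke F q n) = of F q (.y j) * of F q (.s i h) :=
  (map_mul _ _ _).symm.trans ((mk_eq (Rel.s_y_of_ne i h j h₁ h₂)).trans (map_mul _ _ _))

end DegenerateHecke

/-! ### The scalar attached to a simple module of the finite group -/

theorem exists_swapScalar {F : Type u} [Field F] [IsAlgClosed F] {G : Type v} [Group G] [Fintype G]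
    {V : Type w} [AddCommGroup V] [Module F V] [FiniteDimensional F V] (ρ : Representation F G V)
    [ρ.IsIrreducible] :
    ∃ c : F, ∀ v₁ v₂ : V, ∑ a : G, ρ a v₁ ⊗ₜ[F] ρ a⁻¹ v₂ = c • (v₂ ⊗ₜ[F] v₁) := by
  -- Schur's lemma for linear maps commuting with the group
  have schur : ∀ T : V →ₗ[F] V, (∀ g x, T (ρ g x) = ρ g (T x)) → ∃ c : F, ∀ x, T x = c • x := by
    intro T hT
    let f : Representation.IntertwiningMap ρ ρ := T.intertwiningMap_of_isIntertwiningMap ρ ρ hT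
    obtain ⟨c, hc⟩ :=
      (Representation.IsIrreducible.algebraMap_intertwiningMap_bijective_of_isAlgClosed
        (ρ := ρ)).2 f
    refine ⟨c, fun x => ?_⟩
    have : f x = (algebraMap F (Representation.IntertwiningMap ρ ρ) c) x := by rw [hc]
    exact this.trans (by simp [Algebra.algebraMap_eq_smul_one])
  have hnt : Nontrivial V := IsSimpleModule.nontrivial (MonoidAlgebra F G) ρ.asModule
  obtain ⟨w₀, hw₀⟩ := exists_ne (0 : V)
  obtain ⟨ψ, hψ⟩ := Module.Projective.exists_dual_ne_zero F hw₀
  have h1 : ∀ (φ : Module.Dual F V) (v : V), ∃ c : F, ∀ x,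
      ∑ a : G, φ (ρ a⁻¹ x) • ρ a v = c • x := by
    intro φ v
    let T : V →ₗ[F] V := ∑ a : G, (φ ∘ₗ ρ a⁻¹).smulRight (ρ a v)
    have hTa : ∀ x, T x = ∑ a : G, φ (ρ a⁻¹ x) • ρ a v := by
      intro x; simp [T]
    obtain ⟨c, hc⟩ := schur T (by
      intro g x
      rw [hTa, hTa, map_sum]
      refine Fintype.sum_equiv (Equiv.mulLeft g⁻¹) _ _ fun a => ?_
      simp [← Module.End.mul_apply, ← map_mul])
    exact ⟨c, fun x => by rw [← hTa, hc]⟩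
  let S : V →ₗ[F] V := ∑ a : G, (ψ ∘ₗ ρ a).smulRight (ρ a⁻¹ w₀)
  have hSa : ∀ v, S v = ∑ a : G, ψ (ρ a v) • ρ a⁻¹ w₀ := by
    intro v; simp [S]
  obtain ⟨c, hc⟩ := schur S (by
    intro g x
    rw [hSa, hSa, map_sum]
    refine Fintype.sum_equiv (Equiv.mulRight g) _ _ fun a => ?_
    simp [← Module.End.mul_apply, ← map_mul])
  have h2 : ∀ (φ : Module.Dual F V) (v x : V),
      ∑ a : G, φ (ρ a⁻¹ x) • ρ a v = (c * (ψ w₀)⁻¹ * φ v) • x := by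
    intro φ v x
    obtain ⟨d, hd⟩ := h1 φ v
    rw [hd]
    congr 1
    have e1 := congrArg ψ (hd w₀)
    have e2 := congrArg φ ((hSa v).symm.trans (hc v))
    simp only [map_sum, map_smul, smul_eq_mul] at e1 e2
    have e3 : d * ψ w₀ = c * φ v := by
      rw [← e1, ← e2]
      exact Finset.sum_congr rfl fun a _ => mul_comm _ _
    field_simp
    exact e3
  refine ⟨c * (ψ w₀)⁻¹, fun v₁ v₂ => ?_⟩
  let b := Module.finBasis F V
  calc ∑ a : G, ρ a v₁ ⊗ₜ[F] ρ a⁻¹ v₂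
      = ∑ a : G, ρ a v₁ ⊗ₜ[F] ∑ i, b.coord i (ρ a⁻¹ v₂) • b i := by
        refine Finset.sum_congr rfl fun a _ => ?_
        congr 1
        simp [b.sum_repr]
    _ = ∑ i, (∑ a : G, b.coord i (ρ a⁻¹ v₂) • ρ a v₁) ⊗ₜ[F] b i := by
        simp only [TensorProduct.tmul_sum, TensorProduct.sum_tmul]
        rw [Finset.sum_comm]
        refine Finset.sum_congr rfl fun i _ => Finset.sum_congr rfl fun a _ => ?_
        rw [TensorProduct.tmul_smul, TensorProduct.smul_tmul']
    _ = (c * (ψ w₀)⁻¹) • (v₂ ⊗ₜ[F] v₁) := by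
        simp only [h2, mul_smul, ← TensorProduct.smul_tmul', ← Finset.smul_sum]
        congr 2
        simp only [← TensorProduct.tmul_smul, ← TensorProduct.tmul_sum]
        congr 1
        simp [b.sum_repr]

/-- The scalar `c` by which `∑ a, a ⊗ a⁻¹` acts on `V ⊗ V`, up to the exchange of the two
tensor factors, for a simple module `V`. -/
def swapScalar {F : Type u} [Field F] [IsAlgClosed F] {G : Type v} [Group G] [Fintype G]
    {V : Type w} [AddCommGroup V] [Module F V] [FiniteDimensional F V] (ρ : Representation F G V)
    [ρ.IsIrreducible] : F :=
  (exists_swapScalar ρ).choose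

theorem swapScalar_spec {F : Type u} [Field F] [IsAlgClosed F] {G : Type v} [Group G] [Fintype G]
    {V : Type w} [AddCommGroup V] [Module F V] [FiniteDimensional F V] (ρ : Representation F G V)
    [ρ.IsIrreducible] (v₁ v₂ : V) :
    ∑ a : G, ρ a v₁ ⊗ₜ[F] ρ a⁻¹ v₂ = swapScalar ρ • (v₂ ⊗ₜ[F] v₁) :=
  (exists_swapScalar ρ).choose_spec v₁ v₂

open Classical in
/-- The parameter of the algebra `ᶜH_m`: it is `0` if `c = 0` and `1` otherwise. -/
def heckeParam {F : Type u} [Field F] (c : F) : F := if c = 0 then 0 else 1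

open Classical in
/-- The factor by which `x i` and `y i` differ: it is `1` if `c = 0` and `c` otherwise. -/
def heckeScale {F : Type u} [Field F] (c : F) : F := if c = 0 then 1 else c

theorem heckeScale_mul_heckeParam {F : Type u} [Field F] (c : F) :
    heckeScale c * heckeParam c = c := by
  unfold heckeScale heckeParam
  split_ifs with h <;> simp [h]

/-- The algebra `ᶜH_m`: the degenerate affine Hecke algebra `H_m` if `c ≠ 0`, and its version
with vanishing parameter if `c = 0`. -/
abbrev TwistedHecke {F : Type u} [Field F] (c : F) (m : ℕ) : Type u :=
  DegenerateHecke F (heckeParam c) m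

/-! ### The module `V^{⊗ m} ⊗ L` -/

namespace WreathHecke

section TensorModule

variable {F : Type u} [Field F] [IsAlgClosed F] {G : Type v} [Group G] [Fintype G]
  {V : Type w} [AddCommGroup V] [Module F V] [FiniteDimensional F V] (ρ : Representation F G V)
  [ρ.IsIrreducible] (m : ℕ)

/-- The operator by which a generator of `H_m(G)` acts on `V^{⊗ m} ⊗ L`: elements of `G ^ m` act
on the tensor power, permutations act diagonally, and `x i` acts as `c • y i` if `c ≠ 0` and as
`y i` if `c = 0`, on the factor `L`. -/
def tensorGen (L : Type z) [AddCommGroup L] [Module F L]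
    [Module (TwistedHecke (swapScalar ρ) m) L] [IsScalarTower F (TwistedHecke (swapScalar ρ) m) L] :
    Gen G m → Module.End F ((⨂[F] _ : Fin m, V) ⊗[F] L)
  | .grp g => TensorProduct.map (PiTensorProduct.map fun i => ρ (g i)) LinearMap.id
  | .x i => heckeScale (swapScalar ρ) •
      TensorProduct.map LinearMap.id
        (Algebra.lsmul F F L (DegenerateHecke.of F _ (.y i) : TwistedHecke (swapScalar ρ) m))
  | .s i h =>
      TensorProduct.map (PiTensorProduct.reindex F (fun _ => V) (simpleTransposition i h)).toLinearMap
        (Algebra.lsmul F F L (DegenerateHecke.of F _ (.s i h) : TwistedHecke (swapScalar ρ) m))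

variable {ρ m} in
theorem sum_grp_tprod (i j : Fin m) (hij : i ≠ j) (f : Fin m → V) :
    ∑ a : G, PiTensorProduct.tprod F
        (fun k => ρ ((Pi.mulSingle i a * Pi.mulSingle j a⁻¹ : Fin m → G) k) (f k))
      = swapScalar ρ • PiTensorProduct.tprod F (fun k => f (Equiv.swap i j k)) := by
  let B : V →ₗ[F] V →ₗ[F] (⨂[F] _ : Fin m, V) :=
    LinearMap.mk₂ F (fun v w =>
      PiTensorProduct.tprod F (Function.update (Function.update f i v) j w))
      (fun v v' w => by
        simp only [Function.update_comm hij, MultilinearMap.map_update_add])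
      (fun c v w => by
        simp only [Function.update_comm hij, MultilinearMap.map_update_smul])
      (fun v w w' => by
        simp only [MultilinearMap.map_update_add])
      (fun c v w => by
        simp only [MultilinearMap.map_update_smul])
  have h := congrArg (TensorProduct.lift B) (swapScalar_spec ρ (f i) (f j))
  simp only [map_sum, map_smul, TensorProduct.lift.tmul] at h
  have e1 : ∀ a : G, B (ρ a (f i)) (ρ a⁻¹ (f j)) = PiTensorProduct.tprod F
        (fun k => ρ ((Pi.mulSingle i a * Pi.mulSingle j a⁻¹ : Fin m → G) k) (f k)) := by
    intro a
    simp only [B, LinearMap.mk₂_apply]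
    congr 1
    funext k
    rcases eq_or_ne k j with rfl | hkj
    · simp [Pi.mulSingle_eq_of_ne hij.symm]
    · rcases eq_or_ne k i with rfl | hki
      · simp [hkj]
      · simp [hkj, hki, Pi.mulSingle_eq_of_ne]
  have e2 : B (f j) (f i) = PiTensorProduct.tprod F (fun k => f (Equiv.swap i j k)) := by
    simp only [B, LinearMap.mk₂_apply]
    congr 1
    funext k
    rcases eq_or_ne k j with rfl | hkj
    · simp
    · rcases eq_or_ne k i with rfl | hki
      · simp [hkj]
      · simp [hkj, hki, Equiv.swap_apply_of_ne_of_ne]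
  rw [← e2, ← h]
  exact Finset.sum_congr rfl fun a _ => (e1 a).symm

variable {ρ m} in
theorem tensorGen_rel (L : Type z) [AddCommGroup L] [Module F L]
    [Module (TwistedHecke (swapScalar ρ) m) L] [IsScalarTower F (TwistedHecke (swapScalar ρ) m) L]
    ⦃a b : FreeAlgebra F (Gen G m)⦄ (hab : Rel F G m a b) :
    FreeAlgebra.lift F (tensorGen ρ m L) a = FreeAlgebra.lift F (tensorGen ρ m L) b := by
  have ext : ∀ A B : Module.End F ((⨂[F] _ : Fin m, V) ⊗[F] L),
      (∀ (f : Fin m → V) (l : L), A (PiTensorProduct.tprod F f ⊗ₜ l)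
        = B (PiTensorProduct.tprod F f ⊗ₜ l)) → A = B := by
    intro A B h
    refine TensorProduct.ext (PiTensorProduct.ext (MultilinearMap.ext fun f => ?_))
    exact LinearMap.ext fun l => h f l
  have hs : ∀ (i : ℕ) (h : i + 1 < m) (f : Fin m → V) (l : L),
      tensorGen ρ m L (.s i h) (PiTensorProduct.tprod F f ⊗ₜ l)
        = PiTensorProduct.tprod F (fun k => f (simpleTransposition i h k)) ⊗ₜ
          ((DegenerateHecke.of F _ (.s i h) : TwistedHecke (swapScalar ρ) m) • l) := by
    intro i h f l
    simp [tensorGen, simpleTransposition]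
  have hg : ∀ (g : Fin m → G) (f : Fin m → V) (l : L),
      tensorGen ρ m L (.grp g) (PiTensorProduct.tprod F f ⊗ₜ l)
        = PiTensorProduct.tprod F (fun k => ρ (g k) (f k)) ⊗ₜ l := by
    intro g f l
    simp [tensorGen]
  have hx : ∀ (i : Fin m) (t : ⨂[F] _ : Fin m, V) (l : L),
      tensorGen ρ m L (.x i) (t ⊗ₜ l)
        = heckeScale (swapScalar ρ) •
          (t ⊗ₜ ((DegenerateHecke.of F _ (.y i) : TwistedHecke (swapScalar ρ) m) • l)) := by
    intro i t l
    simp [tensorGen]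
  have hsw : ∀ (i : ℕ) (h : i + 1 < m), (simpleTransposition i h)⁻¹ = simpleTransposition i h :=
    fun i h => Equiv.swap_inv _ _
  refine ext _ _ fun f l => ?_
  cases hab with
  | grp_one =>
    simp only [FreeAlgebra.lift_ι_apply, map_one, hg]
    simp
  | grp_mul g h =>
    simp only [FreeAlgebra.lift_ι_apply, map_mul, Module.End.mul_apply, hg, Pi.mul_apply]
  | x_comm i j =>
    simp only [FreeAlgebra.lift_ι_apply, map_mul, Module.End.mul_apply, hx, map_smul, ← mul_smul,
      DegenerateHecke.y_comm i j]
  | x_grp i g =>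
    simp only [FreeAlgebra.lift_ι_apply, map_mul, Module.End.mul_apply, hx, hg, map_smul]
  | s_sq i h =>
    simp only [FreeAlgebra.lift_ι_apply, map_mul, map_one, Module.End.mul_apply, hs, ← mul_smul,
      DegenerateHecke.s_sq]
    simp [simpleTransposition]
  | s_comm i j hi hj hij =>
    simp only [FreeAlgebra.lift_ι_apply, map_mul, Module.End.mul_apply, hs, ← mul_smul,
      DegenerateHecke.s_comm i j hi hj hij]
    congr 2
    funext k
    congr 1
    exact simpleTransposition_comm i j hi hj hij k
  | s_braid i h =>
    simp only [FreeAlgebra.lift_ι_apply, map_mul, Module.End.mul_apply, hs, ← mul_smul,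
      ← mul_assoc, DegenerateHecke.s_braid i h]
    congr 2
    funext k
    congr 1
    exact simpleTransposition_braid i h k
  | s_x i h =>
    simp only [FreeAlgebra.lift_ι_apply, map_mul, map_sub, map_sum, Module.End.mul_apply, hs, hx,
      hg, LinearMap.sub_apply, LinearMap.sum_apply, map_smul, ← mul_smul,
      DegenerateHecke.s_y i h, sub_smul, algebraMap_smul, TensorProduct.tmul_sub, smul_sub,
      TensorProduct.tmul_smul]
    rw [← TensorProduct.sum_tmul, sum_grp_tprod _ _ (by simp [Fin.ext_iff]),
      ← TensorProduct.smul_tmul', heckeScale_mul_heckeParam]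
    rfl
  | s_x_of_ne i h j h₁ h₂ =>
    simp only [FreeAlgebra.lift_ι_apply, map_mul, Module.End.mul_apply, hs, hx, map_smul,
      ← mul_smul, DegenerateHecke.s_y_of_ne i h j h₁ h₂]
  | s_grp i h g =>
    simp only [FreeAlgebra.lift_ι_apply, map_mul, Module.End.mul_apply, hs, hg, hsw]

variable {m} in
/-- The module `V^{⊗ m} ⊗ L` over `H_m(G)`, for a module `L` over `ᶜH_m`. -/
def tensorRep (L : Type z) [AddCommGroup L] [Module F L]
    [Module (TwistedHecke (swapScalar ρ) m) L] [IsScalarTower F (TwistedHecke (swapScalar ρ) m) L] :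
    WreathHecke F G m →ₐ[F] Module.End F ((⨂[F] _ : Fin m, V) ⊗[F] L) :=
  lift (tensorGen ρ m L) (tensorGen_rel L)

end TensorModule

/-! ### Parabolic subalgebras -/

section Parabolic

/-- The embedding of `m` positions as the block `a, …, a + m - 1`. -/
def shift {a m n : ℕ} (h : a + m ≤ n) (j : Fin m) : Fin n := ⟨a + j, by omega⟩

theorem shift_injective {a m n : ℕ} (h : a + m ≤ n) : Function.Injective (shift h) := by
  intro i j hij
  simpa [shift, Fin.ext_iff] using hij

/-- The generators of `H_m(G)`, shifted into the block `a, …, a + m - 1` of `H_n(G)`. -/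
def blockGen (F : Type u) [Field F] (G : Type v) [Group G] [Fintype G] {a m n : ℕ}
    (h : a + m ≤ n) : Gen G m → WreathHecke F G n
  | .grp g => of F (.grp (Function.extend (shift h) g 1))
  | .x i => of F (.x (shift h i))
  | .s i hi => of F (.s (a + i) (by omega))

theorem extend_mulSingle {G : Type v} [Group G] {a m n : ℕ} (h : a + m ≤ n) (i : Fin m) (c : G) :
    Function.extend (shift h) (Pi.mulSingle i c : Fin m → G) 1 = Pi.mulSingle (shift h i) c := by
  funext k
  by_cases hk : ∃ j, shift h j = k
  · obtain ⟨j, rfl⟩ := hk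
    rw [(shift_injective h).extend_apply]
    simp [Pi.mulSingle_apply, (shift_injective h).eq_iff]
  · rw [Function.extend_apply' _ _ _ hk]
    have : k ≠ shift h i := fun e => hk ⟨i, e.symm⟩
    simp [this]

variable {F : Type u} [Field F] {G : Type v} [Group G] [Fintype G]

theorem blockGen_rel {a m n : ℕ} (h : a + m ≤ n) ⦃p q : FreeAlgebra F (Gen G m)⦄
    (hpq : Rel F G m p q) :
    FreeAlgebra.lift F (blockGen F G h) p = FreeAlgebra.lift F (blockGen F G h) q := by
  cases hpq with
  | grp_one => simp [blockGen, Function.extend_one, grp_one]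
  | grp_mul g g' =>
    simp only [FreeAlgebra.lift_ι_apply, map_mul, blockGen, grp_mul]
    rw [← Function.extend_mul, mul_one]
  | x_comm i j => simp only [FreeAlgebra.lift_ι_apply, map_mul, blockGen, x_comm (shift h i)]
  | x_grp i g => simp only [FreeAlgebra.lift_ι_apply, map_mul, blockGen, x_grp]
  | s_sq i hi => simp only [FreeAlgebra.lift_ι_apply, map_mul, map_one, blockGen, s_sq]
  | s_comm i j hi hj hij =>
    simp only [FreeAlgebra.lift_ι_apply, map_mul, blockGen]
    exact s_comm _ _ _ _ (by omega)
  | s_braid i hi =>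
    simp only [FreeAlgebra.lift_ι_apply, map_mul, blockGen]
    exact s_braid (a + i) (by omega)
  | s_x i hi =>
    simp only [FreeAlgebra.lift_ι_apply, map_mul, map_sub, map_sum, blockGen]
    refine (s_x (a + i) (by omega)).trans ?_
    congr 1
    refine Finset.sum_congr rfl fun c _ => ?_
    congr 2
    have := Function.extend_mul (shift h) (Pi.mulSingle ⟨i, Nat.lt_of_succ_lt hi⟩ c : Fin m → G)
      (Pi.mulSingle ⟨i + 1, hi⟩ c⁻¹) 1 1
    rw [mul_one, extend_mulSingle, extend_mulSingle] at this
    exact this.symm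
  | s_x_of_ne i hi j h₁ h₂ =>
    simp only [FreeAlgebra.lift_ι_apply, map_mul, blockGen]
    exact s_x_of_ne _ _ _ (by simp [shift, h₁]) (by simp [shift]; omega)
  | s_grp i hi g =>
    simp only [FreeAlgebra.lift_ι_apply, map_mul, blockGen, s_grp]
    congr 3
    funext k
    simp only [simpleTransposition, Equiv.swap_inv]
    have e1 : (⟨a + i, by omega⟩ : Fin n) = shift h ⟨i, Nat.lt_of_succ_lt hi⟩ := rfl
    have e2 : (⟨a + i + 1, by omega⟩ : Fin n) = shift h ⟨i + 1, hi⟩ := rfl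
    rw [e1, e2]
    by_cases hk : ∃ j, shift h j = k
    · obtain ⟨j, rfl⟩ := hk
      rw [← (shift_injective h).map_swap, (shift_injective h).extend_apply,
        (shift_injective h).extend_apply]
    · rw [Equiv.swap_apply_of_ne_of_ne (fun e => hk ⟨_, e.symm⟩) (fun e => hk ⟨_, e.symm⟩),
        Function.extend_apply' _ _ _ hk, Function.extend_apply' _ _ _ hk]

/-- The homomorphism `H_m(G) → H_n(G)` onto the subalgebra attached to the
block `a, …, a + m - 1` of positions. -/
def blockHom (F : Type u) [Field F] (G : Type v) [Group G] [Fintype G] {a m n : ℕ}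
    (h : a + m ≤ n) : WreathHecke F G m →ₐ[F] WreathHecke F G n :=
  lift (blockGen F G h) (blockGen_rel h)

theorem commute_of_gen {m m' : ℕ} {A : Type*} [Ring A] [Algebra F A]
    (φ : WreathHecke F G m →ₐ[F] A) (ψ : WreathHecke F G m' →ₐ[F] A)
    (H : ∀ a b, Commute (φ (of F a)) (ψ (of F b))) (p : WreathHecke F G m)
    (q : WreathHecke F G m') : Commute (φ p) (ψ q) := by
  have h1 : ∀ a, ∀ q, Commute (φ (of F a)) (ψ q) := by
    intro a q
    have hq : q ∈ Algebra.adjoin F (Set.range (of F : Gen G m' → WreathHecke F G m')) := by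
      rw [adjoin_range_of]; trivial
    induction hq using Algebra.adjoin_induction with
    | mem x hx => obtain ⟨b, rfl⟩ := hx; exact H a b
    | algebraMap r => rw [AlgHom.commutes]; exact (Algebra.commutes r _).symm
    | add x y _ _ hx hy => rw [map_add]; exact hx.add_right hy
    | mul x y _ _ hx hy => rw [map_mul]; exact hx.mul_right hy
  have hp : p ∈ Algebra.adjoin F (Set.range (of F : Gen G m → WreathHecke F G m)) := by
    rw [adjoin_range_of]; trivial
  induction hp using Algebra.adjoin_induction with
  | mem x hx => obtain ⟨b, rfl⟩ := hx; exact h1 b q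
  | algebraMap r => rw [AlgHom.commutes]; exact Algebra.commutes r _
  | add x y _ _ hx hy => rw [map_add]; exact hx.add_left hy
  | mul x y _ _ hx hy => rw [map_mul]; exact hx.mul_left hy

theorem blockHom_commute {a m b m' n : ℕ} (h : a + m ≤ n) (h' : b + m' ≤ n) (hab : a + m ≤ b)
    (p : WreathHecke F G m) (q : WreathHecke F G m') :
    Commute (blockHom F G h p) (blockHom F G h' q) := by
  have grp_s : ∀ (g : Fin n → G) (i : ℕ) (hi : i + 1 < n),
      g ⟨i, Nat.lt_of_succ_lt hi⟩ = g ⟨i + 1, hi⟩ →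
      Commute (of F (.s i hi) : WreathHecke F G n) (of F (.grp g)) := by
    intro g i hi hgi
    refine (s_grp i hi g).trans ?_
    congr 3
    funext k
    simp only [simpleTransposition, Equiv.swap_inv, Equiv.swap_apply_def]
    split_ifs with h1 h2
    · rw [h1, hgi]
    · rw [h2, hgi]
    · rfl
  have out : ∀ (g : Fin m → G) (k : Fin n), a + m ≤ k.val →
      Function.extend (shift h) g 1 k = 1 := by
    intro g k hk
    refine Function.extend_apply' _ _ _ ?_
    rintro ⟨j, rfl⟩
    simp only [shift] at hk
    omega
  have out' : ∀ (g : Fin m' → G) (k : Fin n), k.val < b →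
      Function.extend (shift h') g 1 k = 1 := by
    intro g k hk
    refine Function.extend_apply' _ _ _ ?_
    rintro ⟨j, rfl⟩
    simp only [shift] at hk
    omega
  refine commute_of_gen _ _ ?_ p q
  intro c d
  simp only [blockHom, lift_of]
  rcases c with g | i | ⟨i, hi⟩ <;> rcases d with g' | j | ⟨j, hj⟩ <;> simp only [blockGen]
  · refine (grp_mul _ _).trans (Eq.trans ?_ (grp_mul _ _).symm)
    congr 2
    funext k
    simp only [Pi.mul_apply]
    rcases lt_or_ge k.val (a + m) with hk | hk
    · rw [out' g' k (by omega)]; simp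
    · rw [out g k hk]; simp
  · exact (x_grp _ _).symm
  · refine (grp_s _ _ _ ?_).symm
    rw [out, out] <;> simp <;> omega
  · exact x_grp _ _
  · exact x_comm _ _
  · exact (s_x_of_ne _ _ _ (by simp [shift]; omega) (by simp [shift]; omega)).symm
  · refine grp_s _ _ _ ?_
    rw [out', out'] <;> simp <;> omega
  · exact s_x_of_ne _ _ _ (by simp [shift]; omega) (by simp [shift]; omega)
  · exact s_comm _ _ _ _ (by omega)

theorem offset_add_le {r n : ℕ} (ν : Fin r → ℕ) (hν : ∑ k, ν k = n) (k : Fin r) :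
    (∑ l ∈ Finset.Iio k, ν l) + ν k ≤ n := by
  rw [Finset.sum_Iio_add_eq_sum_Iic, ← hν]
  exact Finset.sum_le_sum_of_subset (Finset.subset_univ _)

theorem offset_le_offset {r : ℕ} (ν : Fin r → ℕ) {k l : Fin r} (h : k < l) :
    (∑ j ∈ Finset.Iio k, ν j) + ν k ≤ ∑ j ∈ Finset.Iio l, ν j := by
  rw [Finset.sum_Iio_add_eq_sum_Iic]
  exact Finset.sum_le_sum_of_subset fun j hj => by
    simp only [Finset.mem_Iic, Finset.mem_Iio] at *
    exact lt_of_le_of_lt hj h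

theorem prod_ofFn_mul {A : Type*} [Monoid A] {r : ℕ} (f g : Fin r → A)
    (h : ∀ i j, i < j → Commute (f j) (g i)) :
    (List.ofFn fun i => f i * g i).prod = (List.ofFn f).prod * (List.ofFn g).prod := by
  induction r with
  | zero => simp
  | succ r ih =>
    simp only [List.ofFn_succ, List.prod_cons]
    rw [ih (fun i => f i.succ) (fun i => g i.succ) (fun i j hij => h _ _ (by simpa using hij))]
    have : Commute (List.ofFn fun i : Fin r => f i.succ).prod (g 0) := by
      refine Commute.list_prod_left _ _ fun x hx => ?_
      obtain ⟨i, rfl⟩ := (List.mem_ofFn' _ _).1 hx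
      exact h _ _ (Fin.succ_pos i)
    simp only [mul_assoc]
    congr 1
    rw [← mul_assoc, ← this.eq, mul_assoc]

/-- The algebra `H_ν(G) = H_{ν₁}(G) ⊗ ⋯ ⊗ H_{ν_r}(G)`. Through `parabolicHom` it is identified
with the subalgebra of `H_n(G)` generated by `G ^ n`, the `x i`, and the simple reflections in the
Young subgroup `S_ν = S_{ν₁} × ⋯ × S_{ν_r}`. -/
abbrev Parabolic (F : Type u) [Field F] (G : Type v) [Group G] [Fintype G] {r : ℕ}
    (ν : Fin r → ℕ) : Type (max u v) :=
  ⨂[F] k, WreathHecke F G (ν k)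

/-- The canonical homomorphism `H_ν(G) → H_n(G)`, for a composition `ν` of `n`: it sends
`a₁ ⊗ ⋯ ⊗ a_r` to the product of the `a_k`, each shifted into the `k`-th block of positions. -/
def parabolicHom (F : Type u) [Field F] (G : Type v) [Group G] [Fintype G] {r n : ℕ}
    (ν : Fin r → ℕ) (hν : ∑ k, ν k = n) : Parabolic F G ν →ₐ[F] WreathHecke F G n :=
  PiTensorProduct.liftAlgHom
    ((MultilinearMap.mkPiAlgebraFin F r (WreathHecke F G n)).compLinearMap
      fun k => (blockHom F G (offset_add_le ν hν k)).toLinearMap)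
    (by simp)
    (fun p q => by
      simp only [MultilinearMap.compLinearMap_apply, MultilinearMap.mkPiAlgebraFin_apply,
        Pi.mul_apply, AlgHom.toLinearMap_apply, map_mul]
      exact prod_ofFn_mul _ _ fun i j hij =>
        (blockHom_commute _ _ (offset_le_offset ν hij) _ _).symm)

theorem parabolicHom_tprod {r n : ℕ} (ν : Fin r → ℕ) (hν : ∑ k, ν k = n)
    (p : ∀ k, WreathHecke F G (ν k)) :
    parabolicHom F G ν hν (PiTensorProduct.tprod F p)
      = (List.ofFn fun k => blockHom F G (offset_add_le ν hν k) (p k)).prod := by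
  simp [parabolicHom]

theorem blockHom_mem_range {r n : ℕ} (ν : Fin r → ℕ) (hν : ∑ k, ν k = n) (k : Fin r)
    (p : WreathHecke F G (ν k)) :
    blockHom F G (offset_add_le ν hν k) p ∈ (parabolicHom F G ν hν).range := by
  refine ⟨PiTensorProduct.tprod F (Pi.mulSingle k p), ?_⟩
  have key : ∀ {A : Type (max u v)} [Monoid A] {r : ℕ} (k : Fin r) (a : A),
      (List.ofFn (Pi.mulSingle k a : Fin r → A)).prod = a := by
    intro A _ r
    induction r with
    | zero => intro k; exact k.elim0
    | succ r ih =>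
      intro k a
      rw [List.ofFn_succ, List.prod_cons]
      induction k using Fin.cases with
      | zero =>
        simp
      | succ k =>
        have : (fun i : Fin r => (Pi.mulSingle k.succ a : Fin (r + 1) → A) i.succ)
            = Pi.mulSingle k a := by
          funext i
          simp [Pi.mulSingle_apply]
        rw [this, ih, Pi.mulSingle_eq_of_ne (Fin.succ_ne_zero k).symm, one_mul]
  refine (parabolicHom_tprod ν hν _).trans ?_
  refine Eq.trans ?_ (key k (blockHom F G (offset_add_le ν hν k) p))
  congr 2
  funext l
  rcases eq_or_ne l k with rfl | h
  · simp
  · simp [h]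

/-- The image of `H_ν(G)` in `H_n(G)` is the subalgebra generated by `G ^ n`, the `x i`, and the
simple reflections in the Young subgroup `S_ν`. -/
theorem parabolicHom_range {r n : ℕ} (ν : Fin r → ℕ) (hν : ∑ k, ν k = n) :
    (parabolicHom F G ν hν).range = Algebra.adjoin F
      ({a | ∃ g, a = of F (.grp g)} ∪ {a | ∃ i, a = of F (.x i)} ∪
        {a | ∃ (i : ℕ) (hi : i + 1 < n), (∃ k, ∑ l ∈ Finset.Iio k, ν l ≤ i ∧
          i + 1 < (∑ l ∈ Finset.Iio k, ν l) + ν k) ∧ a = of F (.s i hi)}) := by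
  have cover : ∀ i : Fin n, ∃ k, ∃ j : Fin (ν k), shift (offset_add_le ν hν k) j = i := by
    intro i
    by_contra hcon
    push Not at hcon
    have step : ∀ m : ℕ, ∀ k : Fin r, k.val = m → (∑ l ∈ Finset.Iio k, ν l) + ν k ≤ i.val := by
      intro m
      induction m with
      | zero =>
        intro k hk
        have h0 : Finset.Iio k = ∅ := by
          ext l
          simp [Fin.lt_def, hk]
        by_contra h
        refine hcon k ⟨i.val, ?_⟩ ?_
        · rw [h0, Finset.sum_empty] at h; omega
        · simp [shift, h0]
      | succ m ih =>
        intro k hk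
        have h1 := ih ⟨m, by omega⟩ rfl
        have h0 : Finset.Iio k = Finset.Iic (⟨m, by omega⟩ : Fin r) := by
          ext l
          simp only [Finset.mem_Iio, Finset.mem_Iic, Fin.lt_def, Fin.le_def, hk]
          omega
        rw [Finset.sum_Iio_add_eq_sum_Iic, ← h0] at h1
        by_contra h
        refine hcon k ⟨i.val - ∑ l ∈ Finset.Iio k, ν l, by omega⟩ ?_
        simp only [shift, Fin.ext_iff]
        omega
    rcases r with _ | r
    · simp only [Finset.univ_eq_empty, Finset.sum_empty] at hν
      exact absurd i.isLt (by omega)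
    · have h := step r (Fin.last r) rfl
      rw [Finset.sum_Iio_add_eq_sum_Iic] at h
      have h0 : Finset.Iic (Fin.last r) = Finset.univ := by
        ext l
        simp [Fin.le_last]
      rw [h0, hν] at h
      exact absurd i.isLt (by omega)
  apply le_antisymm
  · rintro _ ⟨z, rfl⟩
    have hb : ∀ k p, blockHom F G (offset_add_le ν hν k) p ∈ Algebra.adjoin F
      ({a : WreathHecke F G n | ∃ g, a = of F (.grp g)} ∪ {a | ∃ i, a = of F (.x i)} ∪
        {a | ∃ (i : ℕ) (hi : i + 1 < n), (∃ k, ∑ l ∈ Finset.Iio k, ν l ≤ i ∧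
          i + 1 < (∑ l ∈ Finset.Iio k, ν l) + ν k) ∧ a = of F (.s i hi)}) := by
      intro k p
      have hp : p ∈ Algebra.adjoin F (Set.range (of F : Gen G (ν k) → WreathHecke F G (ν k))) := by
        rw [adjoin_range_of]; trivial
      induction hp using Algebra.adjoin_induction with
      | mem x hx =>
        obtain ⟨b, rfl⟩ := hx
        refine Algebra.subset_adjoin ?_
        rw [blockHom, lift_of]
        rcases b with g | i | ⟨i, hi⟩
        · exact Or.inl (Or.inl ⟨_, rfl⟩)
        · exact Or.inl (Or.inr ⟨_, rfl⟩)
        · exact Or.inr ⟨_, _, ⟨k, by omega, by omega⟩, rfl⟩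
      | algebraMap c => rw [AlgHom.commutes]; exact Subalgebra.algebraMap_mem _ c
      | add x y _ _ hx hy => rw [map_add]; exact add_mem hx hy
      | mul x y _ _ hx hy => rw [map_mul]; exact mul_mem hx hy
    change parabolicHom F G ν hν z ∈ _
    induction z using PiTensorProduct.induction_on with
    | smul_tprod c p =>
      rw [map_smul, parabolicHom_tprod]
      refine Subalgebra.smul_mem _ (list_prod_mem fun x hx => ?_) c
      obtain ⟨k, rfl⟩ := (List.mem_ofFn' _ _).1 hx
      exact hb k _
    | add x y hx hy => rw [map_add]; exact add_mem hx hy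
  · refine Algebra.adjoin_le ?_
    rintro _ ((⟨g, rfl⟩ | ⟨i, rfl⟩) | ⟨i, hi, ⟨k, h1, h2⟩, rfl⟩)
    · let φ : (Fin n → G) →* WreathHecke F G n :=
        { toFun := fun g => of F (.grp g), map_one' := grp_one, map_mul' := fun g h => (grp_mul g h).symm }
      have hle : (⊤ : Submonoid (Fin n → G))
          ≤ (parabolicHom F G ν hν).range.toSubmonoid.comap φ := by
        rw [← Submonoid.pi_top Set.univ, ← Submonoid.iSup_map_mulSingle]
        refine iSup_le fun i => ?_
        rintro _ ⟨c, -, rfl⟩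
        obtain ⟨k, j, rfl⟩ := cover i
        have h := blockHom_mem_range (F := F) ν hν k (of F (.grp (Pi.mulSingle j c)))
        rw [blockHom, lift_of] at h
        simp only [blockGen, extend_mulSingle] at h
        exact h
      exact hle (Submonoid.mem_top g)
    · obtain ⟨k, j, rfl⟩ := cover i
      have h := blockHom_mem_range (F := F) (G := G) ν hν k (of F (.x j))
      rw [blockHom, lift_of] at h
      exact h
    · have h := blockHom_mem_range (F := F) (G := G) ν hν k
        (of F (.s (i - ∑ l ∈ Finset.Iio k, ν l) (by omega)))
      rw [blockHom, lift_of] at h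
      simp only [blockGen] at h
      have e : (∑ l ∈ Finset.Iio k, ν l) + (i - ∑ l ∈ Finset.Iio k, ν l) = i := by omega
      simp only [e] at h
      exact h

end Parabolic

end WreathHecke

/-! ### Induced modules and the modules `D_ν(L)` -/

section Induced

variable {F : Type u} [Field F]

/-- The external tensor product of representations of algebras. -/
def outerRep {ι : Type*} {B : ι → Type*} [∀ k, Ring (B k)] [∀ k, Algebra F (B k)]
    {W : ι → Type*} [∀ k, AddCommGroup (W k)] [∀ k, Module F (W k)]
    (σ : ∀ k, B k →ₐ[F] Module.End F (W k)) :
    (⨂[F] k, B k) →ₐ[F] Module.End F (⨂[F] k, W k) :=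
  PiTensorProduct.liftAlgHom
    ((PiTensorProduct.mapMultilinear F W W).compLinearMap fun k => (σ k).toLinearMap)
    (by
      simp only [MultilinearMap.compLinearMap_apply, Pi.one_apply, AlgHom.toLinearMap_apply,
        map_one]
      exact PiTensorProduct.map_one)
    (fun p q => by
      simp only [MultilinearMap.compLinearMap_apply, Pi.mul_apply, AlgHom.toLinearMap_apply,
        map_mul]
      exact PiTensorProduct.map_mul _ _)

/-- The relations `a b ⊗ w = a ⊗ b w` that cut `A ⊗_B W` out of `A ⊗_F W`. -/
def inducedRel {A B : Type*} [Ring A] [Algebra F A] [Ring B] [Algebra F B] (j : B →ₐ[F] A)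
    {W : Type*} [AddCommGroup W] [Module F W] (σ : B →ₐ[F] Module.End F W) :
    Submodule A (A ⊗[F] W) :=
  Submodule.span A
    {t | ∃ (a : A) (b : B) (w : W), t = (a * j b) ⊗ₜ[F] w - a ⊗ₜ[F] σ b w}

/-- The induced module `ind_B^A W = A ⊗_B W`, with `A` acting by left multiplication. Here `A` is
a right `B`-module through `j`. -/
abbrev inducedModule {A B : Type*} [Ring A] [Algebra F A] [Ring B] [Algebra F B] (j : B →ₐ[F] A)
    {W : Type*} [AddCommGroup W] [Module F W] (σ : B →ₐ[F] Module.End F W) :=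
  (A ⊗[F] W) ⧸ inducedRel j σ

end Induced

namespace WreathHecke

/-- The `H_n(G)`-module `D_ν(L)`, induced from the `H_ν(G)`-module
`(V₁^{⊗ ν₁} ⊗ L₁) ⊗ ⋯ ⊗ (V_r^{⊗ ν_r} ⊗ L_r)`. -/
abbrev D {F : Type u} [Field F] [IsAlgClosed F] {G : Type v} [Group G] [Fintype G] {r : ℕ}
    {V : Fin r → Type w} [∀ k, AddCommGroup (V k)] [∀ k, Module F (V k)]
    [∀ k, FiniteDimensional F (V k)] (ρ : ∀ k, Representation F G (V k))
    [∀ k, (ρ k).IsIrreducible] {n : ℕ} (ν : Fin r → ℕ) (hν : ∑ k, ν k = n)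
    (L : Fin r → Type z) [∀ k, AddCommGroup (L k)] [∀ k, Module F (L k)]
    [∀ k, Module (TwistedHecke (swapScalar (ρ k)) (ν k)) (L k)]
    [∀ k, IsScalarTower F (TwistedHecke (swapScalar (ρ k)) (ν k)) (L k)] :=
  inducedModule (parabolicHom F G ν hν) (outerRep fun k => tensorRep (ρ k) (L k))

end WreathHecke

end

noncomputable section

/-! ### Density -/

/-! The proof separates the modules `V k` at each of the `n` positions. Say that a vector has weight
`c`, a labelling of the positions, if the group algebra at position `i` acts on it through its image
in `End (V (c i))`. The group algebra need not be semisimple, but by density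
(`exists_smul_eq_of_pairwise_not_equiv`) it contains elements `ε k` acting as the identity on `V k`
and as zero on the other simple modules. Their products over the positions project to weights, and
permutations permute the weights.

Let `W` be an irreducible module over the parabolic algebra whose weight is the block labelling of
`ν`. A module generated by an image of `W` is the sum of the translates of this image under
permutations (`iSup_permHom_eq_top`). The translate by `s` has the block weight only if `s`
preserves the blocks, so the vectors obtained by projecting to the block weight all lie in the image
of `W` (`weightElt_block_mem_range`). Hence every nonzero submodule meets, and then contains, the
image of `W`: the induced module is simple as soon as `W` maps to it injectively. For the same
reason `ν` and `W` can be recovered from the induced module (`eq_of_inducedModule_equiv`,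
`exists_hom_of_inducedModule_equiv`).

Injectivity of `W → ind W` is obtained without a basis theorem for the wreath Hecke algebra. A
module containing `W` is written down explicitly on copies of `W` indexed by the minimal
representatives of the cosets of the Young subgroup (`exists_extension`). Here `s_i` either acts
inside a copy or exchanges two copies, the latter with no correction term, because `∑ a ⊗ a⁻¹`
vanishes between non-isomorphic simple modules.

For a single block, matrix units of `End V` lift to the group algebra at each position. They show
that `V^{⊗ m} ⊗ L` is irreducible when `L` is simple (`isIrreducibleRep_tensorRep`) and that `L` is
determined by it. Conversely, let `e` be a lift of a rank one idempotent. On a module of constant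
weight the common image of `e` at all positions is a module over the degenerate algebra, since `∑ a
⊗ a⁻¹` acts there as the swap scalar; this gives a nonzero map from some `V^{⊗ m} ⊗ L`
(`exists_tensor_hom_ne_zero`).

Every simple module is reached as follows. It is finite dimensional, because the algebra is finite
over central symmetric polynomials in the `x i` (`finiteDimensional_of_isSimpleModule`). Minimal
orbit dimension then provides a weight vector, which a permutation brings to block order, and next a
vector of the same weight generating a simple module under each block factor. The one-block maps
combine to a nonzero map from an external tensor product (`exists_outerRep_hom_of_orbit`), and
Frobenius reciprocity turns it into a nonzero map between simple modules. -/

/-- The density theorem for a finite family of pairwise non-isomorphic finite dimensional simple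
modules over an algebraically closed field. -/
theorem exists_smul_eq_of_pairwise_not_equiv {F B ι : Type*} [Field F] [IsAlgClosed F] [Ring B]
    [Algebra F B] [Finite ι] {W : ι → Type*} [∀ k, AddCommGroup (W k)] [∀ k, Module F (W k)]
    [∀ k, Module B (W k)] [∀ k, IsScalarTower F B (W k)] [∀ k, FiniteDimensional F (W k)]
    [∀ k, IsSimpleModule B (W k)] (hW : ∀ k l, Nonempty (W k ≃ₗ[B] W l) → k = l)
    (T : ∀ k, Module.End F (W k)) : ∃ b : B, ∀ k w, b • w = T k w := by
  classical
  have := Fintype.ofFinite ι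
  have hcomm : ∀ (f : Module.End B (∀ k, W k)) (m : ∀ k, W k),
      (fun k => T k (f m k)) = f (fun k => T k (m k)) := by
    intro f m
    -- By Schur's lemma the components of `f` between distinct `W l` and `W k` vanish and the
    -- diagonal ones are scalars, so `f` commutes with the diagonal operator `T`.
    have key : ∀ k l, ∃ c : F, ∀ w : W l, f (Pi.single l w) k = if h : l = k then c • (h ▸ w) else 0 := by
      intro k l
      let g : W l →ₗ[B] W k := LinearMap.proj k ∘ₗ f ∘ₗ LinearMap.single B W l
      by_cases h : l = k
      · subst h
        obtain ⟨c, hc⟩ := (IsSimpleModule.algebraMap_end_bijective_of_isAlgClosed F).2 g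
        refine ⟨c, fun w => ?_⟩
        have : g w = c • w := by rw [← hc]; rfl
        simp only [dif_pos]
        exact this
      · refine ⟨0, fun w => ?_⟩
        rcases LinearMap.bijective_or_eq_zero g with hg | hg
        · exact absurd (hW l k ⟨LinearEquiv.ofBijective g hg⟩) h
        · have : g w = 0 := by rw [hg]; rfl
          rw [dif_neg h]
          exact this
    have hm : ∀ m : ∀ k, W k, f m = ∑ l, f (Pi.single l (m l)) := by
      intro m
      conv_lhs => rw [← Finset.univ_sum_single m, map_sum]
    funext k
    rw [hm m, hm fun k => T k (m k)]
    simp only [Finset.sum_apply, map_sum]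
    refine Finset.sum_congr rfl fun l _ => ?_
    obtain ⟨c, hc⟩ := key k l
    rw [hc, hc]
    split_ifs with h
    · subst h; simp
    · simp
  let f : Module.End (Module.End B (∀ k, W k)) (∀ k, W k) :=
    { toFun := fun m k => T k (m k)
      map_add' := fun m m' => by funext k; simp
      map_smul' := fun g m => hcomm g m }
  -- Density yields agreement on a finite set only; basis vectors suffice because the operators are
  -- linear over `F`.
  let b := fun k => Module.finBasis F (W k)
  obtain ⟨a, ha⟩ := jacobson_density f
    (Finset.univ.image fun p : Σ k, Fin (Module.finrank F (W k)) => Pi.single p.1 (b p.1 p.2))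
  refine ⟨a, fun k w => ?_⟩
  have h1 : T k = Algebra.lsmul F F (W k) a := by
    refine (b k).ext fun i => ?_
    have := congrFun (ha (Pi.single k (b k i))
      (Finset.mem_image.2 ⟨⟨k, i⟩, Finset.mem_univ _, rfl⟩)) k
    rw [Pi.smul_apply] at this
    simpa [f] using this
  rw [h1]; rfl

/-! ### Finiteness of simple modules -/

/-- As `A` is finite over `R`, the module `M` is finitely generated over `R`, and so `m M ≠ M` for
some maximal ideal `m` of `R`. The image of `R` is central, hence `m M` is stable under `A` and must
vanish. So `M` is finite over the field `R / m`, which is finite over `F` by the Nullstellensatz. -/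
theorem finite_of_isSimpleModule {F R A M : Type*} [Field F] [CommRing R] [Algebra F R]
    [Algebra.FiniteType F R] [Ring A] [Algebra F A] [Algebra R A] [IsScalarTower F R A]
    [Module.Finite R A] [AddCommGroup M] [Module F M] [Module A M] [IsScalarTower F A M]
    [IsSimpleModule A M] : Module.Finite F M := by
  let : Module R M := Module.compHom M (algebraMap R A)
  have hRA : ∀ (r : R) (m : M), r • m = algebraMap R A r • m := fun _ _ => rfl
  have : IsScalarTower R A M := ⟨fun r a m => by
    rw [hRA, Algebra.smul_def, mul_smul]⟩
  have : IsScalarTower F R M := ⟨fun c r m => by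
    rw [hRA, hRA, Algebra.smul_def c r, map_mul, ← IsScalarTower.algebraMap_apply, mul_smul,
      algebraMap_smul]⟩
  have hnt : Nontrivial M := IsSimpleModule.nontrivial A M
  obtain ⟨m₀, hm₀⟩ := exists_ne (0 : M)
  have : Module.Finite R M := by
    refine Module.Finite.of_surjective ((LinearMap.toSpanSingleton A M m₀).restrictScalars R) ?_
    exact IsSimpleModule.toSpanSingleton_surjective A hm₀
  obtain ⟨N, hN, -⟩ := (eq_top_or_exists_le_coatom (⊥ : Submodule R M)).resolve_left bot_ne_top
  have : IsSimpleModule R (M ⧸ N) := isSimpleModule_iff_isCoatom.2 hN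
  let m := Module.annihilator R (M ⧸ N)
  have : m.IsMaximal := IsSimpleModule.annihilator_isMaximal
  let : Field (R ⧸ m) := Ideal.Quotient.field m
  have hmN : m • (⊤ : Submodule R M) ≤ N := by
    refine Submodule.smul_le.2 fun r hr x _ => ?_
    rw [← Submodule.Quotient.mk_eq_zero, Submodule.Quotient.mk_smul]
    exact Module.mem_annihilator.1 hr _
  let K : Submodule A M :=
    { (m • (⊤ : Submodule R M)) with
      smul_mem' := fun a x hx => by
        change a • x ∈ m • (⊤ : Submodule R M)
        change x ∈ m • (⊤ : Submodule R M) at hx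
        induction hx using Submodule.smul_induction_on' with
        | smul r hr x hx =>
          rw [hRA, ← mul_smul, ← Algebra.commutes, mul_smul, ← hRA]
          exact Submodule.smul_mem_smul hr trivial
        | add x hx y hy h1 h2 => rw [smul_add]; exact add_mem h1 h2 }
  have hmK : ∀ x, x ∈ K ↔ x ∈ m • (⊤ : Submodule R M) := fun _ => Iff.rfl
  have hK : K = ⊥ := by
    refine (eq_bot_or_eq_top K).resolve_right fun h => hN.1 (eq_top_iff.2 fun x _ => hmN ((hmK x).1 ?_))
    rw [h]
    trivial
  have htors : Module.IsTorsionBySet R M m := fun x r => by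
    have h : (r : R) • x ∈ K := (hmK _).2 (Submodule.smul_mem_smul r.2 Submodule.mem_top)
    rw [hK] at h
    exact (Submodule.mem_bot A).1 h
  let : Module (R ⧸ m) M := htors.module
  have : IsScalarTower R (R ⧸ m) M := htors.isScalarTower
  have : IsScalarTower F (R ⧸ m) M := ⟨fun c q x => by
    obtain ⟨q, rfl⟩ := Ideal.Quotient.mk_surjective q
    exact smul_assoc c q x⟩
  have : Module.Finite (R ⧸ m) M := Module.Finite.of_restrictScalars_finite R _ _
  have : Algebra.FiniteType F (R ⧸ m) := inferInstance
  have : Module.Finite F (R ⧸ m) := finite_of_finite_type_of_isJacobsonRing F (R ⧸ m)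
  exact Module.Finite.trans (R ⧸ m) M

/-! ### Vectors generating simple modules over commuting algebras -/

/-- The vector `v` is zero or generates a simple module. -/
def GeneratesSimple {F B M : Type*} [Field F] [Ring B] [Algebra F B] [AddCommGroup M] [Module F M]
    (σ : B →ₐ[F] Module.End F M) (v : M) : Prop :=
  ∀ b, σ b v ≠ 0 → ∃ b', σ b' (σ b v) = v

section GeneratesSimple

variable {F B M : Type*} [Field F] [Ring B] [Algebra F B] [AddCommGroup M] [Module F M]

/-- A commuting operator `β` carries the relation `σ b' (σ b v) = v` to the same relation for `β v`.
Zero vectors are admitted in the definition so that this needs no injectivity. -/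
theorem GeneratesSimple.map {σ : B →ₐ[F] Module.End F M} {v : M} (h : GeneratesSimple σ v)
    {β : Module.End F M} (hβ : ∀ b, Commute (σ b) β) : GeneratesSimple σ (β v) := by
  have e : ∀ b x, σ b (β x) = β (σ b x) := fun b x => LinearMap.congr_fun (hβ b) x
  intro b hb
  rw [e] at hb
  obtain ⟨b', hb'⟩ := h b fun h0 => hb (by rw [h0, map_zero])
  exact ⟨b', by rw [e, e, hb']⟩

/-- Among the nonzero vectors of the orbit of `v`, one whose own orbit has minimal dimension works:
any nonzero vector it produces has an orbit inside its own and of no smaller dimension. -/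
theorem exists_generatesSimple (σ : B →ₐ[F] Module.End F M) (v : M) (hv : v ≠ 0)
    (hfin : FiniteDimensional F (LinearMap.range ((LinearMap.applyₗ v).comp σ.toLinearMap))) :
    ∃ b, σ b v ≠ 0 ∧ GeneratesSimple σ (σ b v) := by
  let O : M → Submodule F M := fun x => LinearMap.range ((LinearMap.applyₗ x).comp σ.toLinearMap)
  have hO : ∀ x b, O (σ b x) ≤ O x := by
    rintro x b _ ⟨b', rfl⟩
    exact ⟨b' * b, by simp⟩
  have hS : {d | ∃ b, σ b v ≠ 0 ∧ Module.finrank F (O (σ b v)) = d}.Nonempty :=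
    ⟨_, 1, by simpa using hv, rfl⟩
  obtain ⟨b, hb, hd⟩ := Nat.sInf_mem hS
  refine ⟨b, hb, fun b' hb' => ?_⟩
  have hle := Nat.sInf_le (s := {d | ∃ b, σ b v ≠ 0 ∧ Module.finrank F (O (σ b v)) = d})
    ⟨b' * b, by simpa using hb', rfl⟩
  rw [← hd, map_mul, Module.End.mul_apply] at hle
  have : FiniteDimensional F (O (σ b v)) :=
    Submodule.finiteDimensional_of_le (S₂ := O v) (hO v b)
  have := Submodule.eq_of_le_of_finrank_le (hO (σ b v) b') hle
  have hmem : σ b v ∈ O (σ b' (σ b v)) := this ▸ ⟨1, by simp⟩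
  obtain ⟨c, hc⟩ := hmem
  exact ⟨c, hc⟩

/-- The algebras are treated one after another; moving the vector by the next algebra does not spoil
the earlier ones, by `GeneratesSimple.map`. The predicate `P` carries along a property stable under
all the actions, later a weight condition. -/
theorem exists_forall_generatesSimple {ι : Type*} [Finite ι] {B : ι → Type*} [∀ k, Ring (B k)]
    [∀ k, Algebra F (B k)] (σ : ∀ k, B k →ₐ[F] Module.End F M)
    (hσ : ∀ k l, k ≠ l → ∀ a b, Commute (σ k a) (σ l b))
    (hfin : ∀ k v, FiniteDimensional F
      (LinearMap.range ((LinearMap.applyₗ v).comp (σ k).toLinearMap)))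
    (P : M → Prop) (hP : ∀ k b v, P v → P (σ k b v)) {v₀ : M} (hv₀ : v₀ ≠ 0) (hPv₀ : P v₀) :
    ∃ v, v ≠ 0 ∧ P v ∧ ∀ k, GeneratesSimple (σ k) v := by
  classical
  have := Fintype.ofFinite ι
  suffices h : ∀ s : Finset ι, ∃ v, v ≠ 0 ∧ P v ∧ ∀ k ∈ s, GeneratesSimple (σ k) v by
    obtain ⟨v, h1, h2, h3⟩ := h Finset.univ
    exact ⟨v, h1, h2, fun k => h3 k (Finset.mem_univ k)⟩
  intro s
  induction s using Finset.induction_on with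
  | empty => exact ⟨v₀, hv₀, hPv₀, by simp⟩
  | insert k s hk ih =>
    obtain ⟨v, h1, h2, h3⟩ := ih
    obtain ⟨b, hb, hs⟩ := exists_generatesSimple (σ k) v h1 (hfin k v)
    refine ⟨σ k b v, hb, hP k b v h2, fun l hl => ?_⟩
    rcases Finset.mem_insert.1 hl with rfl | hl
    · exact hs
    · exact (h3 l hl).map fun a => hσ l k (by rintro rfl; exact hk ‹_›) a b

/-- The left ideal annihilating a vector. -/
def annVec (σ : B →ₐ[F] Module.End F M) (v : M) : Submodule B B where
  carrier := {b | σ b v = 0}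
  add_mem' := fun {a b} ha hb => by
    simp only [Set.mem_ofPred_eq, map_add, LinearMap.add_apply] at *
    rw [ha, hb, add_zero]
  zero_mem' := by simp
  smul_mem' := fun a b hb => by
    simp only [Set.mem_ofPred_eq, smul_eq_mul, map_mul, Module.End.mul_apply] at *
    rw [hb, map_zero]

theorem mem_annVec {σ : B →ₐ[F] Module.End F M} {v : M} {b : B} :
    b ∈ annVec σ v ↔ σ b v = 0 := Iff.rfl

theorem GeneratesSimple.isSimpleModule {σ : B →ₐ[F] Module.End F M} {v : M}
    (h : GeneratesSimple σ v) (hv : v ≠ 0) : IsSimpleModule B (B ⧸ annVec σ v) := by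
  rw [isSimpleModule_iff_isCoatom]
  refine ⟨fun h1 => hv ?_, fun J hJ => ?_⟩
  · have : (1 : B) ∈ annVec σ v := h1 ▸ trivial
    simpa [mem_annVec] using this
  · obtain ⟨hle, b, hbJ, hb⟩ := SetLike.lt_iff_le_and_exists.1 hJ
    obtain ⟨b', hb'⟩ := h b hb
    have h1 : (1 : B) - b' * b ∈ J := hle (by
      rw [mem_annVec, map_sub, map_mul, map_one, LinearMap.sub_apply, Module.End.mul_apply, hb',
        Module.End.one_apply, sub_self])
    have h2 : (1 : B) ∈ J := by
      simpa using add_mem h1 (J.smul_mem b' hbJ)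
    exact (Ideal.eq_top_iff_one J).2 h2

/-- The orbit map `B / ann v → M`. -/
def orbitMap (σ : B →ₐ[F] Module.End F M) (v : M) : (B ⧸ annVec σ v) →ₗ[F] M :=
  ((annVec σ v).restrictScalars F).liftQ ((LinearMap.applyₗ v).comp σ.toLinearMap)
    (fun _ hb => hb)

theorem orbitMap_mk (σ : B →ₐ[F] Module.End F M) (v : M) (b : B) :
    orbitMap σ v (Submodule.Quotient.mk b) = σ b v := rfl

theorem orbitMap_smul (σ : B →ₐ[F] Module.End F M) (v : M) (b : B) (q : B ⧸ annVec σ v) :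
    orbitMap σ v (b • q) = σ b (orbitMap σ v q) := by
  obtain ⟨q, rfl⟩ := Submodule.Quotient.mk_surjective _ q
  rw [← Submodule.Quotient.mk_smul, orbitMap_mk, orbitMap_mk, smul_eq_mul, map_mul,
    Module.End.mul_apply]

theorem orbitMap_injective (σ : B →ₐ[F] Module.End F M) (v : M) :
    Function.Injective (orbitMap σ v) := by
  refine (injective_iff_map_eq_zero _).2 fun q hq => ?_
  obtain ⟨q, rfl⟩ := Submodule.Quotient.mk_surjective _ q
  exact (Submodule.Quotient.mk_eq_zero _).2 hq

end GeneratesSimple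

/-! ### The Coxeter presentation of the symmetric group -/

section Coxeter

variable {K : Type*} [Group K] (s : ℕ → K)

/-- The product `s_N s_{N-1} ⋯` with `k` factors. -/
def descProd (N : ℕ) : ℕ → K
  | 0 => 1
  | k + 1 => descProd N k * s (N - k)

variable {s} {N : ℕ} (hsq : ∀ i < N, s i * s i = 1)
  (hcomm : ∀ i j, i + 1 < j → j < N → s i * s j = s j * s i)
  (hbraid : ∀ i, i + 1 < N → s i * s (i + 1) * s i = s (i + 1) * s i * s (i + 1))

include hcomm in
theorem descProd_mul_of_lt {k i : ℕ} (hN : 0 < N) (hi : i + k + 1 ≤ N - 1) :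
    descProd s (N - 1) k * s i = s i * descProd s (N - 1) k := by
  induction k with
  | zero => simp [descProd]
  | succ k ih =>
    rw [descProd, mul_assoc, ← hcomm i (N - 1 - k) (by omega) (by omega), ← mul_assoc,
      ih (by omega), mul_assoc]

include hcomm hbraid in
-- Both `s (i + 1)` and `s i` occur in the descending product. The new factor `s (i + 1)` moves left
-- past the factors of smaller index, the braid relation turns it into `s i`, and this moves left
-- past the factors of larger index.
theorem descProd_mul_of_gt {k i : ℕ} (hk : k ≤ N) (hi : N - 1 < i + k) (hiN : i + 1 < N) :
    descProd s (N - 1) k * s (i + 1) = s i * descProd s (N - 1) k := by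
  induction k with
  | zero => omega
  | succ k ih =>
    rcases Nat.lt_or_ge (N - 1) (i + k) with h | h
    · rw [descProd, mul_assoc, hcomm (N - 1 - k) (i + 1) (by omega) (by omega), ← mul_assoc,
        ih (by omega) h, mul_assoc]
    · obtain ⟨k, rfl⟩ : ∃ k', k = k' + 1 := ⟨k - 1, by omega⟩
      have e1 : N - 1 - (k + 1) = i := by omega
      have e2 : N - 1 - k = i + 1 := by omega
      rw [descProd, descProd, e1, e2, mul_assoc, mul_assoc, ← mul_assoc (s (i + 1)), ← hbraid i hiN,
        ← mul_assoc, ← mul_assoc, descProd_mul_of_lt hcomm (by omega) (by omega)]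
      simp only [mul_assoc]

include hsq hcomm hbraid in
/-- A group generated by `N` elements subject to the Coxeter relations of type `A_N` has at
most `(N + 1)!` elements. -/
theorem card_closure_le_of_coxeter :
    Finite (Subgroup.closure {x | ∃ i < N, x = s i}) ∧
      Nat.card (Subgroup.closure {x | ∃ i < N, x = s i}) ≤ (N + 1).factorial := by
  induction N with
  | zero =>
    have : ({x | ∃ i < 0, x = s i} : Set K) = ∅ := by ext; simp
    rw [this, Subgroup.closure_empty]
    exact ⟨inferInstance, by simp⟩
  | succ N ih =>
    obtain ⟨hfin, hcard⟩ := ih (fun i hi => hsq i (by omega))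
      (fun i j hij hj => hcomm i j hij (by omega)) (fun i hi => hbraid i (by omega))
    set H := Subgroup.closure {x | ∃ i < N, x = s i} with hH
    have hs : ∀ i < N, s i ∈ H := fun i hi => Subgroup.subset_closure ⟨i, hi, rfl⟩
    -- The cosets of `H` are represented by the `N + 2` descending products. Right multiplication by
    -- `s i` lengthens the product if `i + k = N`, shortens it if `i + k = N + 1`, and otherwise
    -- stays in the coset.
    have step : ∀ k ≤ N + 1, ∀ i < N + 1, ∃ h ∈ H, ∃ k' ≤ N + 1,
        descProd s N k * s i = h * descProd s N k' := by
      intro k hk i hi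
      rcases lt_trichotomy (i + k) N with h | h | h
      · refine ⟨s i, hs i (by omega), k, hk, ?_⟩
        exact descProd_mul_of_lt (N := N + 1) hcomm (by omega) (by omega)
      · refine ⟨1, H.one_mem, k + 1, by omega, ?_⟩
        rw [one_mul, descProd]
        congr 2
        omega
      · rcases Nat.eq_or_lt_of_le (show N + 1 ≤ i + k from h) with h' | h'
        · obtain ⟨k, rfl⟩ : ∃ k', k = k' + 1 := ⟨k - 1, by omega⟩
          refine ⟨1, H.one_mem, k, by omega, ?_⟩
          have e : N - k = i := by omega
          rw [one_mul, descProd, e, mul_assoc, hsq i hi, mul_one]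
        · obtain ⟨i, rfl⟩ : ∃ i', i = i' + 1 := ⟨i - 1, by omega⟩
          refine ⟨s i, hs i (by omega), k, hk, ?_⟩
          exact descProd_mul_of_gt (N := N + 1) hcomm hbraid hk (by omega) (by omega)
    have hT : ∀ x ∈ Subgroup.closure {x | ∃ i < N + 1, x = s i},
        ∃ h ∈ H, ∃ k ≤ N + 1, x = h * descProd s N k := by
      intro x hx
      have aux : ∀ x i, i < N + 1 → (∃ h ∈ H, ∃ k ≤ N + 1, x = h * descProd s N k) →
          ∃ h ∈ H, ∃ k ≤ N + 1, x * s i = h * descProd s N k := by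
        rintro x i hi ⟨h, hh, k, hk, rfl⟩
        obtain ⟨h', hh', k', hk', e⟩ := step k hk i hi
        exact ⟨h * h', H.mul_mem hh hh', k', hk', by rw [mul_assoc, e, mul_assoc]⟩
      induction hx using Subgroup.closure_induction_right with
      | one => exact ⟨1, H.one_mem, 0, by omega, by simp [descProd]⟩
      | mul_right x _ y hy hx =>
        obtain ⟨i, hi, rfl⟩ := hy
        exact aux _ i hi hx
      | mul_inv_cancel x _ y hy hx =>
        obtain ⟨i, hi, rfl⟩ := hy
        rw [inv_eq_of_mul_eq_one_left (hsq i hi)]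
        exact aux _ i hi hx
    let H' := Subgroup.closure {x | ∃ i < N + 1, x = s i}
    have hle : H ≤ H' := Subgroup.closure_mono fun x ⟨i, hi, e⟩ => ⟨i, by omega, e⟩
    have hd : ∀ k ≤ N + 1, descProd s N k ∈ H' := by
      intro k hk
      induction k with
      | zero => exact H'.one_mem
      | succ k ih =>
        exact H'.mul_mem (ih (by omega)) (Subgroup.subset_closure ⟨N - k, by omega, rfl⟩)
    let f : H × Fin (N + 2) → H' := fun p =>
      ⟨p.1 * descProd s N p.2, H'.mul_mem (hle p.1.2) (hd _ (by omega))⟩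
    have hf : Function.Surjective f := by
      rintro ⟨x, hx⟩
      obtain ⟨h, hh, k, hk, rfl⟩ := hT x hx
      exact ⟨(⟨h, hh⟩, ⟨k, by omega⟩), rfl⟩
    refine ⟨Finite.of_surjective f hf, (Nat.card_le_card_of_surjective f hf).trans ?_⟩
    rw [Nat.card_prod, Nat.card_fin, Nat.factorial_succ (N + 1), mul_comm]
    exact Nat.mul_le_mul_left _ hcard

end Coxeter

theorem simpleTransposition_mul_self {n : ℕ} (i : ℕ) (h : i + 1 < n) :
    simpleTransposition i h * simpleTransposition i h = 1 :=
  Equiv.swap_mul_self _ _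

theorem mclosure_simpleTransposition (n : ℕ) :
    Submonoid.closure {σ : Equiv.Perm (Fin n) | ∃ i h, σ = simpleTransposition i h} = ⊤ := by
  rcases n with _ | n
  · exact Subsingleton.elim _ _
  · rw [← Equiv.Perm.mclosure_swap_castSucc_succ]
    congr 1
    ext σ
    constructor
    · rintro ⟨i, h, rfl⟩
      exact ⟨⟨i, by omega⟩, rfl⟩
    · rintro ⟨i, rfl⟩
      exact ⟨i, by omega, rfl⟩

/-- The symmetric group is presented by the simple transpositions and the Coxeter relations. -/
theorem exists_hom_of_coxeter {M : Type*} [Monoid M] {n : ℕ} (s : ∀ i, i + 1 < n → M)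
    (hsq : ∀ i h, s i h * s i h = 1)
    (hcomm : ∀ i j hi hj, i + 1 < j → s i hi * s j hj = s j hj * s i hi)
    (hbraid : ∀ i h, s i (Nat.lt_of_succ_lt h) * s (i + 1) h * s i (Nat.lt_of_succ_lt h)
      = s (i + 1) h * s i (Nat.lt_of_succ_lt h) * s (i + 1) h) :
    ∃ φ : Equiv.Perm (Fin n) →* M, ∀ i h, φ (simpleTransposition i h) = s i h := by
  rcases Nat.eq_zero_or_pos n with rfl | hn
  · exact ⟨1, fun i h => absurd h (by omega)⟩
  -- The group generated by these pairs maps onto the symmetric group and has at most `n!` elements,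
  -- so the projection is bijective; its inverse followed by the second component is the
  -- homomorphism sought. Only indices below `n - 1` enter, so the default `1` plays no role.
  let t : ℕ → Equiv.Perm (Fin n) × Mˣ := fun i =>
    if h : i + 1 < n then (simpleTransposition i h, ⟨s i h, s i h, hsq i h, hsq i h⟩) else 1
  have ht : ∀ i h, t i = (simpleTransposition i h, ⟨s i h, s i h, hsq i h, hsq i h⟩) :=
    fun i h => dif_pos h
  obtain ⟨hfin, hcard⟩ := card_closure_le_of_coxeter (s := t) (N := n - 1)
    (fun i hi => by
      rw [ht i (by omega)]
      exact Prod.ext (simpleTransposition_mul_self i _) (Units.ext (hsq i _)))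
    (fun i j hij hj => by
      rw [ht i (by omega), ht j (by omega)]
      exact Prod.ext (Equiv.ext fun k => (simpleTransposition_comm i j _ _ hij k).symm)
        (Units.ext (hcomm i j _ _ hij)))
    (fun i hi => by
      rw [ht i (by omega), ht (i + 1) (by omega)]
      exact Prod.ext (Equiv.ext fun k => simpleTransposition_braid i _ k)
        (Units.ext (hbraid i _)))
  set H := Subgroup.closure {x | ∃ i < n - 1, x = t i} with hH
  let π : H →* Equiv.Perm (Fin n) := (MonoidHom.fst _ _).comp H.subtype
  have hπs : Function.Surjective π := by
    rw [← MonoidHom.mrange_eq_top, eq_top_iff, ← mclosure_simpleTransposition, Submonoid.closure_le]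
    rintro _ ⟨i, h, rfl⟩
    exact ⟨⟨t i, Subgroup.subset_closure ⟨i, by omega, rfl⟩⟩, by
      change (t i).1 = _
      rw [ht i h]⟩
  have hπ : Function.Bijective π := by
    refine hπs.bijective_of_nat_card_le (hcard.trans ?_)
    rw [Nat.card_perm, Nat.card_fin, Nat.sub_add_cancel hn]
  let e := MulEquiv.ofBijective π hπ
  refine ⟨((Units.coeHom M).comp ((MonoidHom.snd _ _).comp H.subtype)).comp e.symm.toMonoidHom,
    fun i h => ?_⟩
  have : e.symm (simpleTransposition i h) = ⟨t i, Subgroup.subset_closure ⟨i, by omega, rfl⟩⟩ := by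
    rw [MulEquiv.symm_apply_eq]
    change _ = (t i).1
    rw [ht i h]
  simp [this, ht i h]

/-! ### The symmetric group and the group algebra inside the wreath Hecke algebra -/

namespace WreathHecke

section Structure

variable {F : Type u} [Field F] {G : Type v} [Group G] [Fintype G] {n : ℕ}

theorem mem_of_forall_gen (S : Subalgebra F (WreathHecke F G n)) (h : ∀ a, of F a ∈ S)
    (p : WreathHecke F G n) : p ∈ S := by
  have : Algebra.adjoin F (Set.range (of F : Gen G n → WreathHecke F G n)) ≤ S :=
    Algebra.adjoin_le (by rintro _ ⟨a, rfl⟩; exact h a)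
  rw [adjoin_range_of] at this
  exact this trivial

theorem exists_permHom (F : Type u) [Field F] (G : Type v) [Group G] [Fintype G] (n : ℕ) :
    ∃ φ : Equiv.Perm (Fin n) →* WreathHecke F G n,
      ∀ i h, φ (simpleTransposition i h) = of F (.s i h) :=
  exists_hom_of_coxeter _ s_sq s_comm s_braid

/-- The homomorphism from the symmetric group to the wreath Hecke algebra. -/
def permHom (F : Type u) [Field F] (G : Type v) [Group G] [Fintype G] (n : ℕ) :
    Equiv.Perm (Fin n) →* WreathHecke F G n :=
  (exists_permHom F G n).choose

theorem permHom_simpleTransposition (i : ℕ) (h : i + 1 < n) :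
    permHom F G n (simpleTransposition i h) = of F (.s i h) :=
  (exists_permHom F G n).choose_spec i h

theorem permHom_mul_grp (σ : Equiv.Perm (Fin n)) (g : Fin n → G) :
    permHom F G n σ * of F (.grp g) = of F (.grp fun k => g (σ⁻¹ k)) * permHom F G n σ := by
  have hσ : σ ∈ Submonoid.closure {σ : Equiv.Perm (Fin n) | ∃ i h, σ = simpleTransposition i h} := by
    rw [mclosure_simpleTransposition]; trivial
  induction hσ using Submonoid.closure_induction generalizing g with
  | mem σ hσ =>
    obtain ⟨i, h, rfl⟩ := hσ
    rw [permHom_simpleTransposition, s_grp]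
  | one => simp
  | mul σ τ _ _ h1 h2 =>
    rw [map_mul, mul_assoc, h2, ← mul_assoc, h1, mul_assoc]
    simp

/-- The group algebra, placed at the position `i`. -/
def posHom (F : Type u) [Field F] {G : Type v} [Group G] [Fintype G] {n : ℕ} (i : Fin n) :
    MonoidAlgebra F G →ₐ[F] WreathHecke F G n :=
  MonoidAlgebra.lift F (WreathHecke F G n) G
    { toFun := fun a => of F (.grp (Pi.mulSingle i a))
      map_one' := by rw [Pi.mulSingle_one, grp_one]
      map_mul' := fun a b => by rw [grp_mul, Pi.mulSingle_mul] }

theorem posHom_of (i : Fin n) (a : G) :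
    posHom F i (MonoidAlgebra.of F G a) = of F (.grp (Pi.mulSingle i a)) := by
  simp [posHom]

omit [Fintype G] in
theorem groupAlgebra_induction {P : MonoidAlgebra F G → Prop} (a : MonoidAlgebra F G)
    (h : ∀ g, P (MonoidAlgebra.of F G g)) (hadd : ∀ a b, P a → P b → P (a + b))
    (hsmul : ∀ (c : F) a, P a → P (c • a)) : P a :=
  MonoidAlgebra.induction_on a h hadd hsmul

theorem permHom_mul_posHom (σ : Equiv.Perm (Fin n)) (i : Fin n) (a : MonoidAlgebra F G) :
    permHom F G n σ * posHom F i a = posHom F (σ i) a * permHom F G n σ := by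
  induction a using groupAlgebra_induction with
  | h g =>
    rw [posHom_of, posHom_of, permHom_mul_grp]
    congr 3
    funext k
    by_cases hk : k = σ i
    · subst hk; simp
    · have hk' : σ⁻¹ k ≠ i := fun e => hk (by simp [← e])
      rw [Pi.mulSingle_eq_of_ne hk, Pi.mulSingle_eq_of_ne hk']
  | hadd a b ha hb => rw [map_add, map_add, mul_add, add_mul, ha, hb]
  | hsmul c a ha => rw [map_smul, map_smul, mul_smul_comm, smul_mul_assoc, ha]

theorem s_mul_posHom (i : ℕ) (h : i + 1 < n) (j : Fin n) (a : MonoidAlgebra F G) :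
    of F (.s i h) * posHom F j a = posHom F (simpleTransposition i h j) a * of F (.s i h) := by
  rw [← permHom_simpleTransposition, permHom_mul_posHom]

theorem x_mul_posHom (j i : Fin n) (a : MonoidAlgebra F G) :
    of F (.x j) * posHom F i a = posHom F i a * of F (.x j) := by
  induction a using groupAlgebra_induction with
  | h g => rw [posHom_of, x_grp]
  | hadd a b ha hb => rw [map_add, mul_add, add_mul, ha, hb]
  | hsmul c a ha => rw [map_smul, mul_smul_comm, smul_mul_assoc, ha]

theorem grp_mul_posHom (g : Fin n → G) (i : Fin n) (a : MonoidAlgebra F G) :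
    of F (.grp g) * posHom F i a = posHom F i
      (MonoidAlgebra.of F G (g i) * a * MonoidAlgebra.of F G (g i)⁻¹) * of F (.grp g) := by
  induction a using groupAlgebra_induction with
  | h b =>
    rw [← map_mul, ← map_mul, posHom_of, posHom_of, grp_mul, grp_mul]
    congr 2
    funext k
    by_cases hk : k = i
    · subst hk; simp
    · simp [hk]
  | hadd a b ha hb => rw [map_add, mul_add, mul_add, add_mul, map_add, add_mul, ha, hb]
  | hsmul c a ha =>
    rw [map_smul, mul_smul_comm, mul_smul_comm, smul_mul_assoc, map_smul, smul_mul_assoc, ha]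

theorem grp_commute_posHom (g : Fin n → G) (i : Fin n) (hg : g i = 1) (a : MonoidAlgebra F G) :
    Commute (of F (.grp g)) (posHom F i a) := by
  refine (grp_mul_posHom g i a).trans ?_
  simp only [hg, inv_one, map_one, one_mul, mul_one]

theorem posHom_commute {i j : Fin n} (hij : i ≠ j) (a b : MonoidAlgebra F G) :
    Commute (posHom F i a) (posHom F j b) := by
  induction a using groupAlgebra_induction with
  | h g =>
    rw [posHom_of]
    exact grp_commute_posHom _ _ (by simp [hij.symm]) b
  | hadd a a' ha hb => rw [map_add]; exact ha.add_left hb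
  | hsmul c a ha => rw [map_smul]; exact ha.smul_left c

/-- The element `∑ a, a ⊗ a⁻¹` placed at the positions `i` and `j`. -/
def swapElt (F : Type u) [Field F] (G : Type v) [Group G] [Fintype G] {n : ℕ} (i j : Fin n) :
    WreathHecke F G n :=
  ∑ a : G, of F (.grp (Pi.mulSingle i a * Pi.mulSingle j a⁻¹))

theorem s_mul_x (i : ℕ) (h : i + 1 < n) :
    of F (.s i h) * of F (.x ⟨i, Nat.lt_of_succ_lt h⟩) = of F (.x ⟨i + 1, h⟩) * of F (.s i h)
      - swapElt F G ⟨i, Nat.lt_of_succ_lt h⟩ ⟨i + 1, h⟩ :=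
  s_x i h

theorem swapElt_comm {i j : Fin n} : swapElt F G i j = swapElt F G j i := by
  refine Fintype.sum_equiv (Equiv.inv G) _ _ fun a => ?_
  rw [Equiv.inv_apply, inv_inv]
  by_cases hij : i = j
  · subst hij; rw [← Pi.mulSingle_mul, ← Pi.mulSingle_mul]; simp
  · rw [(Pi.mulSingle_commute (f := fun _ => G) hij a a⁻¹).eq]

theorem s_mul_swapElt (i : ℕ) (h : i + 1 < n) :
    of F (.s i h) * swapElt F G ⟨i, Nat.lt_of_succ_lt h⟩ ⟨i + 1, h⟩
      = swapElt F G ⟨i, Nat.lt_of_succ_lt h⟩ ⟨i + 1, h⟩ * of F (.s i h) := by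
  conv_rhs => rw [swapElt_comm]
  rw [swapElt, swapElt, Finset.mul_sum, Finset.sum_mul]
  refine Finset.sum_congr rfl fun a _ => ?_
  rw [← grp_mul, ← grp_mul, ← posHom_of, ← posHom_of, ← posHom_of, ← posHom_of, ← mul_assoc,
    s_mul_posHom, mul_assoc, s_mul_posHom, ← mul_assoc]
  simp [simpleTransposition]

theorem x_mul_swapElt (k i j : Fin n) :
    of F (.x k) * swapElt F G i j = swapElt F G i j * of F (.x k) := by
  rw [swapElt, Finset.mul_sum, Finset.sum_mul]
  exact Finset.sum_congr rfl fun a _ => x_grp _ _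

/-- This is `s_mul_x` multiplied by `s_i` on both sides, since `s_i` commutes with `swapElt`. -/
theorem s_mul_x_succ (i : ℕ) (h : i + 1 < n) :
    of F (.s i h) * of F (.x ⟨i + 1, h⟩) = of F (.x ⟨i, Nat.lt_of_succ_lt h⟩) * of F (.s i h)
      + swapElt F G ⟨i, Nat.lt_of_succ_lt h⟩ ⟨i + 1, h⟩ := by
  have e := congrArg (fun t => of F (.s i h) * t * of F (.s i h)) (s_mul_x (F := F) (G := G) i h)
  simp only [mul_sub, sub_mul] at e
  rw [← mul_assoc, s_sq, one_mul, ← mul_assoc, mul_assoc (_ * _), s_sq, mul_one, s_mul_swapElt,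
    mul_assoc, s_sq, mul_one] at e
  rw [e]
  abel

end Structure

end WreathHecke

/-! ### Central symmetric polynomials and finite dimensionality of simple modules -/

namespace WreathHecke

section Finiteness

variable (F : Type u) [Field F] (G : Type v) [Group G] [Fintype G] (n : ℕ)

/-- The subalgebra generated by the polynomial generators. -/
abbrev polySubalgebra : Subalgebra F (WreathHecke F G n) :=
  Algebra.adjoin F (Set.range fun i : Fin n => (of F (.x i) : WreathHecke F G n))

theorem polySubalgebra_isMulCommutative : IsMulCommutative (polySubalgebra F G n) :=
  Algebra.isMulCommutative_adjoin F (by rintro _ ⟨i, rfl⟩ _ ⟨j, rfl⟩; exact x_comm i j)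

instance : CommRing (polySubalgebra F G n) where
  __ := Subalgebra.toRing (polySubalgebra F G n)
  mul_comm := (polySubalgebra_isMulCommutative F G n).is_comm.comm

variable {F G n}

theorem poly_mul_of_commute {p : WreathHecke F G n} (hp : p ∈ polySubalgebra F G n)
    {a : WreathHecke F G n} (ha : ∀ i, of F (.x i) * a = a * of F (.x i)) : p * a = a * p := by
  induction hp using Algebra.adjoin_induction with
  | mem x hx => obtain ⟨i, rfl⟩ := hx; exact ha i
  | algebraMap c => exact Algebra.commutes c a
  | add x y _ _ hx hy => rw [add_mul, mul_add, hx, hy]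
  | mul x y _ _ hx hy => rw [mul_assoc, hy, ← mul_assoc, hx, mul_assoc]

/-- A twisted Leibniz rule: the corrections collect into one polynomial multiple of `swapElt`
because that element commutes with the polynomial generators. -/
theorem s_mul_poly (i : ℕ) (h : i + 1 < n) {p : WreathHecke F G n}
    (hp : p ∈ polySubalgebra F G n) :
    ∃ p' ∈ polySubalgebra F G n, ∃ p'' ∈ polySubalgebra F G n, of F (.s i h) * p
      = p' * of F (.s i h) + p'' * swapElt F G ⟨i, Nat.lt_of_succ_lt h⟩ ⟨i + 1, h⟩ := by
  have hx : ∀ j, of F (.x j) ∈ polySubalgebra F G n :=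
    fun j => Algebra.subset_adjoin ⟨j, rfl⟩
  induction hp using Algebra.adjoin_induction with
  | mem x hx' =>
    obtain ⟨j, rfl⟩ := hx'
    dsimp only
    by_cases h1 : j.val = i
    · obtain rfl : j = ⟨i, Nat.lt_of_succ_lt h⟩ := Fin.ext h1
      exact ⟨_, hx ⟨i + 1, h⟩, -1, neg_mem (one_mem _), by rw [s_mul_x]; simp [sub_eq_add_neg]⟩
    · by_cases h2 : j.val = i + 1
      · obtain rfl : j = ⟨i + 1, h⟩ := Fin.ext h2
        exact ⟨_, hx ⟨i, Nat.lt_of_succ_lt h⟩, 1, one_mem _, by rw [s_mul_x_succ, one_mul]⟩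
      · exact ⟨_, hx j, 0, zero_mem _, by rw [s_x_of_ne i h j h1 h2]; simp⟩
  | algebraMap c =>
    exact ⟨_, Subalgebra.algebraMap_mem _ c, 0, zero_mem _, by
      rw [Algebra.commutes]; simp⟩
  | add x y _ _ hx hy =>
    obtain ⟨p', hp', p'', hp'', e⟩ := hx
    obtain ⟨q', hq', q'', hq'', e'⟩ := hy
    exact ⟨p' + q', add_mem hp' hq', p'' + q'', add_mem hp'' hq'', by
      rw [mul_add, e, e', add_mul, add_mul]; abel⟩
  | mul x y _ hy' hx hy =>
    obtain ⟨p', hp', p'', hp'', e⟩ := hx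
    obtain ⟨q', hq', q'', hq'', e'⟩ := hy
    refine ⟨p' * q', mul_mem hp' hq', p' * q'' + p'' * y,
      add_mem (mul_mem hp' hq'') (mul_mem hp'' hy'), ?_⟩
    rw [← mul_assoc, e, add_mul, mul_assoc p', e', mul_assoc p'',
      ← poly_mul_of_commute hy' fun k => x_mul_swapElt k _ _, mul_add, add_mul]
    simp only [mul_assoc, add_assoc]

/-- The wreath Hecke algebra is spanned over its polynomial subalgebra by the elements `g σ`. -/
theorem span_poly_eq_top :
    Submodule.span (polySubalgebra F G n) (Set.range fun t : (Fin n → G) × Equiv.Perm (Fin n) =>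
      of F (.grp t.1) * permHom F G n t.2) = ⊤ := by
  set T := Submodule.span (polySubalgebra F G n)
    (Set.range fun t : (Fin n → G) × Equiv.Perm (Fin n) =>
      of F (.grp t.1) * permHom F G n t.2) with hT
  have hmul : ∀ p ∈ polySubalgebra F G n, ∀ a ∈ T, p * a ∈ T := fun p hp a ha =>
    T.smul_mem (⟨p, hp⟩ : polySubalgebra F G n) ha
  have hgen : ∀ g σ, of F (.grp g) * permHom F G n σ ∈ T := fun g σ =>
    Submodule.subset_span ⟨(g, σ), rfl⟩
  have hgrp : ∀ g, ∀ a ∈ T, of F (.grp g) * a ∈ T := by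
    intro g a ha
    induction ha using Submodule.span_induction with
    | mem a ha =>
      obtain ⟨⟨g', σ⟩, rfl⟩ := ha
      dsimp only
      rw [← mul_assoc, grp_mul]
      exact hgen _ _
    | zero => rw [mul_zero]; exact T.zero_mem
    | add a b _ _ ha hb => rw [mul_add]; exact T.add_mem ha hb
    | smul p a _ ha =>
      change of F (.grp g) * ((p : WreathHecke F G n) * a) ∈ T
      rw [← mul_assoc, ← poly_mul_of_commute p.2 fun k => x_grp k g, mul_assoc]
      exact hmul _ p.2 _ ha
  have hswap : ∀ i j, ∀ a ∈ T, swapElt F G i j * a ∈ T := by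
    intro i j a ha
    rw [swapElt, Finset.sum_mul]
    exact T.sum_mem fun c _ => hgrp _ a ha
  have hs : ∀ i h, ∀ a ∈ T, of F (.s i h) * a ∈ T := by
    intro i h a ha
    induction ha using Submodule.span_induction with
    | mem a ha =>
      obtain ⟨⟨g', σ⟩, rfl⟩ := ha
      dsimp only
      rw [← mul_assoc, s_grp, mul_assoc, ← permHom_simpleTransposition, ← map_mul]
      exact hgen _ _
    | zero => rw [mul_zero]; exact T.zero_mem
    | add a b _ _ ha hb => rw [mul_add]; exact T.add_mem ha hb
    | smul p a ha' ha =>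
      change of F (.s i h) * ((p : WreathHecke F G n) * a) ∈ T
      obtain ⟨p', hp', p'', hp'', e⟩ := s_mul_poly i h p.2
      rw [← mul_assoc, e, add_mul, mul_assoc, mul_assoc]
      exact T.add_mem (hmul _ hp' _ ha) (hmul _ hp'' _ (hswap _ _ _ ha'))
  -- The elements stabilising `T` under left multiplication form a subalgebra containing the
  -- generators; applying them to `1 ∈ T` gives the whole algebra.
  let S : Subalgebra F (WreathHecke F G n) :=
    { carrier := {b | ∀ a ∈ T, b * a ∈ T}
      mul_mem' := fun {b c} hb hc a ha => by rw [mul_assoc]; exact hb _ (hc _ ha)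
      add_mem' := fun {b c} hb hc a ha => by rw [add_mul]; exact T.add_mem (hb _ ha) (hc _ ha)
      algebraMap_mem' := fun c a ha => hmul _ (Subalgebra.algebraMap_mem _ c) a ha }
  have hS : ∀ b, b ∈ S := mem_of_forall_gen S (by
    rintro (g | i | ⟨i, h⟩)
    · exact hgrp g
    · exact hmul _ (Algebra.subset_adjoin ⟨i, rfl⟩)
    · exact hs i h)
  refine eq_top_iff.2 fun b _ => ?_
  have h1 := hS b (of F (.grp 1) * permHom F G n 1) (hgen 1 1)
  rwa [map_one, grp_one, mul_one, mul_one] at h1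

variable (F G n) in
/-- The polynomial `∏ i, (T - x i)`. -/
def charPoly : Polynomial (polySubalgebra F G n) :=
  ∏ i : Fin n, (Polynomial.X
    - Polynomial.C (⟨of F (.x i), Algebra.subset_adjoin ⟨i, rfl⟩⟩ : polySubalgebra F G n))

/-- The elements of the polynomial subalgebra that commute with a given element. -/
def polyCentralizer (a : WreathHecke F G n) : Subring (polySubalgebra F G n) where
  carrier := {p | a * p = p * a}
  mul_mem' := fun {p q} (hp : _ = _) (hq : _ = _) => by
    change a * (p * q : WreathHecke F G n) = (p * q : WreathHecke F G n) * a
    rw [← mul_assoc, hp, mul_assoc, hq, mul_assoc]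
  one_mem' := by simp
  add_mem' := fun {p q} (hp : _ = _) (hq : _ = _) => by
    change a * (p + q : WreathHecke F G n) = (p + q : WreathHecke F G n) * a
    rw [mul_add, add_mul, hp, hq]
  zero_mem' := by simp
  neg_mem' := fun {p} (hp : _ = _) => by
    change a * (-p : WreathHecke F G n) = (-p : WreathHecke F G n) * a
    rw [mul_neg, neg_mul, hp]

/-- Only the factors with `x_i` and `x_{i+1}` fail to commute with `s_i`, and their product involves
only `x_i + x_{i+1}` and `x_i x_{i+1}`, in which the correction terms cancel. -/
theorem s_mul_coeff_charPoly (i : ℕ) (h : i + 1 < n) (k : ℕ) :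
    (charPoly F G n).coeff k ∈ polyCentralizer (of F (.s i h)) := by
  set Z := polyCentralizer (F := F) (G := G) (n := n) (of F (.s i h)) with hZ
  let X : Fin n → polySubalgebra F G n := fun i => ⟨of F (.x i), Algebra.subset_adjoin ⟨i, rfl⟩⟩
  let R := (Polynomial.mapRingHom Z.subtype).range
  have hC : ∀ p ∈ Z, Polynomial.C p ∈ R := fun p hp => ⟨Polynomial.C ⟨p, hp⟩, by simp⟩
  have hX : Polynomial.X ∈ R := ⟨Polynomial.X, by simp⟩
  have key : charPoly F G n ∈ R := by
    set a : Fin n := ⟨i, Nat.lt_of_succ_lt h⟩ with ha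
    set b : Fin n := ⟨i + 1, h⟩ with hb
    have hab : b ∈ Finset.univ.erase a := by simp [ha, hb]
    rw [charPoly, ← Finset.mul_prod_erase _ _ (Finset.mem_univ a), ← Finset.mul_prod_erase _ _ hab,
      ← mul_assoc]
    refine mul_mem ?_ (prod_mem fun j hj => ?_)
    · have e : (Polynomial.X - Polynomial.C (X a)) * (Polynomial.X - Polynomial.C (X b))
          = Polynomial.X * Polynomial.X - Polynomial.C (X a + X b) * Polynomial.X
            + Polynomial.C (X a * X b) := by
        rw [map_add, map_mul]; ring
      refine e ▸ add_mem (sub_mem (mul_mem hX hX) (mul_mem (hC _ ?_) hX)) (hC _ ?_)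
      · change of F (.s i h) * (of F (.x a) + of F (.x b)) = (of F (.x a) + of F (.x b)) * of F (.s i h)
        rw [mul_add, s_mul_x, s_mul_x_succ, add_mul]
        abel
      · change of F (.s i h) * (of F (.x a) * of F (.x b)) = of F (.x a) * of F (.x b) * of F (.s i h)
        rw [← mul_assoc, s_mul_x, sub_mul, mul_assoc, s_mul_x_succ, ← x_mul_swapElt, mul_add,
          ← mul_assoc, x_comm b a]
        abel
    · simp only [Finset.mem_erase, Finset.mem_univ, and_true, ne_eq, ha, hb, Fin.ext_iff] at hj
      exact sub_mem hX (hC _ (s_x_of_ne i h j hj.2 hj.1))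
  obtain ⟨q, hq⟩ := key
  rw [← hq]
  simp

theorem coeff_charPoly_commutes (k : ℕ) (a : WreathHecke F G n) :
    ((charPoly F G n).coeff k : WreathHecke F G n) * a = a * (charPoly F G n).coeff k := by
  have : a ∈ Subalgebra.centralizer F {((charPoly F G n).coeff k : WreathHecke F G n)} := by
    refine mem_of_forall_gen _ ?_ a
    intro b
    rw [Subalgebra.mem_centralizer_iff]
    rintro _ rfl
    rcases b with g | i | ⟨i, h⟩
    · exact poly_mul_of_commute (Subtype.property _) fun k => x_grp k g
    · exact poly_mul_of_commute (Subtype.property _) fun k => x_comm k i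
    · exact (s_mul_coeff_charPoly i h k).symm
  exact Subalgebra.mem_centralizer_iff F |>.1 this _ rfl

/-- Simple modules over the wreath Hecke algebra are finite dimensional. -/
theorem finiteDimensional_of_isSimpleModule (M : Type*) [AddCommGroup M] [Module F M]
    [Module (WreathHecke F G n) M] [IsScalarTower F (WreathHecke F G n) M]
    [IsSimpleModule (WreathHecke F G n) M] : FiniteDimensional F M := by
  let C := polySubalgebra F G n
  have : Nontrivial M := IsSimpleModule.nontrivial (WreathHecke F G n) M
  have : Nontrivial (WreathHecke F G n) := Module.nontrivial _ M
  have : Nontrivial C := inferInstance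
  let X : Fin n → C := fun i => ⟨of F (.x i), Algebra.subset_adjoin ⟨i, rfl⟩⟩
  -- Coefficients beyond the degree vanish, so bounding the index loses nothing and makes the
  -- generating set finite.
  let R : Subalgebra F C := Algebra.adjoin F
    (((charPoly F G n).coeff '' Set.Iic (charPoly F G n).natDegree))
  have hRcoeff : ∀ k, (charPoly F G n).coeff k ∈ R := by
    intro k
    rcases le_or_gt k (charPoly F G n).natDegree with hk | hk
    · exact Algebra.subset_adjoin ⟨k, hk, rfl⟩
    · rw [Polynomial.coeff_eq_zero_of_natDegree_lt hk]; exact zero_mem _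
  have hcomm : ∀ (r : R) (a : WreathHecke F G n),
      ((r : C) : WreathHecke F G n) * a = a * ((r : C) : WreathHecke F G n) := by
    rintro ⟨r, hr⟩ a
    change (r : WreathHecke F G n) * a = a * (r : WreathHecke F G n)
    induction hr using Algebra.adjoin_induction with
    | mem x hx => obtain ⟨k, -, rfl⟩ := hx; exact coeff_charPoly_commutes k a
    | algebraMap c => exact Algebra.commutes c a
    | add x y _ _ hx hy =>
      change (x + y : WreathHecke F G n) * a = a * (x + y : WreathHecke F G n)
      rw [add_mul, mul_add, hx, hy]
    | mul x y _ _ hx hy =>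
      change (x * y : WreathHecke F G n) * a = a * (x * y : WreathHecke F G n)
      rw [mul_assoc, hy, ← mul_assoc, hx, mul_assoc]
  have hft : Algebra.FiniteType F R := by
    refine (Subalgebra.fg_iff_finiteType _).1 (Subalgebra.fg_def.2 ⟨_, ?_, rfl⟩)
    exact (Set.finite_Iic _).image _
  let φ : R →ₐ[F] WreathHecke F G n := C.val.comp R.val
  let _ : Algebra R (WreathHecke F G n) := φ.toRingHom.toAlgebra' hcomm
  have hFR : IsScalarTower F R (WreathHecke F G n) := .of_algebraMap_eq fun c => (φ.commutes c).symm
  have : IsScalarTower R C (WreathHecke F G n) := ⟨fun r c a => by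
    change ((r : C) * c : WreathHecke F G n) * a = (r : C) * ((c : WreathHecke F G n) * a)
    rw [mul_assoc]⟩
  -- Each `x_i` is a root of the monic polynomial `charPoly`, which descends to `R`.
  have hint : ∀ i, IsIntegral R (X i) := by
    intro i
    have hm : (charPoly F G n).Monic :=
      Polynomial.monic_prod_of_monic _ _ fun j _ => Polynomial.monic_X_sub_C _
    obtain ⟨q, hq, -, hqm⟩ := Polynomial.lifts_and_degree_eq_and_monic
      (f := algebraMap R C) (p := charPoly F G n)
      ((Polynomial.lifts_iff_coeff_lifts _).2 fun k => ⟨⟨_, hRcoeff k⟩, rfl⟩) hm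
    refine ⟨q, hqm, ?_⟩
    rw [← Polynomial.eval_map, hq, charPoly, Polynomial.eval_prod]
    exact Finset.prod_eq_zero (Finset.mem_univ i) (by simp [X])
  have hfinC : Module.Finite R C := by
    have htop : Algebra.adjoin R (Set.range X) = ⊤ := by
      refine eq_top_iff.2 fun c _ => ?_
      have : (Algebra.adjoin F (Set.range X)) ≤ (Algebra.adjoin R (Set.range X)).restrictScalars F :=
        Algebra.adjoin_le Algebra.subset_adjoin
      refine this ?_
      have h1 : (Algebra.adjoin F (Set.range X)).map C.val = C := by
        rw [AlgHom.map_adjoin, ← Set.range_comp]; rfl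
      have h2 : (c : WreathHecke F G n) ∈ (Algebra.adjoin F (Set.range X)).map C.val := by
        rw [h1]; exact c.2
      obtain ⟨c', hc', e⟩ := h2
      rwa [← Subtype.ext e]
    have := fg_adjoin_of_finite (R := R) (Set.finite_range X) (by rintro _ ⟨i, rfl⟩; exact hint i)
    rw [htop] at this
    exact ⟨this⟩
  have hfinA : Module.Finite C (WreathHecke F G n) :=
    ⟨Submodule.fg_def.2 ⟨_, Set.finite_range _, span_poly_eq_top⟩⟩
  have : Module.Finite R (WreathHecke F G n) := Module.Finite.trans C _
  exact @finite_of_isSimpleModule F R (WreathHecke F G n) M _ _ _ hft _ _ _ hFR this _ _ _ _ _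

end Finiteness

end WreathHecke

/-! ### Irreducible representations of algebras -/

section Irreducible

variable {F B W : Type*} [Field F] [Ring B] [Algebra F B] [AddCommGroup W] [Module F W]

/-- The space `W` is nonzero and has no proper nonzero subspace stable under `B`. -/
def IsIrreducibleRep (σ : B →ₐ[F] Module.End F W) : Prop :=
  Nontrivial W ∧ ∀ N : Submodule F W, (∀ b, ∀ w ∈ N, σ b w ∈ N) → N = ⊥ ∨ N = ⊤

theorem IsIrreducibleRep.isSimpleModule {σ : B →ₐ[F] Module.End F W} (h : IsIrreducibleRep σ) :
    letI : Module B W := Module.compHom W σ.toRingHom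
    IsSimpleModule B W := by
  let _ : Module B W := Module.compHom W σ.toRingHom
  have hsmul : ∀ (b : B) (w : W), b • w = σ b w := fun _ _ => rfl
  have := h.1
  refine (isSimpleModule_iff _ _).2 ⟨fun N => ?_⟩
  let N' : Submodule F W :=
    { N with
      smul_mem' := fun c w hw => by
        have := N.smul_mem (algebraMap F B c) hw
        rwa [hsmul, AlgHom.commutes] at this }
  rcases h.2 N' fun b w hw => N.smul_mem b hw with h | h
  · exact Or.inl (SetLike.ext fun w => SetLike.ext_iff.1 h w)
  · exact Or.inr (SetLike.ext fun w => SetLike.ext_iff.1 h w)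

/-- Burnside's theorem. -/
theorem IsIrreducibleRep.surjective [IsAlgClosed F] [FiniteDimensional F W]
    {σ : B →ₐ[F] Module.End F W} (h : IsIrreducibleRep σ) : Function.Surjective σ := by
  let _ : Module B W := Module.compHom W σ.toRingHom
  have hsmul : ∀ (b : B) (w : W), b • w = σ b w := fun _ _ => rfl
  have := h.isSimpleModule
  have : IsScalarTower F B W := ⟨fun c b w => by
    rw [hsmul, hsmul, map_smul, LinearMap.smul_apply]⟩
  intro T
  obtain ⟨b, hb⟩ := exists_smul_eq_of_pairwise_not_equiv (F := F) (B := B) (ι := Unit)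
    (W := fun _ => W) (fun _ _ _ => rfl) (fun _ => T)
  exact ⟨b, LinearMap.ext fun w => hb () w⟩

end Irreducible

/-! ### External tensor products of representations -/

section Outer

variable {F : Type*} [Field F] {ι : Type*} {B : ι → Type*} [∀ k, Ring (B k)]
  [∀ k, Algebra F (B k)] {W : ι → Type*} [∀ k, AddCommGroup (W k)] [∀ k, Module F (W k)]

theorem outerRep_tprod (σ : ∀ k, B k →ₐ[F] Module.End F (W k)) (p : ∀ k, B k) :
    outerRep σ (PiTensorProduct.tprod F p) = PiTensorProduct.map fun k => σ k (p k) := by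
  simp [outerRep]

theorem outerRep_singleAlgHom [DecidableEq ι] (σ : ∀ k, B k →ₐ[F] Module.End F (W k)) (k : ι)
    (b : B k) (w : ∀ k, W k) :
    outerRep σ (PiTensorProduct.singleAlgHom k b) (PiTensorProduct.tprod F w)
      = PiTensorProduct.tprod F (Function.update w k (σ k b (w k))) := by
  rw [PiTensorProduct.singleAlgHom_apply, outerRep_tprod, PiTensorProduct.map_tprod]
  congr 1
  funext l
  rcases eq_or_ne l k with rfl | h
  · simp
  · simp [h]

/-- An external tensor product of representations with full image is irreducible. -/
theorem isIrreducibleRep_outerRep [Finite ι] [∀ k, FiniteDimensional F (W k)]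
    [∀ k, Nontrivial (W k)] (σ : ∀ k, B k →ₐ[F] Module.End F (W k))
    (hσ : ∀ k, Function.Surjective (σ k)) : IsIrreducibleRep (outerRep σ) := by
  classical
  let b := fun k => Module.finBasis F (W k)
  let bt := Basis.piTensorProduct b
  have hne : ∀ k, Nonempty (Fin (Module.finrank F (W k))) := fun k => (b k).index_nonempty
  let i₀ : ∀ k, Fin (Module.finrank F (W k)) := fun k => (hne k).some
  have : Nontrivial (⨂[F] k, W k) := ⟨bt i₀, 0, bt.ne_zero i₀⟩
  refine ⟨this, fun N hN => or_iff_not_imp_left.2 fun hbot => ?_⟩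
  obtain ⟨t, htN, ht⟩ := N.exists_mem_ne_zero_of_ne_bot hbot
  obtain ⟨f, hf⟩ : ∃ f, bt.repr t f ≠ 0 := by
    by_contra! h
    exact ht (bt.repr.map_eq_zero_iff.1 (Finsupp.ext h))
  rw [eq_top_iff, ← bt.span_eq, Submodule.span_le]
  rintro _ ⟨g, rfl⟩
  -- Each `p k` acts as the matrix unit taking the basis vector `f k` to `g k`, so their tensor
  -- product extracts the coordinate `f` and places it at `g`.
  choose p hp using fun k => hσ k ((b k).coord (f k) |>.smulRight (b k (g k)))
  have key : ∀ t, outerRep σ (PiTensorProduct.tprod F p) t = bt.repr t f • bt g := by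
    intro t
    have : outerRep σ (PiTensorProduct.tprod F p) = (bt.coord f).smulRight (bt g) := by
      have := Fintype.ofFinite ι
      refine bt.ext fun h => ?_
      rw [outerRep_tprod, LinearMap.smulRight_apply, Module.Basis.coord_apply]
      simp only [bt, Basis.piTensorProduct_apply, PiTensorProduct.map_tprod, hp,
        LinearMap.smulRight_apply, Module.Basis.coord_apply, MultilinearMap.map_smul_univ,
        Basis.piTensorProduct_repr_tprod_apply]
    rw [this]; rfl
  have := hN (PiTensorProduct.tprod F p) t htN
  rw [key] at this
  exact (N.smul_mem_iff hf).1 this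

end Outer

/-! ### Products of elements of the group algebra at distinct positions -/

theorem prod_ofFn_mulSingle {A : Type*} [Monoid A] {r : ℕ} (k : Fin r) (a : A) :
    (List.ofFn (Pi.mulSingle k a : Fin r → A)).prod = a := by
  induction r with
  | zero => exact k.elim0
  | succ r ih =>
    rw [List.ofFn_succ, List.prod_cons]
    induction k using Fin.cases with
    | zero => simp
    | succ k =>
      have : (fun i : Fin r => (Pi.mulSingle k.succ a : Fin (r + 1) → A) i.succ)
          = Pi.mulSingle k a := by
        funext i
        simp [Pi.mulSingle_apply]
      rw [this, ih, Pi.mulSingle_eq_of_ne (Fin.succ_ne_zero k).symm, one_mul]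

namespace WreathHecke

section PosProd

variable {F : Type u} [Field F] {G : Type v} [Group G] [Fintype G] {n : ℕ}

/-- The product of elements of the group algebra, placed at the positions `0, …, n - 1`. -/
def posProd (F : Type u) [Field F] (G : Type v) [Group G] [Fintype G] (n : ℕ) :
    MultilinearMap F (fun _ : Fin n => MonoidAlgebra F G) (WreathHecke F G n) :=
  (MultilinearMap.mkPiAlgebraFin F n (WreathHecke F G n)).compLinearMap
    fun i => (posHom F i).toLinearMap

theorem posProd_apply (u : Fin n → MonoidAlgebra F G) :
    posProd F G n u = (List.ofFn fun i => posHom F i (u i)).prod := by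
  simp [posProd]

theorem posProd_mul (u u' : Fin n → MonoidAlgebra F G) :
    posProd F G n (u * u') = posProd F G n u * posProd F G n u' := by
  simp only [posProd_apply, Pi.mul_apply, map_mul]
  exact prod_ofFn_mul _ _ fun i j hij => posHom_commute hij.ne' _ _

theorem posProd_mulSingle (i : Fin n) (a : MonoidAlgebra F G) :
    posProd F G n (Pi.mulSingle i a) = posHom F i a := by
  rw [posProd_apply, ← prod_ofFn_mulSingle i (posHom F i a)]
  congr 2
  funext l
  rcases eq_or_ne l i with rfl | h
  · simp
  · simp [h]

/-- `posProd` as a homomorphism of monoids. -/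
def posProdHom (F : Type u) [Field F] (G : Type v) [Group G] [Fintype G] (n : ℕ) :
    (Fin n → MonoidAlgebra F G) →* WreathHecke F G n where
  toFun := posProd F G n
  map_one' := by simp [posProd_apply]
  map_mul' := posProd_mul

/-- Homomorphisms out of a finite product of monoids are determined on the single factors, where
both sides are known. The same principle proves `permHom_mul_posProd` and `tensorRep_posProd`. -/
theorem posProd_of (g : Fin n → G) :
    posProd F G n (fun i => MonoidAlgebra.of F G (g i)) = of F (.grp g) := by
  let φ : (Fin n → G) →* WreathHecke F G n :=
    { toFun := fun g => of F (.grp g), map_one' := grp_one, map_mul' := fun g h => (grp_mul g h).symm }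
  let ψ : (Fin n → G) →* WreathHecke F G n :=
    { toFun := fun g => posProd F G n fun i => MonoidAlgebra.of F G (g i)
      map_one' := by
        simp only [Pi.one_apply, map_one]
        exact map_one (posProdHom F G n)
      map_mul' := fun g h => by
        rw [← posProd_mul]
        simp only [Pi.mul_apply, map_mul]
        rfl }
  have : ψ = φ := MonoidHom.pi_ext fun i a => by
    change posProd F G n (fun l => MonoidAlgebra.of F G ((Pi.mulSingle i a : Fin n → G) l))
      = of F (.grp _)
    rw [← posHom_of, ← posProd_mulSingle]
    congr 1
    funext l
    rcases eq_or_ne l i with rfl | h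
    · simp
    · rw [Pi.mulSingle_eq_of_ne h, Pi.mulSingle_eq_of_ne h, map_one]
  exact DFunLike.congr_fun this g

theorem permHom_mul_posProd (σ : Equiv.Perm (Fin n)) (u : Fin n → MonoidAlgebra F G) :
    permHom F G n σ * posProd F G n u = posProd F G n (fun k => u (σ⁻¹ k)) * permHom F G n σ := by
  have hinv : permHom F G n σ⁻¹ * permHom F G n σ = 1 := by rw [← map_mul]; simp
  have hinv' : permHom F G n σ * permHom F G n σ⁻¹ = 1 := by rw [← map_mul]; simp
  let φ : (Fin n → MonoidAlgebra F G) →* WreathHecke F G n :=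
    { toFun := fun u => permHom F G n σ * posProd F G n u * permHom F G n σ⁻¹
      map_one' := by
        rw [show posProd F G n 1 = 1 from map_one (posProdHom F G n), mul_one, hinv']
      map_mul' := fun u u' => by
        rw [posProd_mul]
        simp only [mul_assoc]
        rw [← mul_assoc (permHom F G n σ⁻¹) (permHom F G n σ), hinv, one_mul] }
  let ψ : (Fin n → MonoidAlgebra F G) →* WreathHecke F G n :=
    { toFun := fun u => posProd F G n fun k => u (σ⁻¹ k)
      map_one' := map_one (posProdHom F G n)
      map_mul' := fun u u' => by rw [← posProd_mul]; rfl }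
  have : φ = ψ := MonoidHom.pi_ext fun i a => by
    change permHom F G n σ * posProd F G n _ * permHom F G n σ⁻¹
      = posProd F G n fun k => (Pi.mulSingle i a : Fin n → MonoidAlgebra F G) (σ⁻¹ k)
    rw [posProd_mulSingle, permHom_mul_posHom, mul_assoc, hinv', mul_one, ← posProd_mulSingle]
    congr 1
    funext k
    by_cases hk : k = σ i
    · subst hk; simp
    · have hk' : σ⁻¹ k ≠ i := fun e => hk (by simp [← e])
      rw [Pi.mulSingle_eq_of_ne hk, Pi.mulSingle_eq_of_ne hk']
  have := DFunLike.congr_fun this u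
  change permHom F G n σ * posProd F G n u * permHom F G n σ⁻¹ = posProd F G n _ at this
  calc _ = permHom F G n σ * posProd F G n u * permHom F G n σ⁻¹ * permHom F G n σ := by
        rw [mul_assoc (_ * _), hinv, mul_one]
    _ = _ := by rw [this]

theorem x_mul_posProd (j : Fin n) (u : Fin n → MonoidAlgebra F G) :
    of F (.x j) * posProd F G n u = posProd F G n u * of F (.x j) := by
  rw [posProd_apply]
  refine Commute.list_prod_right _ _ fun y hy => ?_
  obtain ⟨i, rfl⟩ := (List.mem_ofFn' _ _).1 hy
  exact x_mul_posHom j i _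

end PosProd

end WreathHecke

/-! ### The modules `V^{⊗ m} ⊗ L` -/

theorem DegenerateHecke.mem_of_forall_gen {F : Type u} [Field F] {q : F} {n : ℕ}
    (S : Subalgebra F (DegenerateHecke F q n)) (h : ∀ a, DegenerateHecke.of F q a ∈ S)
    (p : DegenerateHecke F q n) : p ∈ S := by
  obtain ⟨p, rfl⟩ := RingQuot.mkAlgHom_surjective F (DegenerateHecke.Rel F q n) p
  induction p using FreeAlgebra.induction with
  | grade0 c =>
    rw [AlgHom.commutes]
    exact S.algebraMap_mem c
  | grade1 a => exact h a
  | mul a b ha hb => rw [map_mul]; exact S.mul_mem ha hb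
  | add a b ha hb => rw [map_add]; exact S.add_mem ha hb

theorem heckeScale_ne_zero {F : Type u} [Field F] (c : F) : heckeScale c ≠ 0 := by
  unfold heckeScale
  split_ifs with h
  · exact one_ne_zero
  · exact h

namespace WreathHecke

section TensorModule

variable {F : Type u} [Field F] [IsAlgClosed F] {G : Type v} [Group G] [Fintype G]
  {V : Type w} [AddCommGroup V] [Module F V] [FiniteDimensional F V] (ρ : Representation F G V)
  [ρ.IsIrreducible] {m : ℕ}

omit [Fintype G] in
theorem asAlgebraHom_surjective : Function.Surjective ρ.asAlgebraHom := by
  intro T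
  obtain ⟨b, hb⟩ := exists_smul_eq_of_pairwise_not_equiv (F := F) (B := MonoidAlgebra F G)
    (ι := Unit) (W := fun _ => ρ.asModule) (fun _ _ _ => rfl) (fun _ => T)
  exact ⟨b, LinearMap.ext fun w => hb () w⟩

include ρ in
omit [IsAlgClosed F] [Fintype G] [FiniteDimensional F V] in
theorem nontrivial_of_isIrreducible : Nontrivial V :=
  IsSimpleModule.nontrivial (MonoidAlgebra F G) ρ.asModule

section

variable (L : Type z) [AddCommGroup L] [Module F L]
  [Module (TwistedHecke (swapScalar ρ) m) L] [IsScalarTower F (TwistedHecke (swapScalar ρ) m) L]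

theorem tensorRep_s (i : ℕ) (h : i + 1 < m) (f : Fin m → V) (l : L) :
    tensorRep ρ L (of F (.s i h)) (PiTensorProduct.tprod F f ⊗ₜ l)
      = PiTensorProduct.tprod F (fun k => f (simpleTransposition i h k)) ⊗ₜ
        ((DegenerateHecke.of F _ (.s i h) : TwistedHecke (swapScalar ρ) m) • l) := by
  rw [tensorRep, lift_of]
  simp [tensorGen, simpleTransposition]

theorem tensorRep_x (i : Fin m) (t : ⨂[F] _ : Fin m, V) (l : L) :
    tensorRep ρ L (of F (.x i)) (t ⊗ₜ l) = heckeScale (swapScalar ρ) •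
      (t ⊗ₜ ((DegenerateHecke.of F _ (.y i) : TwistedHecke (swapScalar ρ) m) • l)) := by
  rw [tensorRep, lift_of]
  simp [tensorGen]

theorem tensorRep_posProd (u : Fin m → MonoidAlgebra F G) :
    tensorRep ρ L (posProd F G m u)
      = TensorProduct.map (PiTensorProduct.map fun i => ρ.asAlgebraHom (u i)) LinearMap.id := by
  let φ : (Fin m → MonoidAlgebra F G) →* Module.End F ((⨂[F] _ : Fin m, V) ⊗[F] L) :=
    ((tensorRep ρ L : WreathHecke F G m →ₐ[F] _) : WreathHecke F G m →* _).comp (posProdHom F G m)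
  let ψ : (Fin m → MonoidAlgebra F G) →* Module.End F ((⨂[F] _ : Fin m, V) ⊗[F] L) :=
    { toFun := fun u =>
        TensorProduct.map (PiTensorProduct.map fun i => ρ.asAlgebraHom (u i)) LinearMap.id
      map_one' := by
        simp only [Pi.one_apply, map_one]
        rw [PiTensorProduct.map_one]
        exact TensorProduct.map_id
      map_mul' := fun u u' => by
        simp only [Pi.mul_apply, map_mul]
        rw [PiTensorProduct.map_mul]
        exact TensorProduct.ext' fun _ _ => rfl }
  -- Rewriting through `mapMultilinear` exposes linearity in the slot `i`, so that only group
  -- elements remain to be checked.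
  have key : ∀ (i : Fin m) (T : Module.End F V), (TensorProduct.map
      (PiTensorProduct.map (Pi.mulSingle i T)) LinearMap.id : Module.End F
        ((⨂[F] _ : Fin m, V) ⊗[F] L)) = TensorProduct.map (PiTensorProduct.mapMultilinear F
          (fun _ : Fin m => V) (fun _ => V) (Function.update 1 i T)) LinearMap.id := fun i T => rfl
  have hsingle : ∀ (i : Fin m) (a : MonoidAlgebra F G),
      (fun j => ρ.asAlgebraHom ((Pi.mulSingle i a : Fin m → MonoidAlgebra F G) j))
        = Pi.mulSingle i (ρ.asAlgebraHom a) := fun i a => by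
    funext j
    rcases eq_or_ne j i with rfl | h
    · simp
    · simp [h]
  have : φ = ψ := MonoidHom.pi_ext fun i a => by
    change tensorRep ρ L (posProd F G m _) = TensorProduct.map (PiTensorProduct.map fun j =>
      ρ.asAlgebraHom ((Pi.mulSingle i a : Fin m → MonoidAlgebra F G) j)) _
    rw [posProd_mulSingle, hsingle, key]
    induction a using groupAlgebra_induction with
    | h g =>
      rw [posHom_of, tensorRep, lift_of, ← key, ← hsingle]
      simp only [tensorGen]
      congr 2
      funext j
      rcases eq_or_ne j i with rfl | h
      · simp
      · simp [h]
    | hadd a b ha hb =>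
      rw [map_add, map_add, map_add, ha, hb, MultilinearMap.map_update_add, TensorProduct.map_add_left]
    | hsmul c a ha =>
      rw [map_smul, map_smul, map_smul, ha, MultilinearMap.map_update_smul, TensorProduct.map_smul_left]
  exact DFunLike.congr_fun this u

theorem tensorRep_posProd_tmul (u : Fin m → MonoidAlgebra F G) (t : ⨂[F] _ : Fin m, V) (l : L) :
    tensorRep ρ L (posProd F G m u) (t ⊗ₜ l)
      = PiTensorProduct.map (fun i => ρ.asAlgebraHom (u i)) t ⊗ₜ l := by
  rw [tensorRep_posProd]; rfl

omit [Fintype G] in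
/-- Elements of the group algebra acting by prescribed endomorphisms. -/
theorem exists_lift_end : ∃ S : Module.End F V →ₗ[F] MonoidAlgebra F G,
    ∀ T, ρ.asAlgebraHom (S T) = T := by
  obtain ⟨S, hS⟩ := LinearMap.exists_rightInverse_of_surjective ρ.asAlgebraHom.toLinearMap
    (LinearMap.range_eq_top.2 (asAlgebraHom_surjective ρ))
  exact ⟨S, fun T => LinearMap.congr_fun hS T⟩

/-- If `L` is simple then `V^{⊗ m} ⊗ L` is irreducible. -/
theorem isIrreducibleRep_tensorRep [IsSimpleModule (TwistedHecke (swapScalar ρ) m) L] :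
    IsIrreducibleRep (tensorRep ρ L : WreathHecke F G m →ₐ[F] _) := by
  have hV := nontrivial_of_isIrreducible ρ
  have hL : Nontrivial L := IsSimpleModule.nontrivial (TwistedHecke (swapScalar ρ) m) L
  let b := Module.finBasis F V
  let bt := Basis.piTensorProduct fun _ : Fin m => b
  let i₀ : Fin (Module.finrank F V) := b.index_nonempty.some
  have hVm : Nontrivial (⨂[F] _ : Fin m, V) := ⟨bt fun _ => i₀, 0, bt.ne_zero _⟩
  refine ⟨inferInstance, fun N hN => or_iff_not_imp_left.2 fun hbot => ?_⟩
  obtain ⟨t, htN, ht⟩ := N.exists_mem_ne_zero_of_ne_bot hbot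
  obtain ⟨S, hS⟩ := exists_lift_end ρ
  let e := TensorProduct.equivFinsuppOfBasisLeft (N := L) bt
  obtain ⟨f, hf⟩ : ∃ f, e t f ≠ 0 := by
    by_contra! h
    exact ht (e.map_eq_zero_iff.1 (Finsupp.ext h))
  -- Matrix units realised in the group algebra: `p g` takes the coefficient in `L` of the basis
  -- tensor `f` and attaches it to the basis tensor `g`.
  let p : (Fin m → Fin (Module.finrank F V)) → WreathHecke F G m := fun g =>
    posProd F G m fun i => S ((b.coord (f i)).smulRight (b (g i)))
  have hmap : ∀ g (t : ⨂[F] _ : Fin m, V), PiTensorProduct.map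
      (fun i => (b.coord (f i)).smulRight (b (g i))) t = bt.repr t f • bt g := by
    intro g t
    have : PiTensorProduct.map (fun i => (b.coord (f i)).smulRight (b (g i)))
        = (bt.coord f).smulRight (bt g) := by
      refine bt.ext fun h => ?_
      rw [LinearMap.smulRight_apply, Module.Basis.coord_apply]
      simp only [bt, Basis.piTensorProduct_apply, PiTensorProduct.map_tprod,
        LinearMap.smulRight_apply, Module.Basis.coord_apply, MultilinearMap.map_smul_univ,
        Basis.piTensorProduct_repr_tprod_apply]
    rw [this]; rfl
  have hp : ∀ g (t : (⨂[F] _ : Fin m, V) ⊗[F] L), tensorRep ρ L (p g) t = bt g ⊗ₜ e t f := by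
    intro g t
    induction t using TensorProduct.induction_on with
    | zero => simp
    | tmul t l =>
      rw [tensorRep_posProd_tmul]
      simp only [hS]
      rw [hmap, TensorProduct.smul_tmul]
      simp [e]
    | add s t hs ht => rw [map_add, map_add, hs, ht, Finsupp.add_apply, TensorProduct.tmul_add]
  -- The operator of `s_i` moves both tensor factors at once. Requiring `t ⊗ l ∈ N` for all `t`
  -- makes it possible to undo its effect on `V^{⊗ m}` and isolate the action on `L`.
  let S' : Subalgebra F (TwistedHecke (swapScalar ρ) m) :=
    { carrier := {b | ∀ l : L, (∀ t : ⨂[F] _ : Fin m, V, t ⊗ₜ l ∈ N) → ∀ t : ⨂[F] _ : Fin m, V,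
        t ⊗ₜ[F] (b • l) ∈ N}
      mul_mem' := fun {a b} ha hb l hl => by
        simp only [mul_smul]
        exact ha _ (hb l hl)
      add_mem' := fun {a b} ha hb l hl t => by
        rw [add_smul, TensorProduct.tmul_add]
        exact N.add_mem (ha l hl t) (hb l hl t)
      algebraMap_mem' := fun c l hl t => by
        rw [algebraMap_smul, TensorProduct.tmul_smul]
        exact N.smul_mem c (hl t) }
  have hS' : ∀ b, b ∈ S' := DegenerateHecke.mem_of_forall_gen S' (by
    rintro (i | ⟨i, h⟩) l hl t
    · have := hN (of F (.x i)) _ (hl t)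
      rw [tensorRep_x] at this
      exact (N.smul_mem_iff (heckeScale_ne_zero _)).1 this
    · induction t using PiTensorProduct.induction_on with
      | smul_tprod c v =>
        have := hN (of F (.s i h)) _
          (hl (PiTensorProduct.tprod F fun k => v (simpleTransposition i h k)))
        rw [tensorRep_s] at this
        rw [← TensorProduct.smul_tmul']
        refine N.smul_mem c ?_
        convert this using 3
        funext k
        exact congrArg v (DFunLike.congr_fun (simpleTransposition_mul_self i h) k).symm
      | add s t hs ht => rw [TensorProduct.add_tmul]; exact N.add_mem hs ht)
  let K : Submodule (TwistedHecke (swapScalar ρ) m) L :=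
    { carrier := {l | ∀ t : ⨂[F] _ : Fin m, V, t ⊗ₜ[F] l ∈ N}
      add_mem' := fun {a b} ha hb t => by
        rw [TensorProduct.tmul_add]; exact N.add_mem (ha t) (hb t)
      zero_mem' := fun t => by rw [TensorProduct.tmul_zero]; exact N.zero_mem
      smul_mem' := fun b l hl => hS' b l hl }
  have hK : e t f ∈ K := by
    intro s
    rw [← bt.sum_repr s, TensorProduct.sum_tmul]
    refine N.sum_mem fun g _ => ?_
    rw [← TensorProduct.smul_tmul', ← hp]
    exact N.smul_mem _ (hN _ _ htN)
  have hKtop : K = ⊤ := (eq_bot_or_eq_top K).resolve_left fun h => hf (by rw [h] at hK; exact hK)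
  refine eq_top_iff.2 fun x _ => ?_
  induction x using TensorProduct.induction_on with
  | zero => exact N.zero_mem
  | tmul s l =>
    have : l ∈ K := hKtop ▸ trivial
    exact this s
  | add s t hs ht => exact N.add_mem (hs trivial) (ht trivial)

/-- If `L` is simple then `V^{⊗ m} ⊗ L` is finite dimensional. -/
theorem finiteDimensional_tensor [IsSimpleModule (TwistedHecke (swapScalar ρ) m) L] :
    FiniteDimensional F ((⨂[F] _ : Fin m, V) ⊗[F] L) := by
  let σ : WreathHecke F G m →ₐ[F] Module.End F ((⨂[F] _ : Fin m, V) ⊗[F] L) := tensorRep ρ L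
  let _ : Module (WreathHecke F G m) ((⨂[F] _ : Fin m, V) ⊗[F] L) := Module.compHom _ σ.toRingHom
  have hsmul : ∀ (b : WreathHecke F G m) (w : (⨂[F] _ : Fin m, V) ⊗[F] L), b • w = σ b w :=
    fun _ _ => rfl
  have := (isIrreducibleRep_tensorRep (m := m) ρ L).isSimpleModule
  have : IsScalarTower F (WreathHecke F G m) ((⨂[F] _ : Fin m, V) ⊗[F] L) := ⟨fun c b w => by
    rw [hsmul, hsmul, map_smul, LinearMap.smul_apply]⟩
  exact finiteDimensional_of_isSimpleModule (F := F) (G := G) (n := m) _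

end

end TensorModule

end WreathHecke

/-! ### Simple modules over one block -/

namespace DegenerateHecke

variable {F : Type u} [Field F] {q : F} {n : ℕ}

/-- The universal property of the degenerate affine Hecke algebra. -/
def lift {A : Type*} [Ring A] [Algebra F A] (f : Gen n → A)
    (hf : ∀ ⦃a b⦄, Rel F q n a b → FreeAlgebra.lift F f a = FreeAlgebra.lift F f b) :
    DegenerateHecke F q n →ₐ[F] A :=
  RingQuot.liftAlgHom F ⟨FreeAlgebra.lift F f, hf⟩

theorem lift_of {A : Type*} [Ring A] [Algebra F A] (f : Gen n → A)
    (hf : ∀ ⦃a b⦄, Rel F q n a b → FreeAlgebra.lift F f a = FreeAlgebra.lift F f b)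
    (a : Gen n) : lift f hf (of F q a) = f a :=
  (RingQuot.liftAlgHom_mkAlgHom_apply F (FreeAlgebra.lift F f) hf _).trans
    (FreeAlgebra.lift_ι_apply f a)

theorem intertwine_of_gen {W P : Type*} [AddCommGroup W] [Module F W] [AddCommGroup P] [Module F P]
    (σ : DegenerateHecke F q n →ₐ[F] Module.End F W) (τ : DegenerateHecke F q n →ₐ[F] Module.End F P)
    (f : W →ₗ[F] P) (h : ∀ a w, f (σ (of F q a) w) = τ (of F q a) (f w))
    (p : DegenerateHecke F q n) (w : W) : f (σ p w) = τ p (f w) := by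
  let S : Subalgebra F (DegenerateHecke F q n) :=
    { carrier := {p | ∀ w, f (σ p w) = τ p (f w)}
      mul_mem' := fun {a b} ha hb w => by
        rw [map_mul, map_mul, Module.End.mul_apply, Module.End.mul_apply, ha, hb]
      add_mem' := fun {a b} ha hb w => by
        rw [map_add, map_add, LinearMap.add_apply, LinearMap.add_apply, map_add, ha, hb]
      algebraMap_mem' := fun c w => by simp [Algebra.algebraMap_eq_smul_one] }
  exact mem_of_forall_gen S h p w

end DegenerateHecke

namespace WreathHecke

section TensorModule

variable {F : Type u} [Field F] {G : Type v} [Group G] [Fintype G] {m : ℕ}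

theorem intertwine_of_gen {W P : Type*} [AddCommGroup W] [Module F W] [AddCommGroup P] [Module F P]
    (σ : WreathHecke F G m →ₐ[F] Module.End F W) (τ : WreathHecke F G m →ₐ[F] Module.End F P)
    (f : W →ₗ[F] P) (h : ∀ a w, f (σ (of F a) w) = τ (of F a) (f w))
    (p : WreathHecke F G m) (w : W) : f (σ p w) = τ p (f w) := by
  let S : Subalgebra F (WreathHecke F G m) :=
    { carrier := {p | ∀ w, f (σ p w) = τ p (f w)}
      mul_mem' := fun {a b} ha hb w => by
        rw [map_mul, map_mul, Module.End.mul_apply, Module.End.mul_apply, ha, hb]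
      add_mem' := fun {a b} ha hb w => by
        rw [map_add, map_add, LinearMap.add_apply, LinearMap.add_apply, map_add, ha, hb]
      algebraMap_mem' := fun c w => by simp [Algebra.algebraMap_eq_smul_one] }
  exact mem_of_forall_gen S h p w

variable [IsAlgClosed F]
  {V : Type w} [AddCommGroup V] [Module F V] [FiniteDimensional F V] (ρ : Representation F G V)
  [ρ.IsIrreducible]

section Multiplicity

variable {P : Type y} [AddCommGroup P] [Module F P] (τ : WreathHecke F G m →ₐ[F] Module.End F P)

omit [IsAlgClosed F] [FiniteDimensional F V] [ρ.IsIrreducible] in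
variable {ρ τ} in
-- Under `hJ` the group algebra at each position acts on `P` through its image in `End V`. Elements
-- may therefore be exchanged for others with the same action on `V`, which allows computing on `P`
-- with matrix units.
theorem map_posHom_congr (hJ : ∀ i a, ρ.asAlgebraHom a = 0 → τ (posHom F i a) = 0) (i : Fin m)
    {a a' : MonoidAlgebra F G} (h : ρ.asAlgebraHom a = ρ.asAlgebraHom a') :
    τ (posHom F i a) = τ (posHom F i a') := by
  have := hJ i (a - a') (by rw [map_sub, h, sub_self])
  rwa [map_sub, map_sub, sub_eq_zero] at this

omit [IsAlgClosed F] [FiniteDimensional F V] [ρ.IsIrreducible] in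
variable {ρ τ} in
theorem map_posProd_congr (hJ : ∀ i a, ρ.asAlgebraHom a = 0 → τ (posHom F i a) = 0)
    {u u' : Fin m → MonoidAlgebra F G} (h : ∀ i, ρ.asAlgebraHom (u i) = ρ.asAlgebraHom (u' i)) :
    τ (posProd F G m u) = τ (posProd F G m u') := by
  rw [posProd_apply, posProd_apply, map_list_prod, map_list_prod, List.map_ofFn, List.map_ofFn]
  congr 2
  funext i
  exact map_posHom_congr hJ i (h i)

/-- The common image of the operators `e`, placed at all positions. -/
def multSpace (e : MonoidAlgebra F G) : Submodule F P where
  carrier := {n | ∀ i, τ (posHom F i e) n = n}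
  add_mem' := fun {a b} ha hb i => by rw [map_add, ha, hb]
  zero_mem' := fun i => map_zero _
  smul_mem' := fun c a ha i => by rw [map_smul, ha]

omit [IsAlgClosed F] in
theorem x_mem_multSpace {e : MonoidAlgebra F G} (j : Fin m) {n : P} (hn : n ∈ multSpace τ e) :
    τ (of F (.x j)) n ∈ multSpace τ e := fun i => by
  rw [← Module.End.mul_apply, ← map_mul, ← x_mul_posHom, map_mul, Module.End.mul_apply, hn i]

omit [IsAlgClosed F] in
theorem s_mem_multSpace {e : MonoidAlgebra F G} (j : ℕ) (h : j + 1 < m) {n : P}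
    (hn : n ∈ multSpace τ e) : τ (of F (.s j h)) n ∈ multSpace τ e := fun i => by
  have := s_mul_posHom j h (simpleTransposition j h i) e
  rw [show simpleTransposition j h (simpleTransposition j h i) = i from
    DFunLike.congr_fun (simpleTransposition_mul_self j h) i] at this
  rw [← Module.End.mul_apply, ← map_mul, ← this, map_mul, Module.End.mul_apply, hn]

/-- The action of the generators of the degenerate affine Hecke algebra on the multiplicity space. -/
def multGen (c : F) (e : MonoidAlgebra F G) : DegenerateHecke.Gen m → Module.End F (multSpace τ e)
  | .y i => c⁻¹ • (τ (of F (.x i))).restrict fun _ hn => x_mem_multSpace τ i hn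
  | .s i h => (τ (of F (.s i h))).restrict fun _ hn => s_mem_multSpace τ i h hn

omit [IsAlgClosed F] in
-- The one relation with a correction term holds because `swapElt` is the scalar `c * q` on the
-- multiplicity space, and dividing `x_i` by `c` leaves `q`.
theorem multGen_rel {c q : F} (hc : c ≠ 0) {e : MonoidAlgebra F G}
    (hswap : ∀ i j : Fin m, i ≠ j → ∀ n ∈ multSpace τ e, τ (swapElt F G i j) n = (c * q) • n)
    ⦃a b : FreeAlgebra F (DegenerateHecke.Gen m)⦄ (hab : DegenerateHecke.Rel F q m a b) :
    FreeAlgebra.lift F (multGen τ c e) a = FreeAlgebra.lift F (multGen τ c e) b := by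
  have hy : ∀ i (n : multSpace τ e), (multGen τ c e (.y i) n : P) = c⁻¹ • τ (of F (.x i)) n :=
    fun i n => rfl
  have hs : ∀ i h (n : multSpace τ e), (multGen τ c e (.s i h) n : P) = τ (of F (.s i h)) n :=
    fun i h n => rfl
  refine LinearMap.ext fun n => Subtype.ext ?_
  cases hab with
  | y_comm i j =>
    simp only [FreeAlgebra.lift_ι_apply, map_mul, Module.End.mul_apply, hy, map_smul]
    rw [← Module.End.mul_apply, ← map_mul, x_comm, map_mul, Module.End.mul_apply]
  | s_sq i h =>
    simp only [FreeAlgebra.lift_ι_apply, map_mul, map_one, Module.End.mul_apply, hs,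
      Module.End.one_apply]
    rw [← Module.End.mul_apply, ← map_mul, s_sq, map_one, Module.End.one_apply]
  | s_comm i j hi hj hij =>
    simp only [FreeAlgebra.lift_ι_apply, map_mul, Module.End.mul_apply, hs]
    rw [← Module.End.mul_apply, ← map_mul, s_comm i j hi hj hij, map_mul, Module.End.mul_apply]
  | s_braid i h =>
    simp only [FreeAlgebra.lift_ι_apply, map_mul, Module.End.mul_apply, hs]
    simp only [← Module.End.mul_apply, ← map_mul, ← mul_assoc]
    rw [s_braid]
  | s_y i h =>
    simp only [FreeAlgebra.lift_ι_apply, map_mul, map_sub, Module.End.mul_apply, hs, hy, map_smul,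
      LinearMap.sub_apply, AlgHom.commutes, Module.algebraMap_end_apply, Submodule.coe_sub,
      Submodule.coe_smul]
    rw [← Module.End.mul_apply, ← map_mul, s_mul_x, map_sub, map_mul, LinearMap.sub_apply,
      Module.End.mul_apply, hswap _ _ (by simp [Fin.ext_iff]) _ n.2, smul_sub, ← mul_smul,
      inv_mul_cancel_left₀ hc]
  | s_y_of_ne i h j h₁ h₂ =>
    simp only [FreeAlgebra.lift_ι_apply, map_mul, Module.End.mul_apply, hs, hy, map_smul]
    rw [← Module.End.mul_apply, ← map_mul, s_x_of_ne i h j h₁ h₂, map_mul, Module.End.mul_apply]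

/-- A nonzero finite dimensional module all of whose restrictions to the factors of `G ^ m` are
sums of copies of `V` receives a nonzero map from some `V^{⊗ m} ⊗ L` with `L` simple. -/
theorem exists_tensor_hom_ne_zero [FiniteDimensional F P] [Nontrivial P]
    (hJ : ∀ i a, ρ.asAlgebraHom a = 0 → τ (posHom F i a) = 0) :
    ∃ (L : Type u) (_ : AddCommGroup L) (_ : Module F L)
      (_ : Module (TwistedHecke (swapScalar ρ) m) L)
      (_ : IsScalarTower F (TwistedHecke (swapScalar ρ) m) L),
      IsSimpleModule (TwistedHecke (swapScalar ρ) m) L ∧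
      ∃ f : (⨂[F] _ : Fin m, V) ⊗[F] L →ₗ[F] P, f ≠ 0 ∧
        ∀ p w, f (tensorRep ρ L p w) = τ p (f w) := by
  classical
  have hV := nontrivial_of_isIrreducible ρ
  let b := Module.finBasis F V
  let i₀ : Fin (Module.finrank F V) := b.index_nonempty.some
  obtain ⟨S, hS⟩ := exists_lift_end ρ
  -- The element `a v` acts on `V` as the rank one operator sending `x` to its `i₀`-th coordinate
  -- times `v`; in particular `e` acts as a rank one idempotent.
  let a : V →ₗ[F] MonoidAlgebra F G := S ∘ₗ LinearMap.smulRightₗ (b.coord i₀)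
  have ha : ∀ v x, ρ.asAlgebraHom (a v) x = b.repr x i₀ • v := by
    intro v x
    simp [a, hS]
  let e := a (b i₀)
  have hmul : ∀ (c : MonoidAlgebra F G) v,
      ρ.asAlgebraHom (c * a v) = ρ.asAlgebraHom (a (ρ.asAlgebraHom c v)) := by
    intro c v
    ext x
    rw [map_mul, Module.End.mul_apply, ha, ha, map_smul]
  have hone : ∀ v, ρ.asAlgebraHom (a v * e) = ρ.asAlgebraHom (a v) := by
    intro v
    rw [hmul, ha]
    simp
  -- the multiplicity space is nonzero
  obtain ⟨n₀, hn₀, hn₀N⟩ : ∃ n : P, n ≠ 0 ∧ n ∈ multSpace τ e := by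
    suffices h : ∀ s : Finset (Fin m), ∃ n : P, n ≠ 0 ∧ ∀ i ∈ s, τ (posHom F i e) n = n by
      obtain ⟨n, h1, h2⟩ := h Finset.univ
      exact ⟨n, h1, fun i => h2 i (Finset.mem_univ i)⟩
    intro s
    induction s using Finset.induction_on with
    | empty =>
      obtain ⟨n, hn⟩ := exists_ne (0 : P)
      exact ⟨n, hn, by simp⟩
    | insert i s hi ih =>
      obtain ⟨n, hn, hns⟩ := ih
      -- In matrix units, `1 = ∑ j, E_{j i₀} E_{i₀ i₀} E_{i₀ j}`. Hence some `e * q j` does not kill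
      -- `n`, and its value at `n` is fixed by `e`.
      let q := fun j => S ((b.coord j).smulRight (b i₀))
      obtain ⟨j, hj⟩ : ∃ j, τ (posHom F i (e * q j)) n ≠ 0 := by
        by_contra! h
        refine hn ?_
        have h1 : ρ.asAlgebraHom (∑ j, a (b j) * (e * q j)) = ρ.asAlgebraHom 1 := by
          ext x
          simp only [map_sum, map_mul, map_one, LinearMap.sum_apply, Module.End.mul_apply, ha, q, hS,
            e, LinearMap.smulRight_apply, Module.Basis.coord_apply, map_smul,
            Module.Basis.repr_self, Finsupp.smul_apply, Finsupp.single_eq_same, smul_eq_mul,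
            mul_one, Module.End.one_apply]
          exact b.sum_repr x
        have h2 := LinearMap.congr_fun (map_posHom_congr hJ i h1) n
        rw [map_one, map_one, Module.End.one_apply, map_sum, map_sum, LinearMap.sum_apply] at h2
        rw [← h2]
        refine Finset.sum_eq_zero fun j _ => ?_
        rw [map_mul, map_mul, Module.End.mul_apply, h, map_zero]
      refine ⟨_, hj, fun k hk => ?_⟩
      by_cases hki : k = i
      · subst hki
        rw [← Module.End.mul_apply, ← map_mul, ← map_mul]
        refine LinearMap.congr_fun (map_posHom_congr hJ k ?_) n
        rw [← mul_assoc, map_mul, hone, ← map_mul]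
      · have hks : k ∈ s := (Finset.mem_insert.1 hk).resolve_left hki
        rw [← Module.End.mul_apply, ← map_mul, (posHom_commute hki _ _).eq, map_mul,
          Module.End.mul_apply, hns k hks]
  have hswap : ∀ i j : Fin m, i ≠ j → ∀ n ∈ multSpace τ e,
      τ (swapElt F G i j) n = (heckeScale (swapScalar ρ) * heckeParam (swapScalar ρ)) • n := by
    intro i j hij n hn
    rw [heckeScale_mul_heckeParam]
    -- Feeding this bilinear map with the identity defining the swap scalar at `b i₀ ⊗ b i₀`, a
    -- tensor fixed by the flip, computes `swapElt` on `n`.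
    let β : V →ₗ[F] V →ₗ[F] P := LinearMap.mk₂ F
      (fun v w => τ (posHom F i (a v)) (τ (posHom F j (a w)) n))
      (fun v v' w => by simp) (fun c v w => by simp) (fun v w w' => by simp)
      (fun c v w => by simp)
    have h := congrArg (TensorProduct.lift β) (swapScalar_spec ρ (b i₀) (b i₀))
    simp only [map_sum, map_smul, TensorProduct.lift.tmul] at h
    have h0 : β (b i₀) (b i₀) = n := by
      change τ (posHom F i e) (τ (posHom F j e) n) = n
      rw [hn, hn]
    rw [h0] at h
    rw [← h, swapElt, map_sum, LinearMap.sum_apply]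
    refine Finset.sum_congr rfl fun g _ => ?_
    have hg : ∀ k (g : G) (x : P), τ (posHom F k (MonoidAlgebra.of F G g)) (τ (posHom F k e) x)
        = τ (posHom F k (a (ρ g (b i₀)))) x := by
      intro k g x
      rw [← Module.End.mul_apply, ← map_mul, ← map_mul]
      refine LinearMap.congr_fun (map_posHom_congr hJ k ?_) x
      rw [hmul]
      simp
    change _ = τ (posHom F i (a (ρ g (b i₀)))) (τ (posHom F j (a (ρ g⁻¹ (b i₀)))) n)
    rw [← hg, ← hg, hn j, ← Module.End.mul_apply (τ (posHom F i e)), ← map_mul,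
      (posHom_commute hij _ _).eq, map_mul, Module.End.mul_apply, hn i, ← grp_mul, map_mul,
      Module.End.mul_apply, posHom_of, posHom_of]
  let σ : TwistedHecke (swapScalar ρ) m →ₐ[F] Module.End F (multSpace τ e) :=
    DegenerateHecke.lift _ (multGen_rel τ (heckeScale_ne_zero (swapScalar ρ)) hswap)
  have hσx : ∀ i (n : multSpace τ e),
      τ (of F (.x i)) n = heckeScale (swapScalar ρ) • (σ (DegenerateHecke.of F _ (.y i)) n : P) := by
    intro i n
    simp only [σ, DegenerateHecke.lift_of]
    change _ = heckeScale (swapScalar ρ) • ((heckeScale (swapScalar ρ))⁻¹ • τ (of F (.x i)) n)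
    rw [smul_inv_smul₀ (heckeScale_ne_zero _)]
  have hσs : ∀ i h (n : multSpace τ e),
      τ (of F (.s i h)) n = (σ (DegenerateHecke.of F _ (.s i h)) n : P) := by
    intro i h n
    simp only [σ, DegenerateHecke.lift_of]
    rfl
  -- A vector generating a simple submodule of the multiplicity space. Taking `L` as a quotient of
  -- the algebra, rather than as a subspace of `P`, places it in the universe `u`.
  obtain ⟨b₀, hb₀, hsimple⟩ := exists_generatesSimple σ (⟨n₀, hn₀N⟩ : multSpace τ e)
    (fun h => hn₀ (congrArg Subtype.val h)) inferInstance
  set n₁ := σ b₀ ⟨n₀, hn₀N⟩ with hn₁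
  let L := TwistedHecke (swapScalar ρ) m ⧸ annVec σ n₁
  let Φ : MultilinearMap F (fun _ : Fin m => V) (multSpace τ e →ₗ[F] P) :=
    ((LinearMap.lcomp F P (multSpace τ e).subtype).comp τ.toLinearMap).compMultilinearMap
      ((posProd F G m).compLinearMap fun _ => a)
  have hΦ : ∀ v n, Φ v n = τ (posProd F G m fun i => a (v i)) n := fun v n => rfl
  let f : (⨂[F] _ : Fin m, V) ⊗[F] L →ₗ[F] P :=
    TensorProduct.lift ((LinearMap.lcomp F P (orbitMap σ n₁)).comp (PiTensorProduct.lift Φ))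
  have hf : ∀ v (l : L), f (PiTensorProduct.tprod F v ⊗ₜ l)
      = τ (posProd F G m fun i => a (v i)) (orbitMap σ n₁ l) := by
    intro v l
    simp [f, hΦ]
  refine ⟨L, inferInstance, inferInstance, inferInstance, inferInstance,
    hsimple.isSimpleModule hb₀, f, fun h0 => ?_, intertwine_of_gen _ _ f fun p w => ?_⟩
  -- At this vector `f` applies `e` at all positions to `n₁`, which `n₁` survives unchanged.
  · have h1 := hf (fun _ => b i₀) (Submodule.Quotient.mk 1)
    rw [h0, orbitMap_mk, map_one, Module.End.one_apply, posProd_apply, map_list_prod,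
      List.map_ofFn] at h1
    have h2 : ∀ l : List (Module.End F P), (∀ T ∈ l, T n₁ = n₁) → l.prod n₁ = n₁ := by
      intro l
      induction l with
      | nil => simp
      | cons T l ih =>
        intro h
        rw [List.prod_cons, Module.End.mul_apply, ih fun T hT => h T (List.mem_cons_of_mem _ hT),
          h T List.mem_cons_self]
    rw [h2 _ fun T hT => by
      obtain ⟨i, rfl⟩ := (List.mem_ofFn' _ _).1 hT
      exact n₁.2 i] at h1
    exact hb₀ (Subtype.ext h1.symm)
  · induction w using TensorProduct.induction_on with
    | zero => simp
    | add x y hx hy => simp only [map_add, hx, hy]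
    | tmul t l =>
      induction t using PiTensorProduct.induction_on with
      | add x y hx hy => simp only [TensorProduct.add_tmul, map_add, hx, hy]
      | smul_tprod c v =>
        rw [← TensorProduct.smul_tmul', map_smul, map_smul, map_smul, map_smul]
        congr 1
        rcases p with g | i | ⟨i, h⟩
        · rw [hf, ← posProd_of, tensorRep_posProd_tmul, PiTensorProduct.map_tprod, hf,
            ← Module.End.mul_apply, ← map_mul, ← posProd_mul]
          -- The elements `g * a v` and `a (g v)` need not be equal, but they act equally on `V`.
          refine LinearMap.congr_fun (map_posProd_congr hJ fun i => ?_) _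
          rw [Pi.mul_apply, hmul]
        · rw [hf, tensorRep_x, map_smul, hf, ← Module.End.mul_apply, ← map_mul, x_mul_posProd,
            map_mul, Module.End.mul_apply, hσx, orbitMap_smul, LinearMap.map_smul (τ _)]
        · rw [hf, tensorRep_s, hf, ← Module.End.mul_apply, ← map_mul, ← permHom_simpleTransposition,
            permHom_mul_posProd, permHom_simpleTransposition, map_mul, Module.End.mul_apply, hσs,
            orbitMap_smul]
          simp [simpleTransposition]

end Multiplicity

/-- A nonzero homomorphism `V^{⊗ m} ⊗ L → V^{⊗ m} ⊗ L'` comes from an isomorphism `L ≃ L'`. -/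
theorem nonempty_linearEquiv_of_tensor_hom (L : Type z) (L' : Type z')
    [AddCommGroup L] [Module F L] [Module (TwistedHecke (swapScalar ρ) m) L]
    [IsScalarTower F (TwistedHecke (swapScalar ρ) m) L]
    [IsSimpleModule (TwistedHecke (swapScalar ρ) m) L]
    [AddCommGroup L'] [Module F L'] [Module (TwistedHecke (swapScalar ρ) m) L']
    [IsScalarTower F (TwistedHecke (swapScalar ρ) m) L']
    [IsSimpleModule (TwistedHecke (swapScalar ρ) m) L']
    (θ : (⨂[F] _ : Fin m, V) ⊗[F] L →ₗ[F] (⨂[F] _ : Fin m, V) ⊗[F] L') (hθ : θ ≠ 0)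
    (hcomm : ∀ p w, θ (tensorRep ρ L p w) = tensorRep ρ L' p (θ w)) :
    Nonempty (L ≃ₗ[TwistedHecke (swapScalar ρ) m] L') := by
  have hV := nontrivial_of_isIrreducible ρ
  let b := Module.finBasis F V
  let i₀ : Fin (Module.finrank F V) := b.index_nonempty.some
  obtain ⟨S, hS⟩ := exists_lift_end ρ
  let t₀ : ⨂[F] _ : Fin m, V := PiTensorProduct.tprod F fun _ => b i₀
  let bt := Basis.piTensorProduct fun _ : Fin m => b
  let ψ : (⨂[F] _ : Fin m, V) →ₗ[F] F := bt.coord fun _ => i₀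
  -- On `V^{⊗ m}` the element `p v` acts as `t ↦ ψ t • tprod v`. Since `θ` commutes with `p`, it
  -- sends `t₀ ⊗ l` to `t₀ ⊗ θ' l`, and `θ'` is the induced map on multiplicity spaces.
  let p : (Fin m → V) → WreathHecke F G m := fun v =>
    posProd F G m fun i => S ((b.coord i₀).smulRight (v i))
  have hmap : ∀ (v : Fin m → V) (t : ⨂[F] _ : Fin m, V),
      PiTensorProduct.map (fun i => (b.coord i₀).smulRight (v i)) t
        = ψ t • PiTensorProduct.tprod F v := by
    intro v t
    have : PiTensorProduct.map (fun i => (b.coord i₀).smulRight (v i))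
        = ψ.smulRight (PiTensorProduct.tprod F v) := by
      refine bt.ext fun h => ?_
      rw [LinearMap.smulRight_apply, Module.Basis.coord_apply]
      simp only [bt, Basis.piTensorProduct_apply, PiTensorProduct.map_tprod,
        LinearMap.smulRight_apply, Module.Basis.coord_apply, MultilinearMap.map_smul_univ,
        Basis.piTensorProduct_repr_tprod_apply]
    rw [this]; rfl
  have hψ : ψ t₀ = 1 := by
    have : t₀ = bt fun _ => i₀ := by simp [t₀, bt]
    rw [this]
    simp [ψ]
  let π : (⨂[F] _ : Fin m, V) ⊗[F] L' →ₗ[F] L' := TensorProduct.lid F L' ∘ₗ ψ.rTensor L'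
  have hπ : ∀ t l, π (t ⊗ₜ l) = ψ t • l := by intro t l; simp [π]
  have hp : ∀ v x, tensorRep ρ L' (p v) x = PiTensorProduct.tprod F v ⊗ₜ π x := by
    intro v x
    induction x using TensorProduct.induction_on with
    | zero => simp
    | add x y hx hy => rw [map_add, map_add, hx, hy, TensorProduct.tmul_add]
    | tmul t l =>
      rw [tensorRep_posProd_tmul]
      simp only [hS]
      rw [hmap, hπ, TensorProduct.smul_tmul]
  have hp' : ∀ v (t : ⨂[F] _ : Fin m, V) (l : L),
      tensorRep ρ L (p v) (t ⊗ₜ l) = ψ t • (PiTensorProduct.tprod F v ⊗ₜ l) := by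
    intro v t l
    rw [tensorRep_posProd_tmul]
    simp only [hS]
    rw [hmap, TensorProduct.smul_tmul']
  let θ' : L →ₗ[F] L' := π ∘ₗ θ ∘ₗ TensorProduct.mk F _ _ t₀
  have hθ' : ∀ l, θ (t₀ ⊗ₜ l) = t₀ ⊗ₜ θ' l := by
    intro l
    have := hcomm (p fun _ => b i₀) (t₀ ⊗ₜ l)
    rw [hp', hψ, one_smul, hp] at this
    exact this
  have hlin : ∀ (q : TwistedHecke (swapScalar ρ) m) l, θ' (q • l) = q • θ' l := by
    refine DegenerateHecke.intertwine_of_gen (Algebra.lsmul F F L) (Algebra.lsmul F F L') θ' ?_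
    rintro (i | ⟨i, h⟩) l
    · have h1 := congrArg π (hcomm (of F (.x i)) (t₀ ⊗ₜ l))
      rw [tensorRep_x, hθ', tensorRep_x, LinearMap.map_smul θ, hθ', LinearMap.map_smul π,
        LinearMap.map_smul π, hπ, hπ, hψ, one_smul, one_smul] at h1
      exact smul_right_injective _ (heckeScale_ne_zero (swapScalar ρ)) h1
    · have h1 := congrArg π (hcomm (of F (.s i h)) (t₀ ⊗ₜ l))
      rw [tensorRep_s, hθ', hθ', tensorRep_s, hπ, hπ, hψ, one_smul, one_smul] at h1
      exact h1
  let θ'' : L →ₗ[TwistedHecke (swapScalar ρ) m] L' := { θ' with map_smul' := hlin }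
  rcases LinearMap.bijective_or_eq_zero θ'' with h | h
  · exact ⟨LinearEquiv.ofBijective θ'' h⟩
  -- Every pure tensor is obtained from `t₀ ⊗ l` by some `p v`, so `θ' = 0` would give `θ = 0`.
  · refine absurd (TensorProduct.ext' fun t l => ?_) hθ
    have h0 : θ' l = 0 := LinearMap.congr_fun h l
    induction t using PiTensorProduct.induction_on with
    | add x y hx hy => rw [TensorProduct.add_tmul, map_add, hx, hy]; simp
    | smul_tprod c v =>
      have h1 := hcomm (p v) (t₀ ⊗ₜ l)
      rw [hp', hψ, one_smul, hθ', h0, TensorProduct.tmul_zero, map_zero] at h1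
      rw [← TensorProduct.smul_tmul', map_smul, h1]
      simp

end TensorModule

end WreathHecke

namespace WreathHecke

/-! ### Weights -/

section Weights

variable {F : Type u} [Field F] {G : Type v} [Group G] [Fintype G] {r : ℕ}
  {V : Fin r → Type w} [∀ k, AddCommGroup (V k)] [∀ k, Module F (V k)]
  (ρ : ∀ k, Representation F G (V k)) {n : ℕ}

omit [Fintype G] in
/-- Elements of the group algebra acting as the identity on one of the simple modules and as zero
on all the others. -/
theorem exists_separating [IsAlgClosed F] [∀ k, FiniteDimensional F (V k)]
    [∀ k, (ρ k).IsIrreducible] (hdistinct : ∀ k l, Nonempty ((ρ k).Equiv (ρ l)) → k = l) :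
    ∃ ε : Fin r → MonoidAlgebra F G, ∀ k l, (ρ l).asAlgebraHom (ε k) = if k = l then 1 else 0 := by
  have h : ∀ k l, Nonempty ((ρ k).asModule ≃ₗ[MonoidAlgebra F G] (ρ l).asModule) → k = l := by
    rintro k l ⟨e⟩
    refine hdistinct k l ⟨((Representation.IntertwiningMap.equivLinearMapAsModule (ρ k) (ρ l)).symm
      e.toLinearMap).ofBijective ?_⟩
    exact e.bijective
  choose ε hε using fun k => exists_smul_eq_of_pairwise_not_equiv (F := F) (B := MonoidAlgebra F G)
    (W := fun l => (ρ l).asModule) h (fun l => if k = l then 1 else 0)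
  refine ⟨ε, fun k l => LinearMap.ext fun w => ?_⟩
  exact hε k l w

variable {M : Type*} [AddCommGroup M] [Module F M]

/-- The vector `v` has weight `c` if, at each position `i`, it is annihilated by the elements of the
group algebra that annihilate the simple module number `c i`. -/
def HasWeight (τ : WreathHecke F G n →ₐ[F] Module.End F M) (c : Fin n → Fin r) (v : M) : Prop :=
  ∀ i a, (ρ (c i)).asAlgebraHom a = 0 → τ (posHom F i a) v = 0

/-- The element that projects to the weight `c`. -/
def weightElt (ε : Fin r → MonoidAlgebra F G) (c : Fin n → Fin r) : WreathHecke F G n :=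
  posProd F G n fun i => ε (c i)

variable {ρ} {τ : WreathHecke F G n →ₐ[F] Module.End F M} {c : Fin n → Fin r} {v : M}

theorem HasWeight.permHom (h : HasWeight ρ τ c v) (σ : Equiv.Perm (Fin n)) :
    HasWeight ρ τ (fun i => c (σ⁻¹ i)) (τ (permHom F G n σ) v) := by
  intro i a ha
  have := permHom_mul_posHom (F := F) σ (σ⁻¹ i) a
  rw [show σ (σ⁻¹ i) = i by simp] at this
  rw [← Module.End.mul_apply, ← map_mul, ← this, map_mul, Module.End.mul_apply, h _ _ ha, map_zero]

theorem posHom_separating_apply {ε : Fin r → MonoidAlgebra F G}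
    (hε : ∀ k l, (ρ l).asAlgebraHom (ε k) = if k = l then 1 else 0) (h : HasWeight ρ τ c v)
    (i : Fin n) (k : Fin r) :
    τ (posHom F i (ε k)) v = (if k = c i then (1 : F) else 0) • v := by
  split_ifs with hk
  · have := h i (ε k - 1) (by rw [map_sub, hε, if_pos hk, map_one, sub_self])
    rw [map_sub, map_sub, map_one, map_one, LinearMap.sub_apply, sub_eq_zero] at this
    rw [this, one_smul]
    rfl
  · rw [zero_smul]
    exact h i (ε k) (by rw [hε, if_neg hk])

theorem list_prod_ofFn_apply {m : ℕ} (T : Fin m → Module.End F M) (d : Fin m → F) (v : M)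
    (h : ∀ i, T i v = d i • v) : (List.ofFn T).prod v = (∏ i, d i) • v := by
  induction m with
  | zero => simp
  | succ m ih =>
    rw [List.ofFn_succ, List.prod_cons, Module.End.mul_apply, ih (fun i => T i.succ)
      (fun i => d i.succ) (fun i => h _), map_smul, h, Fin.prod_univ_succ, mul_comm, mul_smul]

/-- Each position contributes a factor one or zero according to whether the two labels agree there,
so a single disagreement kills the vector. -/
theorem weightElt_apply {ε : Fin r → MonoidAlgebra F G}
    (hε : ∀ k l, (ρ l).asAlgebraHom (ε k) = if k = l then 1 else 0) (h : HasWeight ρ τ c v)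
    (c' : Fin n → Fin r) : τ (weightElt ε c') v = if c' = c then v else 0 := by
  rw [weightElt, posProd_apply, map_list_prod, List.map_ofFn,
    list_prod_ofFn_apply (τ ∘ fun i => posHom F i (ε (c' i))) (fun i => if c' i = c i then (1 : F) else 0) v
      fun i => posHom_separating_apply hε h i (c' i)]
  split_ifs with hc
  · subst hc; simp
  · obtain ⟨i, hi⟩ := Function.ne_iff.1 hc
    rw [Finset.prod_eq_zero (Finset.mem_univ i) (if_neg hi), zero_smul]

theorem weightElt_mul_permHom (ε : Fin r → MonoidAlgebra F G) (c : Fin n → Fin r)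
    (σ : Equiv.Perm (Fin n)) : weightElt ε c * WreathHecke.permHom F G n σ
      = WreathHecke.permHom F G n σ * weightElt ε fun i => c (σ i) := by
  rw [weightElt, weightElt, permHom_mul_posProd]
  simp

end Weights

/-! ### Blocks -/

section Blocks

variable {r n : ℕ} (ν : Fin r → ℕ) (hν : ∑ k, ν k = n)

theorem shift_offset_injective : Function.Injective
    fun p : (Σ k, Fin (ν k)) => shift (offset_add_le ν hν p.1) p.2 := by
  rintro ⟨k, i⟩ ⟨l, j⟩ h
  simp only [shift, Fin.mk.injEq] at h
  rcases lt_trichotomy k l with hkl | rfl | hkl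
  · have := offset_le_offset ν hkl; omega
  · rw [Sigma.mk.injEq]
    exact ⟨rfl, heq_of_eq (Fin.ext (by omega))⟩
  · have := offset_le_offset ν hkl; omega

/-- The positions, described by a block and a position in that block. -/
def blockEquiv : (Σ k, Fin (ν k)) ≃ Fin n :=
  Equiv.ofBijective (fun p => shift (offset_add_le ν hν p.1) p.2)
    ((Fintype.bijective_iff_injective_and_card _).2 ⟨shift_offset_injective ν hν, by simp [hν]⟩)

theorem blockEquiv_apply (k : Fin r) (j : Fin (ν k)) :
    blockEquiv ν hν ⟨k, j⟩ = shift (offset_add_le ν hν k) j := rfl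

/-- The block of a position. -/
def block (i : Fin n) : Fin r := ((blockEquiv ν hν).symm i).1

theorem block_blockEquiv (k : Fin r) (j : Fin (ν k)) : block ν hν (blockEquiv ν hν ⟨k, j⟩) = k := by
  simp [block]

theorem exists_blockEquiv (i : Fin n) : ∃ k j, blockEquiv ν hν ⟨k, j⟩ = i :=
  ⟨_, _, (blockEquiv ν hν).apply_symm_apply i⟩

theorem exists_blockEquiv_of_block_eq {i i' : Fin n} (h : block ν hν i = block ν hν i') :
    ∃ k j j', blockEquiv ν hν ⟨k, j⟩ = i ∧ blockEquiv ν hν ⟨k, j'⟩ = i' := by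
  obtain ⟨k, j, rfl⟩ := exists_blockEquiv ν hν i
  obtain ⟨k', j', rfl⟩ := exists_blockEquiv ν hν i'
  rw [block_blockEquiv, block_blockEquiv] at h
  subst h
  exact ⟨k, j, j', rfl, rfl⟩

theorem blockEquiv_lt_iff {k : Fin r} {j j' : Fin (ν k)} :
    blockEquiv ν hν ⟨k, j⟩ < blockEquiv ν hν ⟨k, j'⟩ ↔ j < j' := by
  rw [blockEquiv_apply, blockEquiv_apply, Fin.lt_def, Fin.lt_def]
  simp only [shift]
  omega

theorem card_block (k : Fin r) : (Finset.univ.filter fun i => block ν hν i = k).card = ν k := by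
  have : (Finset.univ.filter fun i => block ν hν i = k)
      = Finset.univ.map ⟨fun j : Fin (ν k) => blockEquiv ν hν ⟨k, j⟩, fun j j' h => by
          simpa using h⟩ := by
    ext i
    simp only [Finset.mem_filter, Finset.mem_univ, true_and, Finset.mem_map]
    constructor
    · rintro rfl
      exact ⟨((blockEquiv ν hν).symm i).2, (blockEquiv ν hν).apply_symm_apply i⟩
    · rintro ⟨j, rfl⟩
      exact block_blockEquiv ν hν k j
  rw [this, Finset.card_map, Finset.card_univ, Fintype.card_fin]

end Blocks

/-! ### The parabolic algebra -/

section Parabolic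

variable {F : Type u} [Field F] {G : Type v} [Group G] [Fintype G] {r n : ℕ} {ν : Fin r → ℕ}

/-- The embedding of a tensor factor into the parabolic algebra. -/
abbrev factorHom (F : Type u) [Field F] (G : Type v) [Group G] [Fintype G] {r : ℕ} {ν : Fin r → ℕ}
    (k : Fin r) : WreathHecke F G (ν k) →ₐ[F] Parabolic F G ν :=
  PiTensorProduct.singleAlgHom (R := F) (A := fun k => WreathHecke F G (ν k)) k

theorem factorHom_apply (k : Fin r) (p : WreathHecke F G (ν k)) :
    (factorHom F G k p : Parabolic F G ν) = PiTensorProduct.tprod F (Pi.mulSingle k p) := rfl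

theorem factorHom_commute {k l : Fin r} (h : k ≠ l) (p : WreathHecke F G (ν k))
    (q : WreathHecke F G (ν l)) :
    Commute (factorHom F G k p : Parabolic F G ν) (factorHom F G l q) :=
  Commute.tprod (Pi.mulSingle_commute (f := fun k => WreathHecke F G (ν k)) h p q)

theorem parabolicHom_factorHom (hν : ∑ k, ν k = n) (k : Fin r) (p : WreathHecke F G (ν k)) :
    parabolicHom F G ν hν (factorHom F G k p) = blockHom F G (offset_add_le ν hν k) p := by
  rw [factorHom_apply, parabolicHom_tprod, ← prod_ofFn_mulSingle k (blockHom F G _ p)]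
  congr 2
  funext l
  rcases eq_or_ne l k with rfl | h
  · simp
  · simp [h]

theorem blockHom_posHom {a m n : ℕ} (h : a + m ≤ n) (j : Fin m) (b : MonoidAlgebra F G) :
    blockHom F G h (posHom F j b) = posHom F (shift h j) b := by
  induction b using groupAlgebra_induction with
  | h g => rw [posHom_of, posHom_of, blockHom, lift_of, blockGen, extend_mulSingle]
  | hadd a b ha hb => rw [map_add, map_add, map_add, ha, hb]
  | hsmul c a ha => rw [map_smul, map_smul, map_smul, ha]

theorem parabolicHom_factorHom_posHom (hν : ∑ k, ν k = n) (k : Fin r) (j : Fin (ν k))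
    (a : MonoidAlgebra F G) : parabolicHom F G ν hν (factorHom F G k (posHom F j a))
      = posHom F (blockEquiv ν hν ⟨k, j⟩) a := by
  rw [parabolicHom_factorHom, blockHom_posHom]; rfl

theorem parabolic_mem_of_forall_gen (S : Subalgebra F (Parabolic F G ν))
    (h : ∀ k a, factorHom F G k (of F a) ∈ S) (b : Parabolic F G ν) : b ∈ S := by
  have h1 : ∀ k p, factorHom F G k p ∈ S := fun k p =>
    mem_of_forall_gen (S.comap (factorHom F G k)) (fun a => h k a) p
  have h2 : (⊤ : Submonoid (∀ k, WreathHecke F G (ν k)))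
      ≤ S.toSubmonoid.comap (PiTensorProduct.tprodMonoidHom F) := by
    rw [← Submonoid.pi_top Set.univ, ← Submonoid.iSup_map_mulSingle]
    refine iSup_le fun k => ?_
    rintro _ ⟨p, -, rfl⟩
    exact h1 k p
  induction b using PiTensorProduct.induction_on with
  | smul_tprod c p => exact S.smul_mem (h2 (Submonoid.mem_top p)) c
  | add x y hx hy => exact S.add_mem hx hy

theorem parabolic_intertwine_of_gen {W P : Type*} [AddCommGroup W] [Module F W] [AddCommGroup P]
    [Module F P] (σ : Parabolic F G ν →ₐ[F] Module.End F W)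
    (τ : Parabolic F G ν →ₐ[F] Module.End F P)
    (f : W →ₗ[F] P) (h : ∀ k a w, f (σ (factorHom F G k (of F a)) w)
      = τ (factorHom F G k (of F a)) (f w))
    (p : Parabolic F G ν) (w : W) : f (σ p w) = τ p (f w) := by
  let S : Subalgebra F (Parabolic F G ν) :=
    { carrier := {p | ∀ w, f (σ p w) = τ p (f w)}
      mul_mem' := fun {a b} ha hb w => by
        rw [map_mul, map_mul, Module.End.mul_apply, Module.End.mul_apply, ha, hb]
      add_mem' := fun {a b} ha hb w => by
        rw [map_add, map_add, LinearMap.add_apply, LinearMap.add_apply, map_add, ha, hb]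
      algebraMap_mem' := fun c w => by simp [Algebra.algebraMap_eq_smul_one] }
  exact parabolic_mem_of_forall_gen S h p w

end Parabolic

end WreathHecke

namespace WreathHecke

/-! ### A module extending a given module over the parabolic algebra -/

section Extension

variable {F : Type u} [Field F] {G : Type v} [Group G] [Fintype G] {r n : ℕ} {ν : Fin r → ℕ}
  (hν : ∑ k, ν k = n)

/-- The generator `x p` of the parabolic algebra. -/
def parX (F : Type u) [Field F] (G : Type v) [Group G] [Fintype G] (p : Fin n) : Parabolic F G ν :=
  factorHom F G ((blockEquiv ν hν).symm p).1 (of F (.x ((blockEquiv ν hν).symm p).2))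

/-- The generator of the parabolic algebra exchanging `p` and `p + 1`. -/
def parS (F : Type u) [Field F] (G : Type v) [Group G] [Fintype G] (p : Fin n) : Parabolic F G ν :=
  if h : ((blockEquiv ν hν).symm p).2.val + 1 < ν ((blockEquiv ν hν).symm p).1 then
    factorHom F G ((blockEquiv ν hν).symm p).1 (of F (.s ((blockEquiv ν hν).symm p).2 h))
  else 1

/-- The elements of `G ^ n` in the parabolic algebra. -/
def parG (F : Type u) [Field F] (g : Fin n → G) : Parabolic F G ν :=
  PiTensorProduct.tprod F fun k => of F (.grp fun j => g (blockEquiv ν hν ⟨k, j⟩))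

theorem parX_blockEquiv (k : Fin r) (j : Fin (ν k)) :
    parX hν F G (blockEquiv ν hν ⟨k, j⟩) = factorHom F G k (of F (.x j)) := by
  have : ∀ q : Σ k, Fin (ν k), q = ⟨k, j⟩ → (factorHom F G q.1 (of F (.x q.2)) : Parabolic F G ν)
      = factorHom F G k (of F (.x j)) := by rintro _ rfl; rfl
  exact this _ ((blockEquiv ν hν).symm_apply_apply _)

theorem parS_blockEquiv (k : Fin r) (j : ℕ) (h : j + 1 < ν k) :
    parS hν F G (blockEquiv ν hν ⟨k, ⟨j, Nat.lt_of_succ_lt h⟩⟩)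
      = factorHom F G k (of F (.s j h)) := by
  have : ∀ q : Σ k, Fin (ν k), q = ⟨k, ⟨j, Nat.lt_of_succ_lt h⟩⟩ →
      (if h : q.2.val + 1 < ν q.1 then (factorHom F G q.1 (of F (.s q.2 h)) : Parabolic F G ν)
        else 1) = factorHom F G k (of F (.s j h)) := by
    rintro _ rfl
    rw [dif_pos h]
  exact this _ ((blockEquiv ν hν).symm_apply_apply _)

theorem parG_one : parG hν F (1 : Fin n → G) = 1 := by
  rw [parG, PiTensorProduct.one_def]
  congr 1
  funext k
  exact grp_one

theorem parG_mul (g h : Fin n → G) : parG hν F (g * h) = parG hν F g * parG hν F h := by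
  rw [parG, parG, parG, PiTensorProduct.tprod_mul_tprod]
  congr 1
  funext k
  exact (grp_mul _ _).symm

theorem parG_extend (k : Fin r) (g : Fin (ν k) → G) :
    parG hν F (Function.extend (shift (offset_add_le ν hν k)) g 1)
      = factorHom F G k (of F (.grp g)) := by
  rw [parG, factorHom_apply]
  congr 1
  funext l
  rcases eq_or_ne l k with rfl | h
  · rw [Pi.mulSingle_eq_same]
    congr 2
    funext j
    rw [blockEquiv_apply, (shift_injective _).extend_apply]
  · rw [Pi.mulSingle_eq_of_ne h, ← grp_one]
    congr 2
    funext j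
    rw [Function.extend_apply']
    · rfl
    · rintro ⟨i, hi⟩
      rw [← blockEquiv_apply ν hν] at hi
      exact h (congrArg Sigma.fst ((blockEquiv ν hν).injective hi)).symm

theorem parG_mulSingle (k : Fin r) (j : Fin (ν k)) (a : G) :
    parG hν F (Pi.mulSingle (blockEquiv ν hν ⟨k, j⟩) a)
      = factorHom F G k (posHom F j (MonoidAlgebra.of F G a)) := by
  rw [posHom_of, ← parG_extend, extend_mulSingle]; rfl

/-- All the elements involved are pure tensors, so the identity may be checked factor by factor, and
only the `k`-th factor has any content. -/
theorem factorHom_mul_parG {k : Fin r} {p q : WreathHecke F G (ν k)} {g g' : Fin n → G}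
    (h : p * of F (.grp fun j => g (blockEquiv ν hν ⟨k, j⟩))
      = of F (.grp fun j => g' (blockEquiv ν hν ⟨k, j⟩)) * q)
    (hg : ∀ l, l ≠ k → ∀ j, g (blockEquiv ν hν ⟨l, j⟩) = g' (blockEquiv ν hν ⟨l, j⟩)) :
    factorHom F G k p * parG hν F g = parG hν F g' * factorHom F G k q := by
  rw [parG, parG, factorHom_apply, factorHom_apply, PiTensorProduct.tprod_mul_tprod,
    PiTensorProduct.tprod_mul_tprod]
  congr 1
  funext l
  rcases eq_or_ne l k with rfl | hl
  · simp only [Pi.mul_apply, Pi.mulSingle_eq_same]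
    exact h
  · simp only [Pi.mul_apply, Pi.mulSingle_eq_of_ne hl, one_mul, mul_one]
    congr 2
    funext j
    exact hg l hl j

theorem parX_commute (p q : Fin n) : Commute (parX hν F G p : Parabolic F G ν) (parX hν F G q) := by
  obtain ⟨k, i, rfl⟩ := exists_blockEquiv ν hν p
  obtain ⟨l, j, rfl⟩ := exists_blockEquiv ν hν q
  rw [parX_blockEquiv, parX_blockEquiv]
  rcases eq_or_ne k l with rfl | h
  · exact Commute.map (x_comm i j) (factorHom F G k)
  · exact factorHom_commute h _ _

theorem parX_mul_parG (p : Fin n) (g : Fin n → G) :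
    parX hν F G p * parG hν F g = parG hν F g * parX hν F G p := by
  obtain ⟨k, i, rfl⟩ := exists_blockEquiv ν hν p
  rw [parX_blockEquiv]
  exact factorHom_mul_parG hν (x_grp i _) fun _ _ _ => rfl

/-- `p` and `q` are consecutive positions of the same block. -/
def Consecutive (p q : Fin n) : Prop :=
  ∃ (k : Fin r) (j : ℕ) (h : j + 1 < ν k),
    p = blockEquiv ν hν ⟨k, ⟨j, Nat.lt_of_succ_lt h⟩⟩ ∧ q = blockEquiv ν hν ⟨k, ⟨j + 1, h⟩⟩

variable {hν}

theorem parS_mul_self {p q : Fin n} (h : Consecutive hν p q) :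
    parS hν F G p * parS hν F G p = 1 := by
  obtain ⟨k, j, hj, rfl, rfl⟩ := h
  rw [parS_blockEquiv hν k j hj, ← map_mul, s_sq, map_one]

theorem parS_commute {p q p' q' : Fin n} (h : Consecutive hν p q) (h' : Consecutive hν p' q')
    (h1 : p ≠ p') (h2 : p ≠ q') (h3 : q ≠ p') :
    Commute (parS hν F G p) (parS hν F G p') := by
  obtain ⟨k, j, hj, rfl, rfl⟩ := h
  obtain ⟨l, i, hi, rfl, rfl⟩ := h'
  rw [parS_blockEquiv hν k j hj, parS_blockEquiv hν l i hi]
  rcases eq_or_ne k l with rfl | hkl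
  · have e1 : j ≠ i := by rintro rfl; exact h1 rfl
    have e2 : j ≠ i + 1 := by rintro rfl; exact h2 rfl
    have e3 : j + 1 ≠ i := by rintro rfl; exact h3 rfl
    rcases lt_or_gt_of_ne e1 with h | h
    · exact Commute.map (s_comm j i hj hi (by omega)) (factorHom F G k)
    · exact (Commute.map (s_comm i j hi hj (by omega)) (factorHom F G k)).symm
  · exact factorHom_commute hkl _ _

theorem parS_braid {p q s : Fin n} (h : Consecutive hν p q) (h' : Consecutive hν q s) :
    parS hν F G p * parS hν F G q * parS hν F G p
      = parS hν F G q * parS hν F G p * parS hν F G q := by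
  obtain ⟨k, j, hj, rfl, rfl⟩ := h
  obtain ⟨l, i, hi, e, rfl⟩ := h'
  have := (blockEquiv ν hν).injective e
  obtain rfl : k = l := congrArg Sigma.fst this
  simp only [Sigma.mk.injEq, heq_eq_eq, true_and, Fin.mk.injEq] at this
  subst this
  rw [parS_blockEquiv hν k j hj, parS_blockEquiv hν k (j + 1) hi]
  simp only [← map_mul]
  rw [s_braid]

theorem parS_mul_parX {p q : Fin n} (h : Consecutive hν p q) :
    parS hν F G p * parX hν F G p = parX hν F G q * parS hν F G p
      - ∑ a : G, parG hν F (Pi.mulSingle p a * Pi.mulSingle q a⁻¹) := by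
  obtain ⟨k, j, hj, rfl, rfl⟩ := h
  rw [parS_blockEquiv hν k j hj, parX_blockEquiv, parX_blockEquiv, ← map_mul, s_x, map_sub, map_mul, map_sum]
  congr 1
  refine Finset.sum_congr rfl fun a _ => ?_
  rw [parG_mul, parG_mulSingle, parG_mulSingle, ← map_mul, posHom_of, posHom_of, grp_mul]

theorem parS_mul_parX_of_ne {p q s : Fin n} (h : Consecutive hν p q) (h1 : s ≠ p) (h2 : s ≠ q) :
    parS hν F G p * parX hν F G s = parX hν F G s * parS hν F G p := by
  obtain ⟨k, j, hj, rfl, rfl⟩ := h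
  obtain ⟨l, i, rfl⟩ := exists_blockEquiv ν hν s
  rw [parS_blockEquiv hν k j hj, parX_blockEquiv]
  rcases eq_or_ne k l with rfl | hkl
  · rw [← map_mul, s_x_of_ne j hj i (by rintro rfl; exact h1 rfl)
      (by rintro e; exact h2 (by congr 2; exact Fin.ext e)), map_mul]
  · exact factorHom_commute hkl _ _

theorem parS_mul_parG {p q : Fin n} (h : Consecutive hν p q) (g : Fin n → G) :
    parS hν F G p * parG hν F g = parG hν F (fun i => g (Equiv.swap p q i)) * parS hν F G p := by
  obtain ⟨k, j, hj, rfl, rfl⟩ := h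
  rw [parS_blockEquiv hν k j hj]
  refine factorHom_mul_parG hν ?_ fun l hl i => ?_
  · rw [s_grp]
    congr 3
    funext i
    rw [simpleTransposition, Equiv.swap_inv]
    congr 1
    have : Function.Injective fun j : Fin (ν k) => blockEquiv ν hν ⟨k, j⟩ := fun j j' h => by
      simpa using h
    exact this.map_swap _ _ _
  · rw [Equiv.swap_apply_of_ne_of_ne] <;>
    · intro e
      exact hl (congrArg Sigma.fst ((blockEquiv ν hν).injective e))

variable (hν)

/-- The permutations that are increasing on the preimage of each block. -/
abbrev BlockIncreasing : Type :=
  {d : Equiv.Perm (Fin n) // ∀ i j, i < j → block ν hν (d i) = block ν hν (d j) → d i < d j}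

variable {hν}

/-- A position of the block strictly between the two images would be the image of some `c`, and
monotonicity on the preimage of the block would force `c` strictly between `i` and `i + 1`. -/
theorem BlockIncreasing.consecutive (d : BlockIncreasing hν) (i : ℕ) (h : i + 1 < n)
    (hd : block ν hν (d.1 ⟨i, Nat.lt_of_succ_lt h⟩) = block ν hν (d.1 ⟨i + 1, h⟩)) :
    Consecutive hν (d.1 ⟨i, Nat.lt_of_succ_lt h⟩) (d.1 ⟨i + 1, h⟩) := by
  have hlt := d.2 ⟨i, Nat.lt_of_succ_lt h⟩ ⟨i + 1, h⟩ (by simp) hd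
  obtain ⟨k, j, j', e, e'⟩ := exists_blockEquiv_of_block_eq ν hν hd
  rw [← e, ← e', blockEquiv_lt_iff, Fin.lt_def] at hlt
  have hj' : j'.val = j.val + 1 := by
    by_contra hne
    let m : Fin (ν k) := ⟨j + 1, by omega⟩
    obtain ⟨c, hc⟩ := d.1.surjective (blockEquiv ν hν ⟨k, m⟩)
    have hb : block ν hν (d.1 c) = k := by rw [hc, block_blockEquiv]
    have hbi : block ν hν (d.1 ⟨i, Nat.lt_of_succ_lt h⟩) = k := by rw [← e, block_blockEquiv]
    rcases lt_trichotomy c ⟨i, Nat.lt_of_succ_lt h⟩ with h1 | h1 | h1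
    · have := d.2 _ _ h1 (hb.trans hbi.symm)
      rw [hc, ← e, blockEquiv_lt_iff, Fin.lt_def] at this
      simp [m] at this
    · rw [h1, ← e] at hc
      have := (blockEquiv ν hν).injective hc
      simp [m, Fin.ext_iff] at this
    · rcases Nat.eq_or_lt_of_le (show i + 1 ≤ c.val from h1) with h2 | h2
      · obtain rfl : c = ⟨i + 1, h⟩ := Fin.ext h2.symm
        rw [← e'] at hc
        have := (blockEquiv ν hν).injective hc
        simp [m, Fin.ext_iff] at this
        omega
      · have := d.2 ⟨i + 1, h⟩ c h2 ((hd.symm.trans hbi).trans hb.symm)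
        rw [hc, ← e', blockEquiv_lt_iff, Fin.lt_def] at this
        simp [m] at this
        omega
  refine ⟨k, j, by omega, e.symm, ?_⟩
  rw [← e']
  congr 2
  exact Fin.ext hj'

/-- Exchanging the images of two adjacent positions that lie in different blocks. -/
def BlockIncreasing.mulSwap (d : BlockIncreasing hν) (i : ℕ) (h : i + 1 < n)
    (hd : block ν hν (d.1 ⟨i, Nat.lt_of_succ_lt h⟩) ≠ block ν hν (d.1 ⟨i + 1, h⟩)) :
    BlockIncreasing hν :=
  ⟨d.1 * simpleTransposition i h, fun a b hab hblock => by
    rw [Equiv.Perm.mul_apply, Equiv.Perm.mul_apply] at hblock ⊢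
    refine d.2 _ _ ?_ hblock
    -- The only pair whose order the transposition reverses is `(i, i + 1)`, and its images lie in
    -- different blocks.
    by_contra hcon
    have : a = ⟨i, Nat.lt_of_succ_lt h⟩ ∧ b = ⟨i + 1, h⟩ := by
      simp only [simpleTransposition, Equiv.swap_apply_def, Fin.ext_iff] at hcon
      simp only [Fin.ext_iff, Fin.lt_def] at hab ⊢
      simp only [Fin.lt_def, apply_ite Fin.val] at hcon
      grind
    obtain ⟨rfl, rfl⟩ := this
    refine hd ?_
    rw [simpleTransposition, Equiv.swap_apply_left, Equiv.swap_apply_right] at hblock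
    exact hblock.symm⟩

variable (hν) in
theorem block_increasing_one (i j : Fin n) (h : i < j)
    (_ : block ν hν ((1 : Equiv.Perm (Fin n)) i) = block ν hν ((1 : Equiv.Perm (Fin n)) j)) :
    (1 : Equiv.Perm (Fin n)) i < (1 : Equiv.Perm (Fin n)) j := h

end Extension

end WreathHecke

/-! ### The action on copies of `W` indexed by block-increasing permutations -/

namespace WreathHecke

section ExtensionModule

variable {F : Type u} [Field F] {G : Type v} [Group G] [Fintype G] {r n : ℕ} {ν : Fin r → ℕ}
  {hν : ∑ k, ν k = n}

/-- Translating the summation variable gives `P b * Ω = Ω * R b` for every `b`; taking `b = ε`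
yields `Ω = 0`. Applied to two blocks, this is the vanishing of `∑ a ⊗ a⁻¹` between non-isomorphic
simple modules. -/
theorem sum_mul_inv_eq_zero {A : Type*} [Ring A] [Algebra F A] (P R : MonoidAlgebra F G →ₐ[F] A)
    (ε : MonoidAlgebra F G) (hP : P ε = 1) (hR : R ε = 0) :
    ∑ a : G, P (MonoidAlgebra.of F G a) * R (MonoidAlgebra.of F G a⁻¹) = 0 := by
  set Ω := ∑ a : G, P (MonoidAlgebra.of F G a) * R (MonoidAlgebra.of F G a⁻¹) with hΩ
  have key : ∀ b, P b * Ω = Ω * R b := by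
    intro b
    induction b using groupAlgebra_induction with
    | h g =>
      rw [hΩ, Finset.mul_sum, Finset.sum_mul]
      refine Fintype.sum_equiv (Equiv.mulLeft g) _ _ fun a => ?_
      rw [Equiv.coe_mulLeft, mul_assoc, ← map_mul R, ← map_mul (MonoidAlgebra.of F G) _ g,
        map_mul (MonoidAlgebra.of F G) g, map_mul P, mul_assoc]
      simp
    | hadd a b ha hb => rw [map_add, map_add, add_mul, mul_add, ha, hb]
    | hsmul c a ha => rw [map_smul, map_smul, smul_mul_assoc, mul_smul_comm, ha]
  have := key ε
  rwa [hP, hR, one_mul, mul_zero] at this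

namespace BlockIncreasing

variable (d : BlockIncreasing hν) (i : ℕ) (h : i + 1 < n)
    (hd : block ν hν (d.1 ⟨i, Nat.lt_of_succ_lt h⟩) ≠ block ν hν (d.1 ⟨i + 1, h⟩))

theorem mulSwap_left : (d.mulSwap i h hd).1 ⟨i, Nat.lt_of_succ_lt h⟩ = d.1 ⟨i + 1, h⟩ := by
  simp [mulSwap, simpleTransposition]

theorem mulSwap_right : (d.mulSwap i h hd).1 ⟨i + 1, h⟩ = d.1 ⟨i, Nat.lt_of_succ_lt h⟩ := by
  simp [mulSwap, simpleTransposition]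

theorem mulSwap_of_ne (j : Fin n) (h1 : j.val ≠ i) (h2 : j.val ≠ i + 1) :
    (d.mulSwap i h hd).1 j = d.1 j := by
  simp only [mulSwap, simpleTransposition, Equiv.Perm.mul_apply]
  rw [Equiv.swap_apply_of_ne_of_ne] <;> simpa [Fin.ext_iff]

end BlockIncreasing

variable {W : Type*} [AddCommGroup W] [Module F W] (σ : Parabolic F G ν →ₐ[F] Module.End F W)

/-- The action of `G ^ n` on the extension of a module. -/
def extG (hν : ∑ k, ν k = n) (g : Fin n → G) : Module.End F (BlockIncreasing hν → W) :=
  LinearMap.pi fun d => σ (parG hν F fun k => g (d.1⁻¹ k)) ∘ₗ LinearMap.proj d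

/-- The action of the polynomial generators on the extension of a module. -/
def extX (hν : ∑ k, ν k = n) (i : Fin n) : Module.End F (BlockIncreasing hν → W) :=
  LinearMap.pi fun d => σ (parX hν F G (d.1 i)) ∘ₗ LinearMap.proj d

open Classical in
/-- The action of the simple reflections on the extension of a module. -/
def extS (hν : ∑ k, ν k = n) (i : ℕ) (h : i + 1 < n) : Module.End F (BlockIncreasing hν → W) :=
  LinearMap.pi fun d =>
    if hd : block ν hν (d.1 ⟨i, Nat.lt_of_succ_lt h⟩) = block ν hν (d.1 ⟨i + 1, h⟩) then
      σ (parS hν F G (d.1 ⟨i, Nat.lt_of_succ_lt h⟩)) ∘ₗ LinearMap.proj d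
    else LinearMap.proj (d.mulSwap i h hd)

variable (i : ℕ) (h : i + 1 < n) (f : BlockIncreasing hν → W) (d : BlockIncreasing hν)

theorem extG_apply (g : Fin n → G) :
    extG σ hν g f d = σ (parG hν F fun k => g (d.1⁻¹ k)) (f d) := rfl

theorem extX_apply (j : Fin n) : extX σ hν j f d = σ (parX hν F G (d.1 j)) (f d) := rfl

theorem extS_of_eq
    (hd : block ν hν (d.1 ⟨i, Nat.lt_of_succ_lt h⟩) = block ν hν (d.1 ⟨i + 1, h⟩)) :
    extS σ hν i h f d = σ (parS hν F G (d.1 ⟨i, Nat.lt_of_succ_lt h⟩)) (f d) := by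
  rw [extS, LinearMap.pi_apply, dif_pos hd]; rfl

theorem extS_of_ne
    (hd : block ν hν (d.1 ⟨i, Nat.lt_of_succ_lt h⟩) ≠ block ν hν (d.1 ⟨i + 1, h⟩)) :
    extS σ hν i h f d = f (d.mulSwap i h hd) := by
  rw [extS, LinearMap.pi_apply, dif_neg hd]; rfl

theorem extS_sq : extS σ hν i h (extS σ hν i h f) = f := by
  funext d
  by_cases hd : block ν hν (d.1 ⟨i, Nat.lt_of_succ_lt h⟩) = block ν hν (d.1 ⟨i + 1, h⟩)
  · rw [extS_of_eq σ i h _ d hd, extS_of_eq σ i h _ d hd, ← Module.End.mul_apply, ← map_mul,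
      parS_mul_self (d.consecutive i h hd), map_one, Module.End.one_apply]
  · rw [extS_of_ne σ i h _ d hd, extS_of_ne σ i h]
    · congr 1
      refine Subtype.ext ?_
      simp only [BlockIncreasing.mulSwap]
      rw [mul_assoc, simpleTransposition_mul_self, mul_one]
    · rw [BlockIncreasing.mulSwap_left, BlockIncreasing.mulSwap_right]
      exact Ne.symm hd

theorem extS_commute (j : ℕ) (hj : j + 1 < n) (hij : i + 1 < j) :
    extS σ hν i h (extS σ hν j hj f) = extS σ hν j hj (extS σ hν i h f) := by
  funext d
  by_cases hd : block ν hν (d.1 ⟨i, Nat.lt_of_succ_lt h⟩) = block ν hν (d.1 ⟨i + 1, h⟩) <;>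
  by_cases hd' : block ν hν (d.1 ⟨j, Nat.lt_of_succ_lt hj⟩) = block ν hν (d.1 ⟨j + 1, hj⟩)
  · rw [extS_of_eq σ i h _ d hd, extS_of_eq σ j hj _ d hd',
      extS_of_eq σ j hj _ d hd', extS_of_eq σ i h _ d hd, ← Module.End.mul_apply, ← map_mul, ← Module.End.mul_apply,
      ← map_mul, (parS_commute (d.consecutive i h hd) (d.consecutive j hj hd') ?_ ?_ ?_).eq] <;>
    · rw [d.1.injective.ne_iff, Ne, Fin.mk.injEq]
      omega
  · rw [extS_of_eq σ i h _ d hd, extS_of_ne σ j hj _ d hd', extS_of_ne σ j hj _ d hd',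
      extS_of_eq σ i h, BlockIncreasing.mulSwap_of_ne]
    all_goals try rw [BlockIncreasing.mulSwap_of_ne, BlockIncreasing.mulSwap_of_ne]
    all_goals first | exact hd | (simp only; omega)
  · rw [extS_of_ne σ i h _ d hd, extS_of_eq σ j hj _ d hd', extS_of_ne σ i h _ d hd,
      extS_of_eq σ j hj, BlockIncreasing.mulSwap_of_ne]
    all_goals try rw [BlockIncreasing.mulSwap_of_ne, BlockIncreasing.mulSwap_of_ne]
    all_goals first | exact hd' | (simp only; omega)
  · rw [extS_of_ne σ i h _ d hd, extS_of_ne σ j hj _ d hd', extS_of_ne σ i h, extS_of_ne σ j hj]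
    · congr 1
      refine Subtype.ext (Equiv.ext fun k => ?_)
      simp only [BlockIncreasing.mulSwap, Equiv.Perm.mul_apply]
      rw [simpleTransposition_comm i j h hj hij]
    all_goals try rw [BlockIncreasing.mulSwap_of_ne, BlockIncreasing.mulSwap_of_ne]
    all_goals first | exact hd | exact hd' | (simp only; omega)

/-- The cases are those of coincidence among the blocks of the three images. If all agree, it is the
braid relation of the parabolic algebra. If exactly two agree, one parabolic reflection occurs on
each side, with the same label and evaluated at the same component. If none agree, it is the braid
relation for transpositions of the index `d`. -/
theorem extS_braid (h : i + 1 + 1 < n) :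
    extS σ hν i (Nat.lt_of_succ_lt h) (extS σ hν (i + 1) h (extS σ hν i (Nat.lt_of_succ_lt h) f))
      = extS σ hν (i + 1) h (extS σ hν i (Nat.lt_of_succ_lt h) (extS σ hν (i + 1) h f)) := by
  funext d
  have h' := Nat.lt_of_succ_lt h
  have L := fun (d : BlockIncreasing hν) hd => d.mulSwap_left i h' hd
  have R := fun (d : BlockIncreasing hν) hd => d.mulSwap_right i h' hd
  have N := fun (d : BlockIncreasing hν) hd => d.mulSwap_of_ne i h' hd ⟨i + 1 + 1, h⟩
    (by simp only; omega) (by simp only; omega)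
  have L' := fun (d : BlockIncreasing hν) hd => d.mulSwap_left (i + 1) h hd
  have R' := fun (d : BlockIncreasing hν) hd => d.mulSwap_right (i + 1) h hd
  have N' := fun (d : BlockIncreasing hν) hd => d.mulSwap_of_ne (i + 1) h hd
    ⟨i, Nat.lt_of_succ_lt h'⟩ (by simp only; omega) (by simp only; omega)
  by_cases h1 : block ν hν (d.1 ⟨i, Nat.lt_of_succ_lt h'⟩) = block ν hν (d.1 ⟨i + 1, h'⟩) <;>
  by_cases h2 : block ν hν (d.1 ⟨i + 1, h'⟩) = block ν hν (d.1 ⟨i + 1 + 1, h⟩)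
  · rw [extS_of_eq σ i h' _ d h1, extS_of_eq σ _ h _ d h2, extS_of_eq σ i h' _ d h1,
      extS_of_eq σ _ h _ d h2, extS_of_eq σ i h' _ d h1, extS_of_eq σ _ h _ d h2]
    simp only [← Module.End.mul_apply, ← map_mul]
    rw [← mul_assoc, ← mul_assoc, parS_braid (d.consecutive i h' h1) (d.consecutive _ h h2)]
  · have h3 := fun e => h2 (h1.symm.trans e)
    rw [extS_of_eq σ i h' _ d h1, extS_of_ne σ _ h _ d h2, extS_of_ne σ i h' _ _ (by rwa [L', N']),
      extS_of_ne σ _ h _ d h2, extS_of_ne σ i h' _ _ (by rwa [L', N']),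
      extS_of_eq σ _ h _ _ (by rwa [R, N, N', R']), R]
    exact congrArg (fun p => σ (parS hν F G p) _) (N' d h2).symm
  · have h3 := fun e => h1 (Eq.trans e h2.symm)
    rw [extS_of_ne σ i h' _ d h1, extS_of_ne σ _ h _ _ (by rwa [R, N]),
      extS_of_eq σ i h' _ _ (by rwa [L', N', L, N]), extS_of_eq σ _ h _ d h2,
      extS_of_ne σ i h' _ d h1, extS_of_ne σ _ h _ _ (by rwa [R, N]), N', L]
  · by_cases h3 : block ν hν (d.1 ⟨i, Nat.lt_of_succ_lt h'⟩) = block ν hν (d.1 ⟨i + 1 + 1, h⟩)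
    · rw [extS_of_ne σ i h' _ d h1, extS_of_eq σ _ h _ _ (by rwa [R, N]),
        extS_of_ne σ i h' _ _ (by rw [L, R]; exact Ne.symm h1), extS_of_ne σ _ h _ d h2,
        extS_of_eq σ i h' _ _ (by rwa [L', N']),
        extS_of_ne σ _ h _ _ (by rw [L', R']; exact Ne.symm h2)]
      refine congrArg₂ (fun p d => σ (parS hν F G p) (f d)) ((R d h1).trans (N' d h2).symm) ?_
      refine Subtype.ext ?_
      simp only [BlockIncreasing.mulSwap]
      rw [mul_assoc, simpleTransposition_mul_self, mul_assoc, simpleTransposition_mul_self]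
    · rw [extS_of_ne σ i h' _ d h1, extS_of_ne σ _ h _ _ (by rwa [R, N]),
        extS_of_ne σ i h' _ _ (by rwa [L', N', L, N]), extS_of_ne σ _ h _ d h2,
        extS_of_ne σ i h' _ _ (by rwa [L', N']), extS_of_ne σ _ h _ _ (by rwa [R, N, N', R'])]
      congr 1
      refine Subtype.ext (Equiv.ext fun k => ?_)
      simp only [BlockIncreasing.mulSwap, Equiv.Perm.mul_apply]
      rw [simpleTransposition_braid i h]

omit [Fintype G] in
theorem mulSingle_perm_inv (d : Equiv.Perm (Fin n)) (j : Fin n) (a : G) :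
    (fun k => (Pi.mulSingle j a : Fin n → G) (d⁻¹ k)) = Pi.mulSingle (d j) a := by
  funext k
  simp only [Pi.mulSingle_apply, Equiv.Perm.inv_eq_iff_eq]

theorem extS_extG (g : Fin n → G) : extS σ hν i h (extG σ hν g f)
    = extG σ hν (fun k => g ((simpleTransposition i h)⁻¹ k)) (extS σ hν i h f) := by
  funext d
  by_cases hd : block ν hν (d.1 ⟨i, Nat.lt_of_succ_lt h⟩) = block ν hν (d.1 ⟨i + 1, h⟩)
  · rw [extS_of_eq σ i h _ d hd, extG_apply, extG_apply, extS_of_eq σ i h _ d hd,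
      ← Module.End.mul_apply, ← map_mul, ← Module.End.mul_apply, ← map_mul,
      parS_mul_parG (d.consecutive i h hd)]
    congr 4
    funext k
    rw [simpleTransposition, Equiv.swap_inv]
    congr 1
    obtain ⟨j, rfl⟩ := d.1.surjective k
    rw [← d.1.injective.map_swap]
    simp
  · rw [extS_of_ne σ i h _ d hd, extG_apply, extG_apply, extS_of_ne σ i h _ d hd]
    simp only [BlockIncreasing.mulSwap, mul_inv_rev, Equiv.Perm.mul_apply]

theorem extS_extX_of_ne (j : Fin n) (h1 : j.val ≠ i) (h2 : j.val ≠ i + 1) :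
    extS σ hν i h (extX σ hν j f) = extX σ hν j (extS σ hν i h f) := by
  funext d
  by_cases hd : block ν hν (d.1 ⟨i, Nat.lt_of_succ_lt h⟩) = block ν hν (d.1 ⟨i + 1, h⟩)
  · rw [extS_of_eq σ i h _ d hd, extX_apply, extX_apply, extS_of_eq σ i h _ d hd,
      ← Module.End.mul_apply, ← map_mul, ← Module.End.mul_apply, ← map_mul,
      parS_mul_parX_of_ne (d.consecutive i h hd)]
    · exact d.1.injective.ne fun e => h1 (congrArg Fin.val e)
    · exact d.1.injective.ne fun e => h2 (congrArg Fin.val e)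
  · rw [extS_of_ne σ i h _ d hd, extX_apply, extX_apply, extS_of_ne σ i h _ d hd,
      BlockIncreasing.mulSwap_of_ne _ _ _ _ _ h1 h2]

variable (hν) in
theorem sum_parG_eq_zero {ε : Fin r → MonoidAlgebra F G}
    (h1 : ∀ k j, σ (factorHom F G k (posHom F j (ε k))) = 1)
    (h0 : ∀ k l j, k ≠ l → σ (factorHom F G l (posHom F j (ε k))) = 0) (p q : Fin n)
    (hpq : block ν hν p ≠ block ν hν q) :
    ∑ a : G, σ (parG hν F (Pi.mulSingle p a * Pi.mulSingle q a⁻¹)) = 0 := by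
  obtain ⟨k, i, rfl⟩ := exists_blockEquiv ν hν p
  obtain ⟨l, j, rfl⟩ := exists_blockEquiv ν hν q
  rw [block_blockEquiv, block_blockEquiv] at hpq
  rw [← sum_mul_inv_eq_zero ((σ.comp (factorHom F G k)).comp (posHom F i))
    ((σ.comp (factorHom F G l)).comp (posHom F j)) (ε k) (h1 k i) (h0 k l j hpq)]
  refine Finset.sum_congr rfl fun a _ => ?_
  rw [parG_mul, parG_mulSingle, parG_mulSingle, map_mul]
  rfl

/-- Within a block this is the relation of the parabolic algebra. Between different blocks `s_i`
merely exchanges two components, so the correction term has to vanish, and it does by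
`sum_parG_eq_zero`. -/
theorem extS_extX {ε : Fin r → MonoidAlgebra F G}
    (h1 : ∀ k j, σ (factorHom F G k (posHom F j (ε k))) = 1)
    (h0 : ∀ k l j, k ≠ l → σ (factorHom F G l (posHom F j (ε k))) = 0) :
    extS σ hν i h (extX σ hν ⟨i, Nat.lt_of_succ_lt h⟩ f)
      = extX σ hν ⟨i + 1, h⟩ (extS σ hν i h f)
        - ∑ a : G, extG σ hν (Pi.mulSingle ⟨i, Nat.lt_of_succ_lt h⟩ a
            * Pi.mulSingle ⟨i + 1, h⟩ a⁻¹) f := by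
  funext d
  have e : ∀ a : G, extG σ hν (Pi.mulSingle ⟨i, Nat.lt_of_succ_lt h⟩ a
            * Pi.mulSingle ⟨i + 1, h⟩ a⁻¹) f d
      = σ (parG hν F (Pi.mulSingle (d.1 ⟨i, Nat.lt_of_succ_lt h⟩) a
            * Pi.mulSingle (d.1 ⟨i + 1, h⟩) a⁻¹)) (f d) := by
    intro a
    rw [extG_apply, ← mulSingle_perm_inv, ← mulSingle_perm_inv]
    rfl
  rw [Pi.sub_apply, Finset.sum_apply, Finset.sum_congr rfl fun a _ => e a]
  by_cases hd : block ν hν (d.1 ⟨i, Nat.lt_of_succ_lt h⟩) = block ν hν (d.1 ⟨i + 1, h⟩)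
  · rw [extS_of_eq σ i h _ d hd, extX_apply, extX_apply, extS_of_eq σ i h _ d hd,
      ← Module.End.mul_apply, ← map_mul, ← Module.End.mul_apply, ← map_mul,
      parS_mul_parX (d.consecutive i h hd), map_sub, map_sum, LinearMap.sub_apply,
      LinearMap.sum_apply]
  · rw [extS_of_ne σ i h _ d hd, extX_apply, extX_apply, extS_of_ne σ i h _ d hd,
      BlockIncreasing.mulSwap_left, ← LinearMap.sum_apply, sum_parG_eq_zero hν σ h1 h0 _ _ hd,
      LinearMap.zero_apply, sub_zero]

/-- A module over the parabolic algebra on which the different blocks are separated by elements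
`ε k` of the group algebra embeds in a module over the wreath Hecke algebra. -/
theorem exists_extension (hν : ∑ k, ν k = n) {ε : Fin r → MonoidAlgebra F G}
    (h1 : ∀ k j, σ (factorHom F G k (posHom F j (ε k))) = 1)
    (h0 : ∀ k l j, k ≠ l → σ (factorHom F G l (posHom F j (ε k))) = 0) :
    ∃ (τ : WreathHecke F G n →ₐ[F] Module.End F (BlockIncreasing hν → W))
      (f : W →ₗ[F] (BlockIncreasing hν → W)), Function.Injective f ∧
      ∀ b w, f (σ b w) = τ (parabolicHom F G ν hν b) (f w) := by
  classical
  let gen : Gen G n → Module.End F (BlockIncreasing hν → W) := fun a => match a with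
    | .grp g => extG σ hν g
    | .x i => extX σ hν i
    | .s i h => extS σ hν i h
  have hgen : ∀ ⦃a b⦄, Rel F G n a b → FreeAlgebra.lift F gen a = FreeAlgebra.lift F gen b := by
    intro a b hab
    refine LinearMap.ext fun f => ?_
    induction hab with
    | grp_one =>
      simp only [pre, FreeAlgebra.lift_ι_apply, map_one, gen]
      funext d
      rw [extG_apply]
      change σ (parG hν F 1) (f d) = f d
      rw [parG_one, map_one]; rfl
    | grp_mul g h =>
      simp only [pre, FreeAlgebra.lift_ι_apply, map_mul, gen, Module.End.mul_apply]
      funext d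
      rw [extG_apply, extG_apply, extG_apply, ← Module.End.mul_apply, ← map_mul, ← parG_mul]
      rfl
    | x_comm i j =>
      simp only [pre, FreeAlgebra.lift_ι_apply, map_mul, gen, Module.End.mul_apply]
      funext d
      simp only [extX_apply, ← Module.End.mul_apply, ← map_mul]
      rw [(parX_commute hν _ _).eq]
    | x_grp i g =>
      simp only [pre, FreeAlgebra.lift_ι_apply, map_mul, gen, Module.End.mul_apply]
      funext d
      simp only [extX_apply, extG_apply, ← Module.End.mul_apply, ← map_mul]
      rw [parX_mul_parG]
    | s_sq i h =>
      simp only [pre, FreeAlgebra.lift_ι_apply, map_mul, map_one, gen, Module.End.mul_apply,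
        Module.End.one_apply, extS_sq]
    | s_comm i j hi hj hij =>
      simp only [pre, FreeAlgebra.lift_ι_apply, map_mul, gen, Module.End.mul_apply]
      exact extS_commute σ i hi f j hj hij
    | s_braid i h =>
      simp only [pre, FreeAlgebra.lift_ι_apply, map_mul, gen, Module.End.mul_apply]
      exact extS_braid σ i f h
    | s_x i h =>
      simp only [pre, FreeAlgebra.lift_ι_apply, map_mul, map_sub, map_sum, gen,
        Module.End.mul_apply, LinearMap.sub_apply, LinearMap.sum_apply]
      exact extS_extX σ i h f h1 h0
    | s_x_of_ne i h j h₁ h₂ =>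
      simp only [pre, FreeAlgebra.lift_ι_apply, map_mul, gen, Module.End.mul_apply]
      exact extS_extX_of_ne σ i h f j h₁ h₂
    | s_grp i h g =>
      simp only [pre, FreeAlgebra.lift_ι_apply, map_mul, gen, Module.End.mul_apply]
      exact extS_extG σ i h f g
  -- `W` is placed as the component of the identity permutation, on which the generators coming from
  -- the parabolic algebra act as they do on `W`.
  let e : BlockIncreasing hν := ⟨1, block_increasing_one hν⟩
  let ι : W →ₗ[F] (BlockIncreasing hν → W) := LinearMap.single F (fun _ => W) e
  have hι : ∀ w d, ι w d = if d = e then w else 0 := fun w d => by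
    simp only [ι, LinearMap.single_apply, Pi.single_apply]
  refine ⟨lift gen hgen, ι, fun w w' hw => ?_, ?_⟩
  · have := congrFun hw e
    rwa [hι, hι, if_pos rfl, if_pos rfl] at this
  · refine parabolic_intertwine_of_gen σ ((lift gen hgen).comp (parabolicHom F G ν hν)) ι ?_
    intro k a w
    rw [AlgHom.comp_apply, parabolicHom_factorHom, blockHom, lift_of]
    have hne : ∀ (T : Module.End F W) (d : BlockIncreasing hν), d ≠ e → T (ι w d) = 0 := by
      intro T d hd
      rw [hι, if_neg hd, map_zero]
    rcases a with g | j | ⟨j, hj⟩ <;> simp only [blockGen] <;>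
      rw [lift_of] <;> funext d <;> simp only [gen]
    · rw [extG_apply, hι]
      split_ifs with hd
      · subst hd
        rw [hι, if_pos rfl, ← parG_extend hν]
        rfl
      · exact (hne _ d hd).symm
    · rw [extX_apply, hι]
      split_ifs with hd
      · subst hd
        rw [hι, if_pos rfl, ← parX_blockEquiv hν]
        rfl
      · exact (hne _ d hd).symm
    · have hb : ∀ (i : ℕ) (h : i + 1 < n) (hi : i = (∑ l ∈ Finset.Iio k, ν l) + j),
          (⟨i, Nat.lt_of_succ_lt h⟩ : Fin n) = blockEquiv ν hν ⟨k, ⟨j, Nat.lt_of_succ_lt hj⟩⟩ ∧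
          (⟨i + 1, h⟩ : Fin n) = blockEquiv ν hν ⟨k, ⟨j + 1, hj⟩⟩ := by
        rintro i h rfl
        exact ⟨rfl, Fin.ext (Nat.add_assoc _ _ _)⟩
      have hi' : (∑ l ∈ Finset.Iio k, ν l) + j + 1 < n := by
        have := offset_add_le ν hν k
        omega
      obtain ⟨e1, e2⟩ := hb _ hi' rfl
      have he : block ν hν (e.1 ⟨_, Nat.lt_of_succ_lt hi'⟩) = block ν hν (e.1 ⟨_, hi'⟩) := by
        change block ν hν ⟨_, Nat.lt_of_succ_lt hi'⟩ = block ν hν ⟨_, hi'⟩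
        rw [e1, e2, block_blockEquiv, block_blockEquiv]
      by_cases hd : block ν hν (d.1 ⟨_, Nat.lt_of_succ_lt hi'⟩) = block ν hν (d.1 ⟨_, hi'⟩)
      · rw [extS_of_eq σ _ hi' _ d hd, hι]
        split_ifs with hde
        · subst hde
          rw [hι, if_pos rfl, ← parS_blockEquiv hν k j hj, ← e1]
          rfl
        · exact (hne _ d hde).symm
      -- A simple reflection of the Young subgroup does not exchange the component `e` with another
      -- one, so both `d` and its swapped partner differ from `e` and both sides vanish.
      · have hde : d ≠ e := by rintro rfl; exact hd he
        rw [extS_of_ne σ _ hi' _ d hd, hι, if_neg hde, hι, if_neg]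
        intro hde'
        have := congrArg (fun d : BlockIncreasing hν => d.1 ⟨_, hi'⟩) hde'
        simp only [BlockIncreasing.mulSwap_right] at this
        have h2 := congrArg (fun d : BlockIncreasing hν => d.1 ⟨_, Nat.lt_of_succ_lt hi'⟩) hde'
        simp only [BlockIncreasing.mulSwap_left] at h2
        rw [this, h2] at hd
        exact hd he.symm

end ExtensionModule

end WreathHecke

/-! ### Induced modules -/

section Induced

variable {F : Type*} [Field F] {A B : Type*} [Ring A] [Algebra F A] [Ring B] [Algebra F B]
  (j : B →ₐ[F] A) {W : Type*} [AddCommGroup W] [Module F W] (σ : B →ₐ[F] Module.End F W)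

/-- The canonical map from a module to the induced module. -/
def inducedOf : W →ₗ[F] inducedModule j σ :=
  (inducedRel j σ).mkQ.restrictScalars F ∘ₗ TensorProduct.mk F A W 1

theorem smul_inducedOf (a : A) (w : W) :
    a • inducedOf j σ w = (inducedRel j σ).mkQ (a ⊗ₜ[F] w) := by
  change a • (inducedRel j σ).mkQ (1 ⊗ₜ[F] w) = _
  rw [← map_smul, TensorProduct.smul_tmul', smul_eq_mul, mul_one]

theorem inducedOf_apply (b : B) (w : W) : inducedOf j σ (σ b w) = j b • inducedOf j σ w := by
  rw [smul_inducedOf, ← one_smul A (inducedOf j σ (σ b w)), smul_inducedOf, ← sub_eq_zero,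
    ← map_sub, Submodule.mkQ_apply, Submodule.Quotient.mk_eq_zero, ← neg_sub]
  refine neg_mem (Submodule.subset_span ⟨1, b, w, ?_⟩)
  rw [one_mul]

theorem span_inducedOf : Submodule.span A (Set.range (inducedOf j σ)) = ⊤ := by
  refine eq_top_iff.2 fun x _ => ?_
  obtain ⟨t, rfl⟩ := (inducedRel j σ).mkQ_surjective x
  induction t using TensorProduct.induction_on with
  | zero => rw [map_zero]; exact zero_mem _
  | tmul a w =>
    rw [← smul_inducedOf]
    exact Submodule.smul_mem _ _ (Submodule.subset_span ⟨w, rfl⟩)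
  | add s t hs ht => rw [map_add]; exact add_mem (hs trivial) (ht trivial)

variable {M : Type*} [AddCommGroup M] [Module F M] [Module A M] [IsScalarTower F A M]

/-- The universal property of the induced module. -/
theorem exists_inducedLift (f : W →ₗ[F] M) (hf : ∀ b w, f (σ b w) = j b • f w) :
    ∃ Φ : inducedModule j σ →ₗ[A] M, ∀ w, Φ (inducedOf j σ w) = f w := by
  let g : A ⊗[F] W →ₗ[A] M := TensorProduct.AlgebraTensorModule.lift
    (((LinearMap.toSpanSingleton A (W →ₗ[F] M) f)))
  have hg : ∀ a w, g (a ⊗ₜ w) = a • f w := fun a w => rfl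
  refine ⟨(inducedRel j σ).liftQ g (Submodule.span_le.2 ?_), fun w => ?_⟩
  · rintro _ ⟨a, b, w, rfl⟩
    rw [SetLike.mem_coe, LinearMap.mem_ker, map_sub, hg, hg, hf, smul_smul, sub_self]
  · refine ((inducedRel j σ).liftQ_apply g _).trans ?_
    exact (hg 1 w).trans (one_smul A _)

end Induced

namespace WreathHecke

/-! ### Modules generated by a module over the parabolic algebra -/

section Generated

variable {F : Type u} [Field F] {G : Type v} [Group G] [Fintype G] {r n : ℕ} {ν : Fin r → ℕ}
  (hν : ∑ k, ν k = n)

/-- Permutations that act inside the blocks. -/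
def youngHom : (∀ k, Equiv.Perm (Fin (ν k))) →* Equiv.Perm (Fin n) :=
  (blockEquiv ν hν).permCongrHom.toMonoidHom.comp (Equiv.Perm.sigmaCongrRightHom _)

theorem youngHom_apply (t : ∀ k, Equiv.Perm (Fin (ν k))) (k : Fin r) (i : Fin (ν k)) :
    youngHom hν t (blockEquiv ν hν ⟨k, i⟩) = blockEquiv ν hν ⟨k, t k i⟩ := by
  simp [youngHom]

theorem exists_youngHom_eq (s : Equiv.Perm (Fin n))
    (hs : ∀ i, block ν hν (s i) = block ν hν i) : ∃ t, youngHom hν t = s := by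
  have h : ∀ k (i : Fin (ν k)), ∃ i' : Fin (ν k), blockEquiv ν hν ⟨k, i'⟩
      = s (blockEquiv ν hν ⟨k, i⟩) := by
    intro k i
    obtain ⟨l, i', e⟩ := exists_blockEquiv ν hν (s (blockEquiv ν hν ⟨k, i⟩))
    have := hs (blockEquiv ν hν ⟨k, i⟩)
    rw [← e, block_blockEquiv, block_blockEquiv] at this
    subst this
    exact ⟨i', e⟩
  choose t ht using h
  have hinj : ∀ k, Function.Injective (t k) := by
    intro k i i' e
    have := ht k i
    rw [e, ht k i'] at this
    simpa using (s.injective.eq_iff.1 this).symm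
  refine ⟨fun k => Equiv.ofBijective (t k) (Finite.injective_iff_bijective.1 (hinj k)),
    Equiv.ext fun i => ?_⟩
  obtain ⟨k, i, rfl⟩ := exists_blockEquiv ν hν i
  rw [youngHom_apply, ← ht]
  rfl

theorem youngHom_mulSingle (k : Fin r) (i : ℕ) (h : i + 1 < ν k)
    (h' : (∑ l ∈ Finset.Iio k, ν l) + i + 1 < n) :
    youngHom hν (Pi.mulSingle k (simpleTransposition i h))
      = simpleTransposition ((∑ l ∈ Finset.Iio k, ν l) + i) h' := by
  have e1 : (⟨(∑ l ∈ Finset.Iio k, ν l) + i, Nat.lt_of_succ_lt h'⟩ : Fin n)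
      = blockEquiv ν hν ⟨k, ⟨i, Nat.lt_of_succ_lt h⟩⟩ := rfl
  have e2 : (⟨(∑ l ∈ Finset.Iio k, ν l) + i + 1, h'⟩ : Fin n)
      = blockEquiv ν hν ⟨k, ⟨i + 1, h⟩⟩ := Fin.ext (Nat.add_assoc _ _ _)
  rw [simpleTransposition.eq_1 ((∑ l ∈ Finset.Iio k, ν l) + i), e1, e2]
  refine Equiv.ext fun p => ?_
  obtain ⟨l, p, rfl⟩ := exists_blockEquiv ν hν p
  rw [youngHom_apply, ← (blockEquiv ν hν).injective.map_swap]
  congr 1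
  rcases eq_or_ne l k with rfl | hl
  · rw [Pi.mulSingle_eq_same, simpleTransposition]
    exact (sigma_mk_injective (i := l)).map_swap _ _ _
  · rw [Pi.mulSingle_eq_of_ne hl, Equiv.swap_apply_of_ne_of_ne]
    · rfl
    · rintro e; exact hl (congrArg Sigma.fst e)
    · rintro e; exact hl (congrArg Sigma.fst e)

/-- The Young subgroup is generated by the simple transpositions inside the blocks, and these come
from generators of the tensor factors. -/
theorem permHom_mem_range (s : Equiv.Perm (Fin n))
    (hs : ∀ i, block ν hν (s i) = block ν hν i) :
    permHom F G n s ∈ (parabolicHom F G ν hν).range := by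
  obtain ⟨t, rfl⟩ := exists_youngHom_eq hν s hs
  have hle : (⊤ : Submonoid (∀ k, Equiv.Perm (Fin (ν k))))
      ≤ (parabolicHom F G ν hν).range.toSubmonoid.comap
        ((permHom F G n).comp (youngHom hν)) := by
    rw [← Submonoid.pi_top Set.univ, ← Submonoid.iSup_map_mulSingle]
    refine iSup_le fun k => ?_
    rw [← mclosure_simpleTransposition, Submonoid.map_le_iff_le_comap, Submonoid.closure_le]
    rintro _ ⟨i, h, rfl⟩
    have h' : (∑ l ∈ Finset.Iio k, ν l) + i + 1 < n := by
      have := offset_add_le ν hν k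
      omega
    refine ⟨factorHom F G k (of F (.s i h)), ?_⟩
    change parabolicHom F G ν hν _
      = permHom F G n (youngHom hν (Pi.mulSingle k (simpleTransposition i h)))
    rw [youngHom_mulSingle hν k i h h', permHom_simpleTransposition, parabolicHom_factorHom,
      blockHom, lift_of]
    rfl
  exact hle (Submonoid.mem_top t)

variable (F G) in
theorem of_x_mem_range (i : Fin n) : of F (.x i) ∈ (parabolicHom F G ν hν).range := by
  rw [parabolicHom_range]
  exact Algebra.subset_adjoin (Or.inl (Or.inr ⟨i, rfl⟩))

variable (F) in
theorem of_grp_mem_range (g : Fin n → G) : of F (.grp g) ∈ (parabolicHom F G ν hν).range := by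
  rw [parabolicHom_range]
  exact Algebra.subset_adjoin (Or.inl (Or.inl ⟨g, rfl⟩))

variable {hν} {W : Type*} [AddCommGroup W] [Module F W] {σ : Parabolic F G ν →ₐ[F] Module.End F W}
  {M : Type*} [AddCommGroup M] [Module F M] {τ : WreathHecke F G n →ₐ[F] Module.End F M}
  {f : W →ₗ[F] M} (hf : ∀ b w, f (σ b w) = τ (parabolicHom F G ν hν b) (f w))

include hf

theorem apply_mem_range_of_mem_range {a : WreathHecke F G n}
    (ha : a ∈ (parabolicHom F G ν hν).range) (w : W) : ∃ w', f w' = τ a (f w) := by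
  obtain ⟨b, rfl⟩ := ha
  exact ⟨σ b w, hf b w⟩

/-- The sum of the translates is stable under all generators. Permutations and elements of `G ^ n`
respect the family of translates. An `x_i` is moved through a permutation one simple reflection at a
time, each step leaving a multiple of `swapElt`, under which the sum is already known to be stable.
-/
theorem iSup_permHom_eq_top
    (hgen : ∀ N : Submodule F M, (∀ a, ∀ v ∈ N, τ a v ∈ N) → LinearMap.range f ≤ N → N = ⊤) :
    ⨆ s : Equiv.Perm (Fin n), (LinearMap.range f).map (τ (permHom F G n s)) = ⊤ := by
  set N := ⨆ s : Equiv.Perm (Fin n), (LinearMap.range f).map (τ (permHom F G n s)) with hN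
  have mem : ∀ s w, τ (permHom F G n s) (f w) ∈ N := fun s w =>
    Submodule.mem_iSup_of_mem s ⟨f w, ⟨w, rfl⟩, rfl⟩
  have ind : ∀ T : Module.End F M, (∀ s w, T (τ (permHom F G n s) (f w)) ∈ N) →
      ∀ v ∈ N, T v ∈ N := by
    intro T hT v hv
    have : N ≤ N.comap T := by
      conv_lhs => rw [hN]
      refine iSup_le fun s => ?_
      rintro _ ⟨_, ⟨w, rfl⟩, rfl⟩
      exact hT s w
    exact this hv
  have hs : ∀ s, ∀ v ∈ N, τ (permHom F G n s) v ∈ N := fun s => ind _ fun s' w => by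
    rw [← Module.End.mul_apply, ← map_mul, ← map_mul]
    exact mem _ _
  have hg : ∀ g, ∀ v ∈ N, τ (of F (.grp g)) v ∈ N := fun g => ind _ fun s w => by
    have e := permHom_mul_grp (F := F) s fun k => g (s k)
    rw [show (fun k => g (s (s⁻¹ k))) = g by funext k; simp] at e
    rw [← Module.End.mul_apply, ← map_mul, ← e, map_mul, Module.End.mul_apply]
    obtain ⟨w', hw'⟩ := apply_mem_range_of_mem_range hf (of_grp_mem_range F hν fun k => g (s k)) w
    rw [← hw']
    exact mem _ _
  have hx : ∀ i, ∀ v ∈ N, τ (of F (.x i)) v ∈ N := fun i => ind _ fun s w => by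
    have hmem : s ∈ Submonoid.closure {σ : Equiv.Perm (Fin n) | ∃ i h, σ = simpleTransposition i h} := by
      rw [mclosure_simpleTransposition]; trivial
    induction hmem using Submonoid.closure_induction_left generalizing i with
    | one =>
      rw [map_one, map_one, Module.End.one_apply]
      obtain ⟨w', hw'⟩ := apply_mem_range_of_mem_range hf (of_x_mem_range F G hν i) w
      rw [← hw']
      simpa using mem 1 w'
    | mul_left _ ht s _ ih =>
      obtain ⟨l, h, rfl⟩ := ht
      have hswap : ∀ p q, ∀ v ∈ N, τ (swapElt F G p q) v ∈ N := by
        intro p q v hv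
        rw [swapElt, map_sum, LinearMap.sum_apply]
        exact Submodule.sum_mem _ fun a _ => hg _ _ hv
      have key : ∃ (i' : Fin n) (c : F), of F (.x i) * of F (.s l h)
          = of F (.s l h) * of F (.x i')
            + c • swapElt F G ⟨l, Nat.lt_of_succ_lt h⟩ ⟨l + 1, h⟩ := by
        by_cases h1 : i.val = l
        · obtain rfl : i = ⟨l, Nat.lt_of_succ_lt h⟩ := Fin.ext h1
          exact ⟨⟨l + 1, h⟩, -1, by rw [s_mul_x_succ, neg_one_smul, add_neg_cancel_right]⟩
        · by_cases h2 : i.val = l + 1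
          · obtain rfl : i = ⟨l + 1, h⟩ := Fin.ext h2
            exact ⟨⟨l, Nat.lt_of_succ_lt h⟩, 1, by rw [s_mul_x, one_smul, sub_add_cancel]⟩
          · exact ⟨i, 0, by rw [s_x_of_ne l h i h1 h2, zero_smul, add_zero]⟩
      obtain ⟨i', c, e⟩ := key
      rw [← Module.End.mul_apply, ← map_mul, map_mul (permHom F G n), permHom_simpleTransposition,
        ← mul_assoc, e, add_mul, map_add, LinearMap.add_apply, smul_mul_assoc, map_smul,
        LinearMap.smul_apply, mul_assoc, map_mul, Module.End.mul_apply, map_mul, map_mul,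
        Module.End.mul_apply, Module.End.mul_apply]
      refine add_mem ?_ (Submodule.smul_mem _ _ (hswap _ _ _ (mem _ _)))
      rw [← permHom_simpleTransposition]
      exact hs _ _ (ih i')
  refine hgen N (fun a => ?_) ?_
  · let S : Subalgebra F (WreathHecke F G n) :=
      { carrier := {a | ∀ v ∈ N, τ a v ∈ N}
        mul_mem' := fun {a b} ha hb v hv => by
          rw [map_mul, Module.End.mul_apply]; exact ha _ (hb _ hv)
        add_mem' := fun {a b} ha hb v hv => by
          rw [map_add, LinearMap.add_apply]; exact add_mem (ha _ hv) (hb _ hv)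
        algebraMap_mem' := fun c v hv => by
          rw [AlgHom.commutes]; exact N.smul_mem c hv }
    refine mem_of_forall_gen S (fun a => ?_) a
    rcases a with g | i | ⟨i, h⟩
    · exact hg g
    · exact hx i
    · intro v hv
      rw [← permHom_simpleTransposition]
      exact hs _ v hv
  · rintro _ ⟨w, rfl⟩
    simpa using mem 1 w

/-! ### Weight projections on generated modules -/

section Weight

variable {V : Fin r → Type w} [∀ k, AddCommGroup (V k)] [∀ k, Module F (V k)]
  {ρ : ∀ k, Representation F G (V k)} {ε : Fin r → MonoidAlgebra F G}
  (hε : ∀ k l, (ρ l).asAlgebraHom (ε k) = if k = l then 1 else 0)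
  (hσ : ∀ k j a, (ρ k).asAlgebraHom a = 0 → σ (factorHom F G k (posHom F j a)) = 0)
  (hgen : ∀ N : Submodule F M, (∀ a, ∀ v ∈ N, τ a v ∈ N) → LinearMap.range f ≤ N → N = ⊤)

include hσ

theorem hasWeight_block (w : W) : HasWeight ρ τ (block ν hν) (f w) := by
  intro i a ha
  obtain ⟨k, j, rfl⟩ := exists_blockEquiv ν hν i
  have hk : ∀ l, l = k → (ρ l).asAlgebraHom a = 0 → (ρ k).asAlgebraHom a = 0 := by
    rintro _ rfl h
    exact h
  replace ha := hk _ (block_blockEquiv ν hν k j) ha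
  rw [← parabolicHom_factorHom_posHom, ← hf, hσ k j a ha, LinearMap.zero_apply, map_zero]

include hε hgen

/-- The translate of `f(W)` by `s` has weight `block ∘ s⁻¹`. This is the block weight only if `s`
preserves the blocks, in which case `s` comes from the parabolic algebra and maps `f(W)` to itself;
every other translate is killed by the projection. -/
theorem weightElt_block_mem_range (v : M) :
    τ (weightElt ε (block ν hν)) v ∈ LinearMap.range f := by
  have hv : v ∈ ⨆ s : Equiv.Perm (Fin n), (LinearMap.range f).map (τ (permHom F G n s)) := by
    rw [iSup_permHom_eq_top hf hgen]; trivial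
  have : (⨆ s : Equiv.Perm (Fin n), (LinearMap.range f).map (τ (permHom F G n s)))
      ≤ (LinearMap.range f).comap (τ (weightElt ε (block ν hν))) := by
    refine iSup_le fun s => ?_
    rintro _ ⟨_, ⟨w, rfl⟩, rfl⟩
    rw [Submodule.mem_comap, weightElt_apply hε ((hasWeight_block hf hσ w).permHom s)]
    split_ifs with h
    · refine apply_mem_range_of_mem_range hf (permHom_mem_range hν s fun i => ?_) w
      have := congrFun h (s i)
      simpa using this
    · exact zero_mem _
  exact this hv

/-- Only rearrangements of the block weight occur in the module, and the weight projections sum to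
the identity on it. So `v` has a nonzero component at some rearrangement, and a permutation moves
that component to the block weight. -/
theorem exists_weightElt_block_ne_zero {v : M} (hv : v ≠ 0) :
    ∃ s, τ (weightElt ε (block ν hν)) (τ (permHom F G n s) v) ≠ 0 := by
  by_contra! hcon
  have key : ∀ v : M, ∑ c : Fin n → Fin r, τ (weightElt ε c) v = v ∧
      ∀ c, (∀ s : Equiv.Perm (Fin n), c ≠ fun i => block ν hν (s⁻¹ i)) → τ (weightElt ε c) v = 0 := by
    intro v
    have hv : v ∈ ⨆ s : Equiv.Perm (Fin n), (LinearMap.range f).map (τ (permHom F G n s)) := by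
      rw [iSup_permHom_eq_top hf hgen]; trivial
    induction hv using Submodule.iSup_induction' with
    | mem s v hv =>
      obtain ⟨_, ⟨w, rfl⟩, rfl⟩ := hv
      have e := weightElt_apply hε ((hasWeight_block hf hσ w).permHom s)
      simp only [e]
      refine ⟨by simp, fun c hc => if_neg (hc s)⟩
    | zero => simp
    | add v v' _ _ h h' =>
      refine ⟨?_, fun c hc => ?_⟩
      · simp only [map_add, Finset.sum_add_distrib, h.1, h'.1]
      · rw [map_add, h.2 c hc, h'.2 c hc, add_zero]
  refine hv ?_
  rw [← (key v).1]
  refine Finset.sum_eq_zero fun c _ => ?_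
  by_cases hc : ∀ s : Equiv.Perm (Fin n), c ≠ fun i => block ν hν (s⁻¹ i)
  · exact (key v).2 c hc
  · push Not at hc
    obtain ⟨s, rfl⟩ := hc
    have e := weightElt_mul_permHom ε (fun i => block ν hν (s⁻¹ i)) s
    have h1 : τ (permHom F G n s) (τ (permHom F G n s⁻¹) v) = v := by
      rw [← Module.End.mul_apply, ← map_mul, ← map_mul, mul_inv_cancel, map_one, map_one,
        Module.End.one_apply]
    rw [← h1, ← Module.End.mul_apply, ← map_mul, e, map_mul, Module.End.mul_apply]
    simp only [← Equiv.Perm.mul_apply, inv_mul_cancel, Equiv.Perm.one_apply]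
    exact (congrArg _ (hcon s⁻¹)).trans (map_zero _)

/-- A nonzero stable subspace contains a vector with nonzero block component, and this component
lies both in the subspace and in `f(W)`. Irreducibility of `W` then forces all of `f(W)`, which
generates, into the subspace. -/
theorem isIrreducibleRep_of_generated (hW : IsIrreducibleRep σ) (hf0 : f ≠ 0) :
    IsIrreducibleRep τ := by
  obtain ⟨w₀, hw₀⟩ := DFunLike.ne_iff.1 hf0
  refine ⟨⟨_, _, hw₀⟩, fun N hN => or_iff_not_imp_left.2 fun hbot => ?_⟩
  obtain ⟨v, hvN, hv⟩ := N.exists_mem_ne_zero_of_ne_bot hbot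
  obtain ⟨s, hs⟩ := exists_weightElt_block_ne_zero hf hε hσ hgen hv
  obtain ⟨w, hw⟩ := weightElt_block_mem_range hf hε hσ hgen (τ (permHom F G n s) v)
  refine hgen N hN ?_
  have hcomap : N.comap f = ⊤ := by
    refine (hW.2 (N.comap f) fun b w hw => ?_).resolve_left fun h => ?_
    · rw [Submodule.mem_comap, hf]
      exact hN _ _ hw
    · have : w ∈ N.comap f := by
        rw [Submodule.mem_comap, hw]
        exact hN _ _ (hN _ _ hvN)
      rw [h, Submodule.mem_bot] at this
      rw [← hw, this, map_zero] at hs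
      exact hs rfl
  rintro _ ⟨w, rfl⟩
  have : w ∈ N.comap f := by rw [hcomap]; trivial
  exact this

end Weight

end Generated

end WreathHecke

/-! ### Contraction of external tensor products to one factor -/

section Contraction

theorem isSimpleModule_of_isIrreducibleRep_lsmul {F A M : Type*} [Field F] [Ring A] [Algebra F A]
    [AddCommGroup M] [Module F M] [Module A M] [IsScalarTower F A M]
    (h : IsIrreducibleRep (Algebra.lsmul F F M : A →ₐ[F] Module.End F M)) : IsSimpleModule A M := by
  have := h.1
  refine (isSimpleModule_iff _ _).2 ⟨fun N => ?_⟩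
  rcases h.2 (N.restrictScalars F) fun a w hw => N.smul_mem a hw with h | h
  · exact Or.inl ((Submodule.restrictScalars_eq_bot_iff F A M).1 h)
  · exact Or.inr ((Submodule.restrictScalars_eq_top_iff F A M).1 h)

variable {F : Type*} [Field F] {ι : Type*} [Fintype ι] [DecidableEq ι] {W : ι → Type*}
  [∀ k, AddCommGroup (W k)] [∀ k, Module F (W k)] [∀ k, FiniteDimensional F (W k)]

/-- A nonzero tensor has a nonzero contraction to each tensor factor. -/
theorem PiTensorProduct.exists_contraction (k : ι) {y : ⨂[F] l, W l} (hy : y ≠ 0) :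
    ∃ C : (⨂[F] l, W l) →ₗ[F] W k, C y ≠ 0 ∧ ∀ (T : Module.End F (W k)) (w : ∀ l, W l),
      C (PiTensorProduct.tprod F (Function.update w k (T (w k))))
        = T (C (PiTensorProduct.tprod F w)) := by
  let b := fun l => Module.finBasis F (W l)
  let bt := Basis.piTensorProduct b
  obtain ⟨f, hf⟩ : ∃ f, bt.repr y f ≠ 0 := by
    by_contra! h
    exact hy (bt.repr.map_eq_zero_iff.1 (Finsupp.ext h))
  -- Contraction with the coordinate functionals `f l` in the factors `l ≠ k`, leaving the `k`-th
  -- factor free.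
  let C : (⨂[F] l, W l) →ₗ[F] W k :=
    ∑ j, (bt.coord (Function.update f k j)).smulRight (b k j)
  have hC : ∀ t, C t = ∑ j, bt.repr t (Function.update f k j) • b k j := fun t => by
    simp [C]
  have hCt : ∀ w, C (PiTensorProduct.tprod F w)
      = (∏ l ∈ Finset.univ.erase k, (b l).repr (w l) (f l)) • w k := by
    intro w
    rw [hC]
    conv_rhs => rw [← (b k).sum_repr (w k), Finset.smul_sum]
    refine Finset.sum_congr rfl fun j _ => ?_
    rw [smul_smul, Basis.piTensorProduct_repr_tprod_apply, ← Finset.mul_prod_erase _ _ (Finset.mem_univ k),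
      Function.update_self, mul_comm]
    congr 2
    refine Finset.prod_congr rfl fun l hl => ?_
    rw [Function.update_of_ne (Finset.ne_of_mem_erase hl)]
  refine ⟨C, fun h0 => hf ?_, fun T w => ?_⟩
  · have := congrArg (fun t => (b k).repr t (f k)) h0
    simpa [hC, Finsupp.single_apply] using this
  · rw [hCt, hCt, map_smul, Function.update_self]
    congr 1
    refine Finset.prod_congr rfl fun l hl => ?_
    rw [Function.update_of_ne (Finset.ne_of_mem_erase hl)]

theorem exists_outerRep_contraction {B : ι → Type*} [∀ k, Ring (B k)] [∀ k, Algebra F (B k)]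
    (σ : ∀ k, B k →ₐ[F] Module.End F (W k)) (k : ι) {y : ⨂[F] l, W l} (hy : y ≠ 0) :
    ∃ C : (⨂[F] l, W l) →ₗ[F] W k, C y ≠ 0 ∧ ∀ b t,
      C (outerRep σ (PiTensorProduct.singleAlgHom k b) t) = σ k b (C t) := by
  obtain ⟨C, hCy, hC⟩ := PiTensorProduct.exists_contraction (F := F) k hy
  refine ⟨C, hCy, fun b t => ?_⟩
  induction t using PiTensorProduct.induction_on with
  | smul_tprod c w =>
    rw [map_smul, map_smul, outerRep_singleAlgHom, hC, map_smul, map_smul]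
  | add s t hs ht => rw [map_add, map_add, hs, ht, map_add, map_add]

omit [Fintype ι] [∀ k, FiniteDimensional F (W k)] in
/-- Intertwiners of the tensor factors from an intertwiner of external tensor products. -/
theorem exists_factor_hom [Finite ι] {B : ι → Type*} [∀ k, Ring (B k)] [∀ k, Algebra F (B k)]
    {W' : ι → Type*} [∀ k, AddCommGroup (W' k)] [∀ k, Module F (W' k)]
    [∀ k, FiniteDimensional F (W' k)] (σ : ∀ k, B k →ₐ[F] Module.End F (W k))
    (σ' : ∀ k, B k →ₐ[F] Module.End F (W' k)) {θ : (⨂[F] l, W l) →ₗ[F] ⨂[F] l, W' l} (hθ : θ ≠ 0)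
    (hcomm : ∀ b t, θ (outerRep σ b t) = outerRep σ' b (θ t)) (k : ι) :
    ∃ f : W k →ₗ[F] W' k, f ≠ 0 ∧ ∀ b x, f (σ k b x) = σ' k b (f x) := by
  have := Fintype.ofFinite ι
  obtain ⟨w, hw⟩ : ∃ w, θ (PiTensorProduct.tprod F w) ≠ 0 := by
    by_contra! h
    exact hθ (PiTensorProduct.ext (MultilinearMap.ext h))
  obtain ⟨C, hC, hCc⟩ := exists_outerRep_contraction σ' k hw
  -- All vectors but the `k`-th are frozen at those of `w`, which makes `θ` a map out of `W k`; the
  -- contraction brings its value back to `W' k`.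
  refine ⟨C ∘ₗ θ ∘ₗ (PiTensorProduct.tprod F).toLinearMap w k, fun h0 => hC ?_, fun b x => ?_⟩
  · have := LinearMap.congr_fun h0 (w k)
    simpa using this
  · have e := outerRep_singleAlgHom σ k b (Function.update w k x)
    rw [Function.update_self, Function.update_idem] at e
    simp only [LinearMap.comp_apply, MultilinearMap.toLinearMap_apply]
    rw [← e, hcomm, hCc]

omit [Fintype ι] [∀ k, FiniteDimensional F (W k)] [DecidableEq ι] in
theorem map_outerRep_apply {B : ι → Type*} [∀ k, Ring (B k)] [∀ k, Algebra F (B k)]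
    {W' : ι → Type*} [∀ k, AddCommGroup (W' k)] [∀ k, Module F (W' k)]
    (σ : ∀ k, B k →ₐ[F] Module.End F (W k))
    (σ' : ∀ k, B k →ₐ[F] Module.End F (W' k)) (f : ∀ k, W k →ₗ[F] W' k)
    (hf : ∀ k b x, f k (σ k b x) = σ' k b (f k x)) (b : ⨂[F] k, B k) (t : ⨂[F] k, W k) :
    PiTensorProduct.map f (outerRep σ b t) = outerRep σ' b (PiTensorProduct.map f t) := by
  induction b using PiTensorProduct.induction_on with
  | smul_tprod c p =>
    simp only [map_smul, LinearMap.smul_apply]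
    congr 1
    rw [outerRep_tprod, outerRep_tprod, ← LinearMap.comp_apply, ← PiTensorProduct.map_comp,
      ← LinearMap.comp_apply, ← PiTensorProduct.map_comp]
    congr 2
    funext k
    exact LinearMap.ext fun x => hf k _ x
  | add s t hs ht => simp only [map_add, LinearMap.add_apply, hs, ht]

end Contraction

/-! ### One-block modules: weight and functoriality in `L` -/

namespace WreathHecke

section OneBlock

variable {F : Type u} [Field F] [IsAlgClosed F] {G : Type v} [Group G] [Fintype G]
  {V : Type w} [AddCommGroup V] [Module F V] [FiniteDimensional F V] (ρ : Representation F G V)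
  [ρ.IsIrreducible] {m : ℕ} (L : Type z) (L' : Type z')
  [AddCommGroup L] [Module F L] [Module (TwistedHecke (swapScalar ρ) m) L]
  [IsScalarTower F (TwistedHecke (swapScalar ρ) m) L]
  [AddCommGroup L'] [Module F L'] [Module (TwistedHecke (swapScalar ρ) m) L']
  [IsScalarTower F (TwistedHecke (swapScalar ρ) m) L']

theorem tensorRep_posHom_eq_zero (j : Fin m) {a : MonoidAlgebra F G} (ha : ρ.asAlgebraHom a = 0) :
    tensorRep ρ L (posHom F j a) = 0 := by
  rw [← posProd_mulSingle, tensorRep_posProd]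
  have : (PiTensorProduct.map fun i => ρ.asAlgebraHom ((Pi.mulSingle j a : Fin m → _) i)) = 0 := by
    refine PiTensorProduct.ext (MultilinearMap.ext fun f => ?_)
    simp only [LinearMap.compMultilinearMap_apply, PiTensorProduct.map_tprod]
    exact (PiTensorProduct.tprod F).map_coord_zero j (by simp [ha])
  rw [this]
  exact TensorProduct.map_zero_left _

theorem tensorRep_map_apply (e : L →ₗ[TwistedHecke (swapScalar ρ) m] L')
    (p : WreathHecke F G m) (t : (⨂[F] _ : Fin m, V) ⊗[F] L) :
    (e.restrictScalars F).lTensor (⨂[F] _ : Fin m, V) (tensorRep ρ L p t)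
      = tensorRep ρ L' p ((e.restrictScalars F).lTensor _ t) := by
  refine intertwine_of_gen (tensorRep ρ L) (tensorRep ρ L') _ (fun a t => ?_) p t
  induction t using TensorProduct.induction_on with
  | zero => simp only [map_zero]
  | add s t hs ht => simp only [map_add, hs, ht]
  | tmul t l =>
    rcases a with g | i | ⟨i, h⟩
    · rw [← posProd_of, LinearMap.lTensor_tmul, tensorRep_posProd_tmul, tensorRep_posProd_tmul,
        LinearMap.lTensor_tmul]
    · rw [tensorRep_x, map_smul, LinearMap.lTensor_tmul, LinearMap.lTensor_tmul, tensorRep_x]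
      simp
    · induction t using PiTensorProduct.induction_on with
      | smul_tprod c f =>
        simp only [← TensorProduct.smul_tmul', map_smul]
        congr 1
        rw [tensorRep_s, LinearMap.lTensor_tmul, LinearMap.lTensor_tmul, tensorRep_s]
        simp
      | add s t hs ht => simp only [TensorProduct.add_tmul, map_add, hs, ht]

end OneBlock

/-! ### Induction from the parabolic algebra: injectivity, simplicity, isomorphisms -/

section InducedParabolic

variable {F : Type u} [Field F] {G : Type v} [Group G] [Fintype G] {r : ℕ}
  {V : Fin r → Type w} [∀ k, AddCommGroup (V k)] [∀ k, Module F (V k)]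
  {ρ : ∀ k, Representation F G (V k)} {ε : Fin r → MonoidAlgebra F G}
  (hε : ∀ k l, (ρ l).asAlgebraHom (ε k) = if k = l then 1 else 0)
  {n : ℕ} {ν : Fin r → ℕ} (hν : ∑ k, ν k = n)
  {W : Type*} [AddCommGroup W] [Module F W] {σ : Parabolic F G ν →ₐ[F] Module.End F W}
  (hσ : ∀ k j a, (ρ k).asAlgebraHom a = 0 → σ (factorHom F G k (posHom F j a)) = 0)

theorem eq_top_of_range_inducedOf_le {A B : Type*} [Ring A] [Algebra F A] [Ring B] [Algebra F B]
    (j : B →ₐ[F] A) (σ : B →ₐ[F] Module.End F W) (N : Submodule F (inducedModule j σ))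
    (hN : ∀ a, ∀ v ∈ N, (Algebra.lsmul F F (inducedModule j σ) : A →ₐ[F] _) a v ∈ N)
    (h : LinearMap.range (inducedOf j σ) ≤ N) : N = ⊤ := by
  let N' : Submodule A (inducedModule j σ) := { N with smul_mem' := fun a v hv => hN a v hv }
  have : N' = ⊤ := by
    rw [eq_top_iff, ← span_inducedOf, Submodule.span_le]
    rintro _ ⟨w, rfl⟩
    exact h ⟨w, rfl⟩
  exact SetLike.ext fun v => SetLike.ext_iff.1 this v

include hσ in
theorem hasWeight_map_inducedOf {M : Type*} [AddCommGroup M] [Module F M]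
    [Module (WreathHecke F G n) M] [IsScalarTower F (WreathHecke F G n) M]
    (e : inducedModule (parabolicHom F G ν hν) σ →ₗ[WreathHecke F G n] M) (w : W) :
    HasWeight ρ (Algebra.lsmul F F M : WreathHecke F G n →ₐ[F] _) (block ν hν)
      (e (inducedOf (parabolicHom F G ν hν) σ w)) :=
  hasWeight_block (σ := σ) (f := e.restrictScalars F ∘ₗ inducedOf (parabolicHom F G ν hν) σ)
    (fun b w => by
      rw [LinearMap.comp_apply, inducedOf_apply]
      exact map_smul e _ _) hσ w

include hε hσ

/-- By the universal property the embedding of `W` into the module of `exists_extension` factors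
through the canonical map to the induced module. This takes the place of freeness of the wreath
Hecke algebra over the parabolic subalgebra. -/
theorem inducedOf_injective : Function.Injective (inducedOf (parabolicHom F G ν hν) σ) := by
  obtain ⟨τ, f, hf, hτ⟩ := exists_extension σ hν (ε := ε)
    (fun k j => by
      have := hσ k j (ε k - 1) (by rw [map_sub, hε, if_pos rfl, map_one, sub_self])
      rwa [map_sub, map_sub, map_sub, map_one, map_one, map_one, sub_eq_zero] at this)
    (fun k l j hkl => hσ l j (ε k) (by rw [hε, if_neg hkl]))
  let _ : Module (WreathHecke F G n) (BlockIncreasing hν → W) := Module.compHom _ τ.toRingHom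
  have hsmul : ∀ (a : WreathHecke F G n) (q : BlockIncreasing hν → W), a • q = τ a q :=
    fun _ _ => rfl
  have : IsScalarTower F (WreathHecke F G n) (BlockIncreasing hν → W) := ⟨fun c a q => by
    rw [hsmul, hsmul, map_smul, LinearMap.smul_apply]⟩
  obtain ⟨Φ, hΦ⟩ := exists_inducedLift (parabolicHom F G ν hν) σ f hτ
  intro w w' h
  exact hf (by rw [← hΦ, ← hΦ, h])

variable (hW : IsIrreducibleRep σ)

include hW

theorem isSimpleModule_inducedModule :
    IsSimpleModule (WreathHecke F G n) (inducedModule (parabolicHom F G ν hν) σ) := by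
  refine isSimpleModule_of_isIrreducibleRep_lsmul
    (isIrreducibleRep_of_generated (inducedOf_apply _ σ) hε hσ
      (eq_top_of_range_inducedOf_le _ σ) hW fun h => ?_)
  have := hW.1
  obtain ⟨w, hw⟩ := exists_ne (0 : W)
  exact hw (inducedOf_injective hε hν hσ (by rw [h]; rfl))

/-- Frobenius reciprocity: `f` extends to a nonzero homomorphism between two simple modules. -/
theorem nonempty_equiv_inducedModule {M : Type*} [AddCommGroup M] [Module F M]
    [Module (WreathHecke F G n) M] [IsScalarTower F (WreathHecke F G n) M]
    [IsSimpleModule (WreathHecke F G n) M] (f : W →ₗ[F] M) (hf0 : f ≠ 0)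
    (hf : ∀ b w, f (σ b w) = parabolicHom F G ν hν b • f w) :
    Nonempty (inducedModule (parabolicHom F G ν hν) σ ≃ₗ[WreathHecke F G n] M) := by
  obtain ⟨Φ, hΦ⟩ := exists_inducedLift (parabolicHom F G ν hν) σ f hf
  have := isSimpleModule_inducedModule hε hν hσ hW
  refine ⟨LinearEquiv.ofBijective Φ (LinearMap.bijective_of_ne_zero fun h0 => hf0 ?_)⟩
  refine LinearMap.ext fun w => ?_
  rw [← hΦ, h0, LinearMap.zero_apply, LinearMap.zero_apply]

/-- The image of `W` has the weight `block ν hν`, and some permutation of it has a nonzero component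
of weight `block ν' hν'`. The two labellings are therefore rearrangements of each other, and
counting their fibres gives `ν = ν'`. -/
theorem eq_of_inducedModule_equiv {ν' : Fin r → ℕ} (hν' : ∑ k, ν' k = n)
    {W' : Type*} [AddCommGroup W'] [Module F W'] {σ' : Parabolic F G ν' →ₐ[F] Module.End F W'}
    (hσ' : ∀ k j a, (ρ k).asAlgebraHom a = 0 → σ' (factorHom F G k (posHom F j a)) = 0)
    (e : inducedModule (parabolicHom F G ν hν) σ
      ≃ₗ[WreathHecke F G n] inducedModule (parabolicHom F G ν' hν') σ') : ν = ν' := by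
  have := hW.1
  obtain ⟨w, hw⟩ := exists_ne (0 : W)
  have hv : e (inducedOf _ σ w) ≠ 0 := fun h => hw (inducedOf_injective hε hν hσ
    ((e.map_eq_zero_iff.1 h).trans (map_zero _).symm))
  obtain ⟨s, hs⟩ := exists_weightElt_block_ne_zero (inducedOf_apply _ σ') hε hσ'
    (eq_top_of_range_inducedOf_le _ σ') hv
  have h1 := weightElt_apply hε ((hasWeight_map_inducedOf hν hσ e.toLinearMap w).permHom s)
    (block ν' hν')
  have h : block ν' hν' = fun i => block ν hν (s⁻¹ i) := by
    by_contra h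
    rw [if_neg h] at h1
    exact hs h1
  funext k
  rw [← card_block ν hν, ← card_block ν' hν']
  refine Finset.card_equiv s fun i => ?_
  simp [h]

/-- An isomorphism preserves weights, so it carries `W` to vectors of block weight in the target,
and those come from `W'` by `weightElt_block_mem_range`. -/
theorem exists_hom_of_inducedModule_equiv
    {W' : Type*} [AddCommGroup W'] [Module F W'] {σ' : Parabolic F G ν →ₐ[F] Module.End F W'}
    (hσ' : ∀ k j a, (ρ k).asAlgebraHom a = 0 → σ' (factorHom F G k (posHom F j a)) = 0)
    (e : inducedModule (parabolicHom F G ν hν) σ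
      ≃ₗ[WreathHecke F G n] inducedModule (parabolicHom F G ν hν) σ') :
    ∃ θ : W →ₗ[F] W', θ ≠ 0 ∧ ∀ b w, θ (σ b w) = σ' b (θ w) := by
  have hinj := inducedOf_injective hε hν hσ'
  let f : W →ₗ[F] inducedModule (parabolicHom F G ν hν) σ' :=
    e.toLinearMap.restrictScalars F ∘ₗ inducedOf _ σ
  have hmem : ∀ t, f t ∈ LinearMap.range (inducedOf (parabolicHom F G ν hν) σ') := fun t => by
    have h1 := weightElt_apply hε (hasWeight_map_inducedOf hν hσ e.toLinearMap t) (block ν hν)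
    rw [if_pos rfl] at h1
    have h2 := weightElt_block_mem_range (inducedOf_apply _ σ') hε hσ'
      (eq_top_of_range_inducedOf_le _ σ') (f t)
    exact h1 ▸ h2
  let E := LinearEquiv.ofInjective _ hinj
  let θ : W →ₗ[F] W' := E.symm.toLinearMap ∘ₗ f.codRestrict _ hmem
  have hθ : ∀ t, inducedOf (parabolicHom F G ν hν) σ' (θ t) = f t := fun t =>
    congrArg Subtype.val (E.apply_symm_apply (f.codRestrict _ hmem t))
  refine ⟨θ, fun h0 => ?_, fun b t => hinj ?_⟩
  · have := hW.1
    obtain ⟨w, hw⟩ := exists_ne (0 : W)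
    have h1 := hθ w
    rw [h0, LinearMap.zero_apply, map_zero] at h1
    exact hw (inducedOf_injective hε hν hσ
      ((e.map_eq_zero_iff.1 h1.symm).trans (map_zero _).symm))
  · rw [hθ, inducedOf_apply, hθ]
    change e (inducedOf _ σ _) = _ • e (inducedOf _ σ _)
    rw [inducedOf_apply, map_smul]

end InducedParabolic

/-! ### The modules `D` -/

section D

variable {F : Type u} [Field F] [IsAlgClosed F] {G : Type v} [Group G] [Fintype G] {r : ℕ}
  {V : Fin r → Type w} [∀ k, AddCommGroup (V k)] [∀ k, Module F (V k)]
  [∀ k, FiniteDimensional F (V k)] (ρ : ∀ k, Representation F G (V k))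
  [∀ k, (ρ k).IsIrreducible] {ν : Fin r → ℕ}
  (L : Fin r → Type z) [∀ k, AddCommGroup (L k)] [∀ k, Module F (L k)]
  [∀ k, Module (TwistedHecke (swapScalar (ρ k)) (ν k)) (L k)]
  [∀ k, IsScalarTower F (TwistedHecke (swapScalar (ρ k)) (ν k)) (L k)]

theorem outerRep_posHom_eq_zero (k : Fin r) (j : Fin (ν k)) (a : MonoidAlgebra F G)
    (ha : (ρ k).asAlgebraHom a = 0) :
    outerRep (fun k => (tensorRep (ρ k) (L k) : WreathHecke F G (ν k) →ₐ[F] _))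
      (factorHom F G k (posHom F j a)) = 0 := by
  refine PiTensorProduct.ext (MultilinearMap.ext fun f => ?_)
  simp only [LinearMap.compMultilinearMap_apply, LinearMap.zero_apply]
  rw [outerRep_singleAlgHom, tensorRep_posHom_eq_zero (ρ k) (L k) j ha]
  exact (PiTensorProduct.tprod F).map_coord_zero k (by simp)

theorem isIrreducibleRep_outerRep_tensorRep
    [∀ k, IsSimpleModule (TwistedHecke (swapScalar (ρ k)) (ν k)) (L k)] :
    IsIrreducibleRep
      (outerRep fun k => (tensorRep (ρ k) (L k) : WreathHecke F G (ν k) →ₐ[F] _)) := by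
  have h1 := fun k => isIrreducibleRep_tensorRep (m := ν k) (ρ k) (L k)
  have h2 := fun k => finiteDimensional_tensor (m := ν k) (ρ k) (L k)
  have h3 := fun k => (h1 k).1
  exact isIrreducibleRep_outerRep _ fun k => (h1 k).surjective

variable [∀ k, IsSimpleModule (TwistedHecke (swapScalar (ρ k)) (ν k)) (L k)]
  (L' : Fin r → Type z') [∀ k, AddCommGroup (L' k)] [∀ k, Module F (L' k)]
  [∀ k, Module (TwistedHecke (swapScalar (ρ k)) (ν k)) (L' k)]
  [∀ k, IsScalarTower F (TwistedHecke (swapScalar (ρ k)) (ν k)) (L' k)]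
  [∀ k, IsSimpleModule (TwistedHecke (swapScalar (ρ k)) (ν k)) (L' k)]

omit [∀ k, IsSimpleModule (TwistedHecke (swapScalar (ρ k)) (ν k)) (L k)]
  [∀ k, IsSimpleModule (TwistedHecke (swapScalar (ρ k)) (ν k)) (L' k)] in
theorem exists_outerRep_hom
    (e : ∀ k, Nonempty (L k ≃ₗ[TwistedHecke (swapScalar (ρ k)) (ν k)] L' k)) :
    ∃ θ : (⨂[F] k, (⨂[F] _ : Fin (ν k), V k) ⊗[F] L k)
        →ₗ[F] ⨂[F] k, (⨂[F] _ : Fin (ν k), V k) ⊗[F] L' k,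
      Function.Injective θ ∧ ∀ b t, θ (outerRep (fun k => tensorRep (ρ k) (L k)) b t)
        = outerRep (fun k => tensorRep (ρ k) (L' k)) b (θ t) := by
  have e := fun k => (e k).some
  let θ := fun k => ((e k).toLinearMap.restrictScalars F).lTensor (⨂[F] _ : Fin (ν k), V k)
  let θ' := fun k => ((e k).symm.toLinearMap.restrictScalars F).lTensor (⨂[F] _ : Fin (ν k), V k)
  refine ⟨PiTensorProduct.map θ, Function.LeftInverse.injective (g := PiTensorProduct.map θ')
    fun t => ?_, map_outerRep_apply _ _ θ
    (fun k b t => tensorRep_map_apply (ρ k) (L k) (L' k) (e k).toLinearMap b t)⟩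
  rw [← LinearMap.comp_apply, ← PiTensorProduct.map_comp]
  have : (fun k => θ' k ∘ₗ θ k) = fun k => LinearMap.id := by
    funext k
    refine TensorProduct.ext' fun t l => ?_
    simp [θ, θ']
  rw [this, PiTensorProduct.map_id, LinearMap.id_apply]

/-- An isomorphism of induced modules restricts to a nonzero map of the external tensor products,
whose contractions give nonzero maps of the one-block modules and hence isomorphisms of the `L k`.
Conversely, isomorphisms of the `L k` induce an embedding of external tensor products, to which
Frobenius reciprocity applies. -/
theorem nonempty_D_equiv_iff (hdistinct : ∀ k l, Nonempty ((ρ k).Equiv (ρ l)) → k = l) {n : ℕ}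
    (hν : ∑ k, ν k = n) :
    Nonempty (D ρ ν hν L ≃ₗ[WreathHecke F G n] D ρ ν hν L') ↔
      ∀ k, Nonempty (L k ≃ₗ[TwistedHecke (swapScalar (ρ k)) (ν k)] L' k) := by
  obtain ⟨ε, hε⟩ := exists_separating ρ hdistinct
  have hW := isIrreducibleRep_outerRep_tensorRep (ν := ν) ρ L
  have hW' := isIrreducibleRep_outerRep_tensorRep (ν := ν) ρ L'
  have hσ := outerRep_posHom_eq_zero (ν := ν) ρ L
  have hσ' := outerRep_posHom_eq_zero (ν := ν) ρ L'
  constructor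
  · rintro ⟨e⟩ k
    have hfd := fun k => finiteDimensional_tensor (m := ν k) (ρ k) (L' k)
    obtain ⟨θ, hθ0, hθ⟩ := exists_hom_of_inducedModule_equiv hε hν hσ hW hσ' e
    obtain ⟨g, hg0, hg⟩ := exists_factor_hom _ _ hθ0 hθ k
    exact nonempty_linearEquiv_of_tensor_hom (ρ k) (L k) (L' k) g hg0 hg
  · intro e
    obtain ⟨θ, hθ0, hθ⟩ := exists_outerRep_hom ρ L L' e
    have := isSimpleModule_inducedModule hε hν hσ' hW'
    refine nonempty_equiv_inducedModule hε hν hσ hW (inducedOf _ _ ∘ₗ θ) (fun h0 => ?_)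
      fun b w => ?_
    · have := hW.1
      obtain ⟨w, hw⟩ := exists_ne
        (0 : ⨂[F] k, (⨂[F] _ : Fin (ν k), V k) ⊗[F] L k)
      refine hw (hθ0 (inducedOf_injective hε hν hσ' ?_))
      rw [map_zero, map_zero]
      exact LinearMap.congr_fun h0 w
    · rw [LinearMap.comp_apply, hθ, inducedOf_apply]
      rfl

end D

end WreathHecke

namespace WreathHecke

/-! ### Every simple module is induced -/

section Exhaustion

variable {F : Type u} [Field F] {G : Type v} [Group G] {r : ℕ}
  {V : Fin r → Type w} [∀ k, AddCommGroup (V k)] [∀ k, Module F (V k)]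
  (ρ : ∀ k, Representation F G (V k))

/-- The quotient is a finite dimensional simple representation, hence isomorphic to some `ρ k`, and
an element acting as zero on it kills the class of `1`. Completeness enters the classification here,
in the universe `max u v` of the group algebra. -/
theorem exists_asAlgebraHom_eq_zero_imp_mem [Finite G]
    (hcomplete : ∀ (U : Type (max u v)) [AddCommGroup U] [Module F U] [FiniteDimensional F U]
      (σ : Representation F G U) [σ.IsIrreducible], ∃ k, Nonempty (σ.Equiv (ρ k)))
    (N : Submodule (MonoidAlgebra F G) (MonoidAlgebra F G))
    [IsSimpleModule (MonoidAlgebra F G) (MonoidAlgebra F G ⧸ N)] :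
    ∃ k, ∀ a, (ρ k).asAlgebraHom a = 0 → a ∈ N := by
  have : FiniteDimensional F (MonoidAlgebra F G) :=
    inferInstance
  have : FiniteDimensional F (MonoidAlgebra F G ⧸ N) :=
    Module.Finite.of_surjective (N.mkQ.restrictScalars F) N.mkQ_surjective
  let σ : Representation F G (MonoidAlgebra F G ⧸ N) := Representation.ofModule' _
  have hσ : ∀ a (q : MonoidAlgebra F G ⧸ N), σ.asAlgebraHom a q = a • q := fun a q =>
    DFunLike.congr_fun (DFunLike.congr_fun ((MonoidAlgebra.lift F _ G).apply_symm_apply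
      (Algebra.lsmul F F (MonoidAlgebra F G ⧸ N) : MonoidAlgebra F G →ₐ[F] _)) a) q
  have hirr : σ.IsIrreducible := by
    rw [Representation.irreducible_iff_isSimpleModule_asModule]
    let e : σ.asModule ≃ₗ[MonoidAlgebra F G] (MonoidAlgebra F G ⧸ N) :=
      { σ.asModuleEquiv with
        map_smul' := fun a q => hσ a q }
    exact IsSimpleModule.congr e
  obtain ⟨k, ⟨e⟩⟩ := hcomplete _ σ
  refine ⟨k, fun a ha => ?_⟩
  have h : ∀ a q, e (σ.asAlgebraHom a q) = (ρ k).asAlgebraHom a (e q) := by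
    intro a q
    induction a using groupAlgebra_induction with
    | h g =>
      rw [Representation.asAlgebraHom_of, Representation.asAlgebraHom_of]
      exact e.toIntertwiningMap.isIntertwining _ _ g q
    | hadd a b ha hb => simp only [map_add, LinearMap.add_apply, ha, hb]
    | hsmul c a ha => simp only [map_smul, LinearMap.smul_apply, ha]
  have h1 := h a (Submodule.Quotient.mk 1)
  rw [ha, LinearMap.zero_apply, hσ, ← Submodule.Quotient.mk_smul, smul_eq_mul, mul_one] at h1
  rw [← Submodule.Quotient.mk_eq_zero N]
  exact e.injective (h1.trans (map_zero e).symm)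

/-- With `ν k` the number of positions labelled `k`, the labelling and the block function have
fibres of the same sizes, and bijections between the fibres glue to a permutation. -/
theorem exists_perm_of_card_fiber {n : ℕ} (c : Fin n → Fin r) :
    ∃ (ν : Fin r → ℕ) (hν : ∑ k, ν k = n) (s : Equiv.Perm (Fin n)),
      (fun i => c (s⁻¹ i)) = block ν hν := by
  let ν : Fin r → ℕ := fun k => (Finset.univ.filter fun i => c i = k).card
  have hν : ∑ k, ν k = n := by
    have := Finset.card_eq_sum_card_fiberwise (f := c) (s := Finset.univ) (t := Finset.univ)
      (fun _ _ => Finset.mem_univ _)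
    rw [Finset.card_univ, Fintype.card_fin] at this
    exact this.symm
  have e : ∀ k, Nonempty ({i // c i = k} ≃ {i // block ν hν i = k}) := fun k => by
    rw [← Fintype.card_eq, Fintype.card_subtype, Fintype.card_subtype, card_block]
  refine ⟨ν, hν, Equiv.ofFiberEquiv fun k => (e k).some, funext fun i => ?_⟩
  rw [← Equiv.ofFiberEquiv_map (fun k => (e k).some)]
  exact congrArg _ (Equiv.apply_symm_apply (Equiv.ofFiberEquiv fun k => (e k).some) i)

variable [Fintype G] {n : ℕ} {M : Type*} [AddCommGroup M] [Module F M]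
  {τ : WreathHecke F G n →ₐ[F] Module.End F M}

variable {ρ} in
-- Elements of `G ^ n` conjugate the group algebra at a position, which respects the two-sided ideal
-- annihilating a simple module; the `x_i` commute with it; and a simple reflection inside a block
-- exchanges two positions with the same label.
theorem HasWeight.blockHom {ν : Fin r → ℕ} {hν : ∑ k, ν k = n} (k : Fin r)
    (p : WreathHecke F G (ν k)) {v : M} (h : HasWeight ρ τ (block ν hν) v) :
    HasWeight ρ τ (block ν hν) (τ (WreathHecke.blockHom F G (offset_add_le ν hν k) p) v) := by
  let S : Subalgebra F (WreathHecke F G (ν k)) :=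
    { carrier := {p | ∀ v, HasWeight ρ τ (block ν hν) v →
        HasWeight ρ τ (block ν hν) (τ (WreathHecke.blockHom F G (offset_add_le ν hν k) p) v)}
      mul_mem' := fun {a b} ha hb v hv => by
        rw [map_mul, map_mul]
        exact ha _ (hb _ hv)
      add_mem' := fun {a b} ha hb v hv i c hc => by
        rw [map_add, map_add, LinearMap.add_apply, map_add, ha v hv i c hc, hb v hv i c hc,
          add_zero]
      algebraMap_mem' := fun c v hv i a ha => by
        rw [AlgHom.commutes, AlgHom.commutes, Module.algebraMap_end_apply, map_smul, hv i a ha,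
          smul_zero] }
  refine mem_of_forall_gen S (fun a v hv i b hb => ?_) p v h
  rw [WreathHecke.blockHom, lift_of]
  rcases a with g | j | ⟨j, hj⟩
  · set g' := Function.extend (shift (offset_add_le ν hν k)) g 1
    have e := grp_mul_posHom (F := F) g' i
      (MonoidAlgebra.of F G (g' i)⁻¹ * b * MonoidAlgebra.of F G (g' i))
    have e1 : MonoidAlgebra.of F G (g' i) * (MonoidAlgebra.of F G (g' i)⁻¹ * b
        * MonoidAlgebra.of F G (g' i)) * MonoidAlgebra.of F G (g' i)⁻¹ = b := by
      have h2 : MonoidAlgebra.of F G (g' i) * MonoidAlgebra.of F G (g' i)⁻¹ = 1 := by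
        rw [← map_mul, mul_inv_cancel, map_one]
      rw [mul_assoc, mul_assoc, h2, mul_one, ← mul_assoc, h2, one_mul]
    rw [e1] at e
    change τ (posHom F i b) (τ (of F (.grp g')) v) = 0
    rw [← Module.End.mul_apply, ← map_mul, ← e, map_mul, Module.End.mul_apply, hv i, map_zero]
    rw [map_mul, map_mul, hb, mul_zero, zero_mul]
  · change τ (posHom F i b) (τ (of F (.x _)) v) = 0
    rw [← Module.End.mul_apply, ← map_mul, ← x_mul_posHom, map_mul, Module.End.mul_apply,
      hv i b hb, map_zero]
  · have hn : (∑ l ∈ Finset.Iio k, ν l) + j + 1 < n := by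
      have := offset_add_le ν hν k
      omega
    change τ (posHom F i b) (τ (of F (.s ((∑ l ∈ Finset.Iio k, ν l) + j) hn)) v) = 0
    have hi : ∀ i, block ν hν (simpleTransposition ((∑ l ∈ Finset.Iio k, ν l) + j) hn i)
        = block ν hν i := by
      intro i
      rw [← youngHom_mulSingle hν k j hj hn]
      obtain ⟨l, i, rfl⟩ := exists_blockEquiv ν hν i
      rw [youngHom_apply, block_blockEquiv, block_blockEquiv]
    have e := s_mul_posHom (F := F) _ hn (simpleTransposition ((∑ l ∈ Finset.Iio k, ν l) + j) hn i) b
    rw [← Equiv.Perm.mul_apply, simpleTransposition_mul_self, Equiv.Perm.one_apply] at e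
    rw [← Module.End.mul_apply, ← map_mul, ← e, map_mul, Module.End.mul_apply, hv, map_zero]
    have hk : ∀ l, l = block ν hν i → (ρ l).asAlgebraHom b = 0 := by
      rintro _ rfl
      exact hb
    exact hk _ (hi i)

/-- Homomorphisms from the modules `W k` onto the cyclic modules generated by `v` under the
commuting tensor factors combine to a homomorphism from the external tensor product. -/
theorem exists_outerRep_hom_of_orbit {ν : Fin r → ℕ} {M : Type*} [AddCommGroup M] [Module F M]
    (τ : Parabolic F G ν →ₐ[F] Module.End F M) {v : M} (hv : v ≠ 0)
    {W : Fin r → Type*} [∀ k, AddCommGroup (W k)] [∀ k, Module F (W k)]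
    (σ : ∀ k, WreathHecke F G (ν k) →ₐ[F] Module.End F (W k))
    (f : ∀ k, W k →ₗ[F] WreathHecke F G (ν k) ⧸ annVec (τ.comp (factorHom F G k)) v)
    (hf : ∀ k p w, f k (σ k p w) = p • f k w) (hsurj : ∀ k, Function.Surjective (f k)) :
    ∃ Ψ : (⨂[F] k, W k) →ₗ[F] M, Ψ ≠ 0 ∧ ∀ b t, Ψ (outerRep σ b t) = τ b (Ψ t) := by
  classical
  let J := fun k => annVec (τ.comp (factorHom F G k)) v
  -- Linear sections of the quotient maps. The choice is immaterial because `Θ` depends on each slot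
  -- only modulo `J k`.
  have hS : ∀ k, ∃ S : (WreathHecke F G (ν k) ⧸ J k) →ₗ[F] WreathHecke F G (ν k),
      ∀ q, Submodule.Quotient.mk (S q) = q := fun k => by
    obtain ⟨S, hS⟩ := ((J k).mkQ.restrictScalars F).exists_rightInverse_of_surjective
      (LinearMap.range_eq_top.2 (J k).mkQ_surjective)
    exact ⟨S, fun q => LinearMap.congr_fun hS q⟩
  choose S hS using hS
  let Θ : Parabolic F G ν →ₗ[F] M := LinearMap.applyₗ v ∘ₗ τ.toLinearMap
  have hΘ : ∀ b, Θ b = τ b v := fun _ => rfl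
  have hmul : ∀ k (p : ∀ k, WreathHecke F G (ν k)) a,
      PiTensorProduct.tprod F (Function.update p k (a * p k))
        = factorHom F G k a * PiTensorProduct.tprod F p := by
    intro k p a
    rw [factorHom_apply, PiTensorProduct.tprod_mul_tprod]
    congr 1
    funext l
    rcases eq_or_ne l k with rfl | h
    · simp
    · simp [h]
  -- Different slots commute, so `a` can be made to act on `v` first.
  have hzero : ∀ k (p : ∀ k, WreathHecke F G (ν k)) a, a ∈ J k →
      Θ (PiTensorProduct.tprod F (Function.update p k a)) = 0 := by
    intro k p a ha
    have e : PiTensorProduct.tprod F (Function.update p k a)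
        = PiTensorProduct.tprod F (Function.update p k 1) * factorHom F G k a := by
      rw [factorHom_apply, PiTensorProduct.tprod_mul_tprod]
      congr 1
      funext l
      rcases eq_or_ne l k with rfl | h
      · simp
      · simp [h]
    rw [e, hΘ, map_mul, Module.End.mul_apply]
    exact (congrArg _ ha).trans (map_zero _)
  have hcongr : ∀ k (p : ∀ k, WreathHecke F G (ν k)) a a',
      (Submodule.Quotient.mk a : WreathHecke F G (ν k) ⧸ J k) = Submodule.Quotient.mk a' →
      Θ (PiTensorProduct.tprod F (Function.update p k a))
        = Θ (PiTensorProduct.tprod F (Function.update p k a')) := by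
    intro k p a a' h
    rw [← sub_eq_zero, ← map_sub, ← MultilinearMap.map_update_sub]
    exact hzero k p _ ((Submodule.Quotient.eq _).1 h)
  let Ψ : (⨂[F] k, W k) →ₗ[F] M := Θ ∘ₗ PiTensorProduct.map fun k => S k ∘ₗ f k
  have hΨ : ∀ w, Ψ (PiTensorProduct.tprod F w) = Θ (PiTensorProduct.tprod F fun k => S k (f k (w k))) := by
    intro w
    simp only [Ψ, LinearMap.comp_apply, PiTensorProduct.map_tprod]
  refine ⟨Ψ, fun h0 => hv ?_, parabolic_intertwine_of_gen (outerRep σ) τ Ψ fun k a t => ?_⟩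
  · choose w hw using fun k => hsurj k (Submodule.Quotient.mk 1)
    -- The slots are replaced by `1` one at a time, each replacement being a congruence modulo `J
    -- k`, until the unit acts on `v`.
    have h1 : ∀ s : Finset (Fin r),
        Θ (PiTensorProduct.tprod F (s.piecewise (fun k => S k (f k (w k))) 1)) = v := by
      intro s
      induction s using Finset.induction_on with
      | empty =>
        rw [Finset.piecewise_empty, ← PiTensorProduct.one_def, hΘ, map_one, Module.End.one_apply]
      | insert k s hk ih =>
        rw [Finset.piecewise_insert, hcongr k _ _ 1 (by rw [hS, hw])]
        refine Eq.trans ?_ ih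
        congr 2
        rw [Function.update_eq_self_iff]
        simp [hk]
    have h2 := h1 Finset.univ
    rw [Finset.piecewise_univ, ← hΨ, h0, LinearMap.zero_apply] at h2
    exact h2.symm
  · induction t using PiTensorProduct.induction_on with
    | smul_tprod c w =>
      rw [map_smul, map_smul, map_smul, map_smul]
      congr 1
      rw [outerRep_singleAlgHom, hΨ, hΨ, hΘ (PiTensorProduct.tprod F fun l => S l (f l (w l))), ← Module.End.mul_apply,
        ← map_mul, ← hmul, ← hΘ]
      have e : (fun l => S l (f l (Function.update w k (σ k (of F a) (w k)) l)))
          = Function.update (fun l => S l (f l (w l))) k (S k (f k (σ k (of F a) (w k)))) := by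
        funext l
        rcases eq_or_ne l k with rfl | h
        · simp
        · simp [h]
      rw [e]
      refine hcongr k _ _ _ ?_
      rw [hS, hf, ← smul_eq_mul, Submodule.Quotient.mk_smul, hS]
    | add s t hs ht => simp only [map_add, hs, ht]

end Exhaustion

section

variable {F : Type u} [Field F] [IsAlgClosed F] {G : Type v} [Group G] [Fintype G] {r : ℕ}
  {V : Fin r → Type w} [∀ k, AddCommGroup (V k)] [∀ k, Module F (V k)]
  [∀ k, FiniteDimensional F (V k)] (ρ : ∀ k, Representation F G (V k))
  [∀ k, (ρ k).IsIrreducible]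

/-- Every simple module is one of the modules `D_ν(L)`. -/
theorem exists_nonempty_equiv_D
    (hdistinct : ∀ k l, Nonempty ((ρ k).Equiv (ρ l)) → k = l)
    (hcomplete : ∀ (U : Type (max u v)) [AddCommGroup U] [Module F U] [FiniteDimensional F U]
      (σ : Representation F G U) [σ.IsIrreducible], ∃ k, Nonempty (σ.Equiv (ρ k)))
    (n : ℕ) (M : Type y) [AddCommGroup M] [Module (WreathHecke F G n) M]
    [IsSimpleModule (WreathHecke F G n) M] :
    ∃ (ν : Fin r → ℕ) (hν : ∑ k, ν k = n) (L : Fin r → Type u)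
      (_ : ∀ k, AddCommGroup (L k)) (_ : ∀ k, Module F (L k))
      (_ : ∀ k, Module (TwistedHecke (swapScalar (ρ k)) (ν k)) (L k))
      (_ : ∀ k, IsScalarTower F (TwistedHecke (swapScalar (ρ k)) (ν k)) (L k)),
      (∀ k, IsSimpleModule (TwistedHecke (swapScalar (ρ k)) (ν k)) (L k)) ∧
      Nonempty (M ≃ₗ[WreathHecke F G n] D ρ ν hν L) := by
  let _ : Module F M := Module.compHom M (algebraMap F (WreathHecke F G n))
  have : IsScalarTower F (WreathHecke F G n) M := ⟨fun c a m => by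
    change (c • a) • m = algebraMap F (WreathHecke F G n) c • a • m
    rw [Algebra.smul_def, mul_smul]⟩
  have hfin : FiniteDimensional F M := finiteDimensional_of_isSimpleModule (F := F) (G := G) (n := n) M
  let τ : WreathHecke F G n →ₐ[F] Module.End F M := Algebra.lsmul F F M
  have := IsSimpleModule.nontrivial (WreathHecke F G n) M
  obtain ⟨v₀, hv₀⟩ := exists_ne (0 : M)
  -- A vector generating a simple module at each position has a weight; the permutation `s` then
  -- brings the labels into block order.
  obtain ⟨v₁, hv₁, -, hgen₁⟩ := exists_forall_generatesSimple
    (fun i : Fin n => τ.comp (posHom F i))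
    (fun i j hij a b => Commute.map (posHom_commute hij a b) τ) (fun _ _ => inferInstance)
    (fun _ => True) (fun _ _ _ _ => trivial) hv₀ trivial
  have hc : ∀ i : Fin n, ∃ k, ∀ a, (ρ k).asAlgebraHom a = 0 → τ (posHom F i a) v₁ = 0 := fun i => by
    have := (hgen₁ i).isSimpleModule hv₁
    exact exists_asAlgebraHom_eq_zero_imp_mem ρ hcomplete (annVec (τ.comp (posHom F i)) v₁)
  choose c hc using hc
  obtain ⟨ν, hν, s, hs⟩ := exists_perm_of_card_fiber c
  have hw₁ : HasWeight ρ τ (block ν hν) (τ (permHom F G n s) v₁) := by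
    rw [← hs]
    exact HasWeight.permHom (c := c) hc s
  have hv₂ : τ (permHom F G n s) v₁ ≠ 0 := fun h => hv₁ (by
    have := congrArg (τ (permHom F G n s⁻¹)) h
    rwa [← Module.End.mul_apply, ← map_mul, ← map_mul, inv_mul_cancel, map_one, map_one,
      Module.End.one_apply, map_zero] at this)
  let τ' : Parabolic F G ν →ₐ[F] Module.End F M := τ.comp (parabolicHom F G ν hν)
  have hτ' : ∀ k p, τ' (factorHom F G k p) = τ (blockHom F G (offset_add_le ν hν k) p) :=
    fun k p => congrArg τ (parabolicHom_factorHom hν k p)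
  -- The second choice is made with respect to the block factors, with the weight as the property
  -- carried along.
  obtain ⟨v, hv, hw, hgen⟩ := exists_forall_generatesSimple
    (fun k : Fin r => τ'.comp (factorHom F G k))
    (fun k l hkl a b => Commute.map (factorHom_commute hkl a b) τ') (fun _ _ => inferInstance)
    (HasWeight ρ τ (block ν hν)) (fun k b v h => by
      rw [AlgHom.comp_apply, hτ']
      exact h.blockHom k b) hv₂ hw₁
  have hsimple := fun k => (hgen k).isSimpleModule hv
  -- The cyclic module of the `k`-th factor embeds in `M` by the orbit map. So it is finite
  -- dimensional, and by the block weight its positions act through `V k`, which is what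
  -- `exists_tensor_hom_ne_zero` requires.
  have hL := fun k => by
    have := hsimple k
    have := IsSimpleModule.nontrivial (WreathHecke F G (ν k))
      (WreathHecke F G (ν k) ⧸ annVec (τ'.comp (factorHom F G k)) v)
    have : FiniteDimensional F (WreathHecke F G (ν k) ⧸ annVec (τ'.comp (factorHom F G k)) v) :=
      FiniteDimensional.of_injective _ (orbitMap_injective (τ'.comp (factorHom F G k)) v)
    exact exists_tensor_hom_ne_zero (m := ν k) (ρ k)
      (Algebra.lsmul F F (WreathHecke F G (ν k) ⧸ annVec (τ'.comp (factorHom F G k)) v))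
      fun j a ha => by
        refine LinearMap.ext fun q => orbitMap_injective (τ'.comp (factorHom F G k)) v ?_
        obtain ⟨p, rfl⟩ := Submodule.Quotient.mk_surjective _ q
        change orbitMap (τ'.comp (factorHom F G k)) v (posHom F j a • _)
          = orbitMap (τ'.comp (factorHom F G k)) v 0
        rw [orbitMap_smul, orbitMap_mk, map_zero]
        change τ' (factorHom F G k (posHom F j a)) (τ' (factorHom F G k p) v) = 0
        rw [hτ', hτ', blockHom_posHom]
        refine hw.blockHom k p _ a ?_
        have hk : ∀ l, l = k → (ρ l).asAlgebraHom a = 0 := by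
          rintro _ rfl
          exact ha
        exact hk _ (block_blockEquiv ν hν k j)
  choose L i₁ i₂ i₃ i₄ hLs f hf0 hf using hL
  refine ⟨ν, hν, L, i₁, i₂, i₃, i₄, hLs, ?_⟩
  obtain ⟨Ψ, hΨ0, hΨ⟩ := exists_outerRep_hom_of_orbit τ' hv
    (fun k => (tensorRep (ρ k) (L k) : WreathHecke F G (ν k) →ₐ[F] _)) f hf fun k => by
      have := hsimple k
      let N : Submodule (WreathHecke F G (ν k))
          (WreathHecke F G (ν k) ⧸ annVec (τ'.comp (factorHom F G k)) v) :=
        { LinearMap.range (f k) with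
          smul_mem' := by
            rintro p _ ⟨w, rfl⟩
            exact ⟨_, hf k p w⟩ }
      have hN : N = ⊤ := (eq_bot_or_eq_top N).resolve_left fun h => hf0 k
        (LinearMap.ext fun w => by
          have : f k w ∈ N := ⟨w, rfl⟩
          rw [h] at this
          exact this)
      intro q
      have : q ∈ N := hN ▸ trivial
      exact this
  obtain ⟨ε, hε⟩ := exists_separating ρ hdistinct
  obtain ⟨e⟩ := nonempty_equiv_inducedModule hε hν (outerRep_posHom_eq_zero (ν := ν) ρ L)
    (isIrreducibleRep_outerRep_tensorRep (ν := ν) ρ L) Ψ hΨ0 hΨ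
  exact ⟨e.symm⟩

end

end WreathHecke

end

/-! ### The classification theorem -/

theorem mainTheorem2
    {F : Type u} [Field F] [IsAlgClosed F] {G : Type v} [Group G] [Fintype G] {r : ℕ}
    -- a complete set of pairwise non-isomorphic finite dimensional simple modules of the group
    {V : Fin r → Type w} [∀ k, AddCommGroup (V k)] [∀ k, Module F (V k)]
    [∀ k, FiniteDimensional F (V k)] (ρ : ∀ k, Representation F G (V k))
    [∀ k, (ρ k).IsIrreducible]
    (hdistinct : ∀ k l, Nonempty ((ρ k).Equiv (ρ l)) → k = l)
    (hcomplete : ∀ (U : Type (max u v)) [AddCommGroup U] [Module F U] [FiniteDimensional F U]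
      (σ : Representation F G U) [σ.IsIrreducible], ∃ k, Nonempty (σ.Equiv (ρ k)))
    (n : ℕ) :
    -- every simple module is one of the modules `D ν L`
    (∀ (M : Type y) [AddCommGroup M] [Module (WreathHecke F G n) M]
      [IsSimpleModule (WreathHecke F G n) M],
      ∃ (ν : Fin r → ℕ) (hν : ∑ k, ν k = n) (L : Fin r → Type u)
        (_ : ∀ k, AddCommGroup (L k)) (_ : ∀ k, Module F (L k))
        (_ : ∀ k, Module (TwistedHecke (swapScalar (ρ k)) (ν k)) (L k))
        (_ : ∀ k, IsScalarTower F (TwistedHecke (swapScalar (ρ k)) (ν k)) (L k)),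
        (∀ k, IsSimpleModule (TwistedHecke (swapScalar (ρ k)) (ν k)) (L k)) ∧
        Nonempty (M ≃ₗ[WreathHecke F G n] WreathHecke.D ρ ν hν L)) ∧
    -- the modules `D ν L` are simple
    (∀ (ν : Fin r → ℕ) (hν : ∑ k, ν k = n) (L : Fin r → Type z)
      [∀ k, AddCommGroup (L k)] [∀ k, Module F (L k)]
      [∀ k, Module (TwistedHecke (swapScalar (ρ k)) (ν k)) (L k)]
      [∀ k, IsScalarTower F (TwistedHecke (swapScalar (ρ k)) (ν k)) (L k)]
      [∀ k, IsSimpleModule (TwistedHecke (swapScalar (ρ k)) (ν k)) (L k)],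
      IsSimpleModule (WreathHecke F G n) (WreathHecke.D ρ ν hν L)) ∧
    -- isomorphic modules `D ν L`, `D ν' L'` have the same composition
    (∀ (ν ν' : Fin r → ℕ) (hν : ∑ k, ν k = n) (hν' : ∑ k, ν' k = n)
      (L : Fin r → Type z) (L' : Fin r → Type z')
      [∀ k, AddCommGroup (L k)] [∀ k, Module F (L k)]
      [∀ k, Module (TwistedHecke (swapScalar (ρ k)) (ν k)) (L k)]
      [∀ k, IsScalarTower F (TwistedHecke (swapScalar (ρ k)) (ν k)) (L k)]
      [∀ k, IsSimpleModule (TwistedHecke (swapScalar (ρ k)) (ν k)) (L k)]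
      [∀ k, AddCommGroup (L' k)] [∀ k, Module F (L' k)]
      [∀ k, Module (TwistedHecke (swapScalar (ρ k)) (ν' k)) (L' k)]
      [∀ k, IsScalarTower F (TwistedHecke (swapScalar (ρ k)) (ν' k)) (L' k)]
      [∀ k, IsSimpleModule (TwistedHecke (swapScalar (ρ k)) (ν' k)) (L' k)],
      Nonempty (WreathHecke.D ρ ν hν L ≃ₗ[WreathHecke F G n] WreathHecke.D ρ ν' hν' L') →
        ν = ν') ∧
    -- for a fixed composition, they are isomorphic exactly when all `L k`, `L' k` are
    (∀ (ν : Fin r → ℕ) (hν : ∑ k, ν k = n) (L : Fin r → Type z) (L' : Fin r → Type z')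
      [∀ k, AddCommGroup (L k)] [∀ k, Module F (L k)]
      [∀ k, Module (TwistedHecke (swapScalar (ρ k)) (ν k)) (L k)]
      [∀ k, IsScalarTower F (TwistedHecke (swapScalar (ρ k)) (ν k)) (L k)]
      [∀ k, IsSimpleModule (TwistedHecke (swapScalar (ρ k)) (ν k)) (L k)]
      [∀ k, AddCommGroup (L' k)] [∀ k, Module F (L' k)]
      [∀ k, Module (TwistedHecke (swapScalar (ρ k)) (ν k)) (L' k)]
      [∀ k, IsScalarTower F (TwistedHecke (swapScalar (ρ k)) (ν k)) (L' k)]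
      [∀ k, IsSimpleModule (TwistedHecke (swapScalar (ρ k)) (ν k)) (L' k)],
      Nonempty (WreathHecke.D ρ ν hν L ≃ₗ[WreathHecke F G n] WreathHecke.D ρ ν hν L') ↔
        ∀ k, Nonempty (L k ≃ₗ[TwistedHecke (swapScalar (ρ k)) (ν k)] L' k)) := by
  obtain ⟨ε, hε⟩ := WreathHecke.exists_separating ρ hdistinct
  refine ⟨fun M => WreathHecke.exists_nonempty_equiv_D ρ hdistinct hcomplete n M, ?_, ?_, ?_⟩
  · intro ν hν L _ _ _ _ _
    exact WreathHecke.isSimpleModule_inducedModule hε hν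
      (WreathHecke.outerRep_posHom_eq_zero (ν := ν) ρ L)
      (WreathHecke.isIrreducibleRep_outerRep_tensorRep (ν := ν) ρ L)
  · rintro ν ν' hν hν' L L' _ _ _ _ _ _ _ _ _ _ ⟨e⟩
    exact WreathHecke.eq_of_inducedModule_equiv hε hν
      (WreathHecke.outerRep_posHom_eq_zero (ν := ν) ρ L)
      (WreathHecke.isIrreducibleRep_outerRep_tensorRep (ν := ν) ρ L) hν'
      (WreathHecke.outerRep_posHom_eq_zero (ν := ν') ρ L') e
  · intro ν hν L L' _ _ _ _ _ _ _ _ _ _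
    exact WreathHecke.nonempty_D_equiv_iff ρ L L' hdistinct hν
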